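/- For a triangle $K$ and $u\in H^1(K)$ let $\Pi_{\rm CR}u|_K\in P_1(K)$ be the Crouzeix–Raviart interpolant, determined by $\int_e \Pi_{\rm CR}u|_K\,ds=\int_e u\,ds$ for each of the three edges $e$ of $K$ (in the sense of traces), and let $\Pi_h^0u|_K=\frac1{|K|}\int_K u\,dx$. (i) Let $K_1,K_2$ be two nondegenerate triangles in $\mathbb R^2$ which share an edge and whose union is a parallelogram. Then for every polynomial $w$ of degree at most $2$ and every polynomial $v$ of degree at most $1$, $$\int_{K_1\cup K_2}(w-\Pi_{\rm CR}w)(v-\Pi_h^0v)\,dx=0 .$$ (ii) Let $\Omega\subset\mathbb R^2$ be a bounded polygonal domain (open, connected, and equal to the interior of its closure) and let $\gamma>0$. There is a constant $C>0$, depending only on $\Omega$ and $\gamma$, such that the following holds. Let $\mathcal T_h$ be any conforming triangulation with $\bigcup_{K\in\mathcal T_h}K=\overline\Omega$ that is uniform, i.e. any two elements with a common edge form a parallelogram, and shape regular with parameter $\gamma$, i.e. each $K\in\mathcal T_h$ contains a disc of radius $h_K/\gamma$, where $h_K=\operatorname{diam}K$. Put $h=\max_{K\in\mathcal T_h}h_K$.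 Then for every $u\in H^3(\Omega)\cap H^1_0(\Omega)$, $$\Big|\int_\Omega(u-\Pi_{\rm CR}u)(u-\Pi_h^0u)\,dx\Big|\le C\,h^4\,|u|_{3,\Omega}^2 ,$$ where $\Pi_{\rm CR}$ and $\Pi_h^0$ are applied element by element and $|u|_{3,\Omega}$ is the $H^3(\Omega)$ semi-norm. -/

import Mathlib

open MeasureTheory Filter Topology
open scoped ContDiff

noncomputable section

/-- The Euclidean plane. -/
abbrev Plane : Type := EuclideanSpace ℝ (Fin 2)

namespace CRMesh

/-! ### Sobolev spaces on a set `U` (open in all uses), through weak derivatives -/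

/-- The classical partial derivative `∂f/∂xᵢ`. -/
def partialDeriv (i : Fin 2) (f : Plane → ℝ) : Plane → ℝ :=
  fun x => fderiv ℝ f x (EuclideanSpace.single i (1 : ℝ))

/-- The classical derivative `∂₁^{α₁} ∂₂^{α₂} f` for a multi-index `α = (α₁, α₂)`. -/
def mixedPartial (α : ℕ × ℕ) (f : Plane → ℝ) : Plane → ℝ :=
  (partialDeriv 0)^[α.1] ((partialDeriv 1)^[α.2] f)

/-- Test functions: smooth with compact support contained in `U`. -/
def IsTestFunction (U : Set Plane) (φ : Plane → ℝ) : Prop :=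
  ContDiff ℝ ∞ φ ∧ HasCompactSupport φ ∧ tsupport φ ⊆ U

/-- `g` is the weak derivative `∂^α u` in `U`. -/
def IsWeakDeriv (U : Set Plane) (α : ℕ × ℕ) (u g : Plane → ℝ) : Prop :=
  LocallyIntegrableOn u U ∧ LocallyIntegrableOn g U ∧
    ∀ φ, IsTestFunction U φ →
      ∫ x in U, u x * mixedPartial α φ x = (-1 : ℝ) ^ (α.1 + α.2) * ∫ x in U, g x * φ x

/-- `u ∈ H^k(U)`: `u` and its weak derivatives up to order `k` are square integrable on `U`. -/
def MemSobolev (k : ℕ) (U : Set Plane) (u : Plane → ℝ) : Prop :=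
  MemLp u 2 (volume.restrict U) ∧
    ∀ α : ℕ × ℕ, α.1 + α.2 ≤ k → ∃ g, MemLp g 2 (volume.restrict U) ∧ IsWeakDeriv U α u g

open Classical in
/-- The square integrable weak derivative `∂^α u` in `U` (unique almost everywhere in `U`);
zero if there is none. -/
def weakDeriv (U : Set Plane) (α : ℕ × ℕ) (u : Plane → ℝ) : Plane → ℝ :=
  if h : ∃ g, MemLp g 2 (volume.restrict U) ∧ IsWeakDeriv U α u g then h.choose else 0

/-- The Sobolev semi-norm `|u|_{k,U}`. -/
def sobolevSeminorm (k : ℕ) (U : Set Plane) (u : Plane → ℝ) : ℝ :=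
  Real.sqrt (∑ α ∈ Finset.HasAntidiagonal.antidiagonal k, ∫ x in U, weakDeriv U α u x ^ 2)

/-- The Sobolev norm `‖u‖_{k,U}`. -/
def sobolevNorm (k : ℕ) (U : Set Plane) (u : Plane → ℝ) : ℝ :=
  Real.sqrt (∑ j ∈ Finset.range (k + 1), sobolevSeminorm j U u ^ 2)

/-- `u ∈ H¹₀(U)`: `u` belongs to the closure of the test functions in `H¹(U)`. -/
def MemH10 (U : Set Plane) (u : Plane → ℝ) : Prop :=
  MemSobolev 1 U u ∧ ∃ φ : ℕ → Plane → ℝ, (∀ n, IsTestFunction U (φ n)) ∧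
    Tendsto (fun n => sobolevNorm 1 U (u - φ n)) atTop (𝓝 0)

/-! ### Triangles, triangulations -/

/-- `f` is the function of a real polynomial in two variables of total degree at most `r`. -/
def IsPoly (r : ℕ) (f : Plane → ℝ) : Prop :=
  ∃ p : MvPolynomial (Fin 2) ℝ, p.totalDegree ≤ r ∧ ∀ x, f x = MvPolynomial.eval (fun i => x i) p

/-- `K` is the vertex set of a nondegenerate triangle. -/
def IsTriangle (K : Finset Plane) : Prop :=
  K.card = 3 ∧ AffineIndependent ℝ ((↑) : K → Plane)

/-- The closed triangle with vertex set `K`. -/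
def elem (K : Finset Plane) : Set Plane := convexHull ℝ (K : Set Plane)

/-- The triangles `K` and `L` share an edge `[a, b]`, and their union is a parallelogram, that is,
its two diagonals (the common edge and the segment between the remaining vertices) bisect
each other. -/
def FormParallelogram (K L : Finset Plane) : Prop :=
  ∃ a b c d : Plane, (K : Set Plane) = {a, b, c} ∧ (L : Set Plane) = {a, b, d} ∧
    midpoint ℝ a b = midpoint ℝ c d

/-- A conforming triangulation covering `Ω` exactly: the elements are given by their vertex sets,
and two elements meet in the convex hull of their common vertices. -/
structure Triangulation (Ω : Set Plane) where
  elems : Finset (Finset Plane)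
  isTriangle : ∀ K ∈ elems, IsTriangle K
  conforming : ∀ K ∈ elems, ∀ L ∈ elems,
    elem K ∩ elem L ⊆ convexHull ℝ ((K : Set Plane) ∩ (L : Set Plane))
  cover : ⋃ K ∈ elems, elem K = closure Ω

/-- Any two adjacent elements (distinct elements with a common edge) form a parallelogram. -/
def Triangulation.Uniform {Ω : Set Plane} (T : Triangulation Ω) : Prop :=
  ∀ K ∈ T.elems, ∀ L ∈ T.elems, ((K : Set Plane) ∩ (L : Set Plane)).ncard = 2 →
    FormParallelogram K L

/-- The mesh size `h = max_K h_K`, with `h_K` the diameter of the element `K`. -/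
def Triangulation.meshSize {Ω : Set Plane} (T : Triangulation Ω) : ℝ :=
  ⨆ K : T.elems, Metric.diam (elem (K : Finset Plane))

/-- Shape regularity with parameter `γ`: each element `K` contains a disc of radius `h_K / γ`. -/
def Triangulation.ShapeRegular {Ω : Set Plane} (T : Triangulation Ω) (γ : ℝ) : Prop :=
  ∀ K ∈ T.elems, ∃ c : Plane, Metric.closedBall c (Metric.diam (elem K) / γ) ⊆ elem K

/-! ### The interpolation operators -/

/-- The integral `∫_e f ds` over the segment `e = [a, b]` of a continuous function `f`. -/
def segmentIntegral (f : Plane → ℝ) (a b : Plane) : ℝ :=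
  dist a b * ∫ t in (0 : ℝ)..1, f (AffineMap.lineMap a b t)

/-- `∫_e u ds = m` for the edge `e = [a, b]` of `K` and `u ∈ H¹(K)`, in the sense of traces: the
trace is the extension by continuity, in the `H¹(K)` norm, of the restriction of functions smooth
up to the boundary. -/
def HasEdgeIntegral (K : Finset Plane) (u : Plane → ℝ) (a b : Plane) (m : ℝ) : Prop :=
  MemSobolev 1 (interior (elem K)) u ∧ ∃ φ : ℕ → Plane → ℝ, (∀ n, ContDiff ℝ ∞ (φ n)) ∧
    Tendsto (fun n => sobolevNorm 1 (interior (elem K)) (u - φ n)) atTop (𝓝 0) ∧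
    Tendsto (fun n => segmentIntegral (φ n) a b) atTop (𝓝 m)

/-- `p` is the Crouzeix–Raviart interpolant of `u` on `K`: it lies in `P₁` and
`∫_e p ds = ∫_e u ds` for each edge `e` of `K`. -/
def IsCRInterpolant (K : Finset Plane) (u p : Plane → ℝ) : Prop :=
  IsPoly 1 p ∧ ∀ a ∈ K, ∀ b ∈ K, a ≠ b → HasEdgeIntegral K u a b (segmentIntegral p a b)

open Classical in
/-- The Crouzeix–Raviart interpolant of `u` on the triangle `K`; for `u ∈ H¹(K)` exactly one
interpolant exists. -/
def crInterpOn (K : Finset Plane) (u : Plane → ℝ) : Plane → ℝ :=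
  if h : ∃ p, IsCRInterpolant K u p then h.choose else 0

/-- The function equal to `F K` inside each element `K` of the collection `𝒯` (and zero on the null
set of points that lie inside no element); the elements are taken not to overlap. -/
def piecewise (𝒯 : Finset (Finset Plane)) (F : Finset Plane → Plane → ℝ) : Plane → ℝ :=
  fun x => ∑ K ∈ 𝒯, (interior (elem K)).indicator (F K) x

/-- The operator `Π_CR` over the elements in `𝒯`. -/
def PiCR (𝒯 : Finset (Finset Plane)) (u : Plane → ℝ) : Plane → ℝ :=
  piecewise 𝒯 fun K => crInterpOn K u

/-- The `L²` projection `Π_h⁰` onto piecewise constants over the elements in `𝒯`: on each element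
`K` the value is `|K|⁻¹ ∫_K u dx`. -/
def PiZero (𝒯 : Finset (Finset Plane)) (u : Plane → ℝ) : Plane → ℝ :=
  piecewise 𝒯 fun K _ => ⨍ x in elem K, u x

end CRMesh

end

open MeasureTheory Filter Topology
open scoped ContDiff

noncomputable section

namespace CRMesh

/-! ### Limits of integrals of products under mean-square convergence -/

section L2

variable {α : Type*} [MeasurableSpace α] {μ : Measure α}

/-! The orthogonality rests on a symmetry. If `K` and `L` form a parallelogram with common edge `[a,
b]`, the point reflection `x ↦ a + b - x` exchanges them. Crouzeix–Raviart interpolation commutes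
with the reflection and reproduces affine functions, and a quadratic function differs from its
reflection by an affine one. So the residual of a quadratic is even, while an affine function minus
its elementwise mean is odd, and the two integrals cancel (`errForm_add_errForm_eq_zero`).

No trace theory is needed to handle the interpolant. The mean of `u` over the edge opposite a vertex
`c` equals the mean over the triangle of `u + ½ ∇u · (x - c)` (`integral_edgeDensity_eq`), a
quantity continuous in `H¹`. Together with the density of smooth functions this gives existence,
uniqueness and a closed formula for the interpolant: its gradient is the mean of the gradient
(`crInterpOn_eq`).

For the global estimate, write `B K` for the contribution of an element. Poincaré's inequality on
convex sets gives `|B K| ≤ 4 h³ |u|₂ |u|₁` (`abs_errForm_le`), one power of `h` short. On a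
parallelogram, subtracting the quadratic with the mean Hessian and the affine function with the mean
gradient, and using the orthogonality, gains that power for `B K + B L`
(`abs_errForm_parallelogram_le`).

Summing over ordered pairs of neighbours counts `B K` twice for each neighbour of `K`. Every element
has at most three neighbours, and exactly three unless it meets the boundary, so the total is
controlled by the pair sums and a remainder carried by boundary elements
(`Triangulation.Uniform.abs_sum_le`). There the missing power of `h` comes from a strip estimate:
the squared `L²` norm over elements meeting the boundary is at most `C h` times the squared `H¹`
norm (`Triangulation.exists_sum_boundaryElems_normSq_le`).

It remains to bound `|u|₁` and `|u|₂` by `|u|₃`. Three applications of Poincaré's inequality on `Ω`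
bring `u` close to a quadratic `p`. Because `u` is an `H¹` limit of test functions, `p` is nearly
one too, and a compactness argument bounds `p`, since a quadratic in the closure of the test
functions vanishes on `∂Ω` and hence identically (`Triangulation.exists_energy_add_energy₂_le`). The
constants in these last two steps come from one fixed triangulation of `Ω`, never from the mesh
being estimated. -/

theorem _root_.MeasureTheory.MemLp.integrable_mul_two {f g : α → ℝ} (hf : MemLp f 2 μ)
    (hg : MemLp g 2 μ) : Integrable (fun x => f x * g x) μ :=
  hf.integrable_mul hg

theorem abs_integral_mul_le {f g : α → ℝ} (hf : MemLp f 2 μ) (hg : MemLp g 2 μ) :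
    |∫ x, f x * g x ∂μ| ≤ √(∫ x, f x ^ 2 ∂μ) * √(∫ x, g x ^ 2 ∂μ) := by
  have h2 : ENNReal.ofReal 2 = 2 := by norm_num
  have h := integral_mul_norm_le_Lp_mul_Lq (μ := μ) (f := f) (g := g) Real.HolderConjugate.two_two
    (by rwa [h2]) (by rwa [h2])
  calc |∫ x, f x * g x ∂μ| ≤ ∫ x, ‖f x‖ * ‖g x‖ ∂μ := by
        simpa [norm_mul] using norm_integral_le_integral_norm (μ := μ) (fun x => f x * g x)
    _ ≤ _ := by
        simpa [← Real.sqrt_eq_rpow, ← one_div] using h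

theorem sq_integral_mul_le {f g : α → ℝ} (hf : MemLp f 2 μ) (hg : MemLp g 2 μ) :
    (∫ x, f x * g x ∂μ) ^ 2 ≤ (∫ x, f x ^ 2 ∂μ) * (∫ x, g x ^ 2 ∂μ) := by
  have h := abs_integral_mul_le hf hg
  rw [← Real.sqrt_mul (integral_nonneg fun x => sq_nonneg _)] at h
  have h2 := pow_le_pow_left₀ (abs_nonneg _) h 2
  rwa [sq_abs, Real.sq_sqrt (mul_nonneg (integral_nonneg fun x => sq_nonneg _)
    (integral_nonneg fun x => sq_nonneg _))] at h2

theorem integral_add_sq_le {f g : α → ℝ} (hf : MemLp f 2 μ) (hg : MemLp g 2 μ) :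
    ∫ x, (f x + g x) ^ 2 ∂μ ≤ 2 * ∫ x, f x ^ 2 ∂μ + 2 * ∫ x, g x ^ 2 ∂μ := by
  rw [← integral_const_mul, ← integral_const_mul,
    ← integral_add (hf.integrable_sq.const_mul 2) (hg.integrable_sq.const_mul 2)]
  refine integral_mono (hf.add hg).integrable_sq
    ((hf.integrable_sq.const_mul 2).add (hg.integrable_sq.const_mul 2)) fun x => ?_
  nlinarith [sq_nonneg (f x - g x)]

theorem sq_integral_le [IsFiniteMeasure μ] {f : α → ℝ} (hf : MemLp f 2 μ) :
    (∫ x, f x ∂μ) ^ 2 ≤ μ.real Set.univ * ∫ x, f x ^ 2 ∂μ := by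
  have := sq_integral_mul_le hf (memLp_const (1 : ℝ) (μ := μ) (p := 2))
  simp only [mul_one, one_pow, integral_const, smul_eq_mul] at this
  linarith

theorem tendsto_integral_mul {f g : α → ℝ} {φ ψ : ℕ → α → ℝ} (hf : MemLp f 2 μ) (hg : MemLp g 2 μ)
    (hφ : ∀ n, MemLp (φ n) 2 μ) (hψ : ∀ n, MemLp (ψ n) 2 μ)
    (h1 : Tendsto (fun n => ∫ x, (f x - φ n x) ^ 2 ∂μ) atTop (𝓝 0))
    (h2 : Tendsto (fun n => ∫ x, (g x - ψ n x) ^ 2 ∂μ) atTop (𝓝 0)) :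
    Tendsto (fun n => ∫ x, φ n x * ψ n x ∂μ) atTop (𝓝 (∫ x, f x * g x ∂μ)) := by
  have s1 : Tendsto (fun n => √(∫ x, (f x - φ n x) ^ 2 ∂μ)) atTop (𝓝 0) := by
    simpa using h1.sqrt
  have s2 : Tendsto (fun n => √(∫ x, (g x - ψ n x) ^ 2 ∂μ)) atTop (𝓝 0) := by
    simpa using h2.sqrt
  have z : Tendsto (fun n => √(∫ x, (f x - φ n x) ^ 2 ∂μ) * √(∫ x, (g x - ψ n x) ^ 2 ∂μ)
      + √(∫ x, (f x - φ n x) ^ 2 ∂μ) * √(∫ x, g x ^ 2 ∂μ)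
      + √(∫ x, f x ^ 2 ∂μ) * √(∫ x, (g x - ψ n x) ^ 2 ∂μ)) atTop (𝓝 0) := by
    simpa using ((s1.mul s2).add (s1.mul_const _)).add (s2.const_mul _)
  rw [tendsto_iff_norm_sub_tendsto_zero]
  refine squeeze_zero (fun n => norm_nonneg _) (fun n => ?_) z
  have a : MemLp (fun x => f x - φ n x) 2 μ := hf.sub (hφ n)
  have b : MemLp (fun x => g x - ψ n x) 2 μ := hg.sub (hψ n)
  have c : Integrable (fun x => (f x - φ n x) * (g x - ψ n x) - (f x - φ n x) * g x) μ :=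
    (a.integrable_mul_two b).sub (a.integrable_mul_two hg)
  have e : ∫ x, φ n x * ψ n x ∂μ - ∫ x, f x * g x ∂μ
      = ∫ x, (f x - φ n x) * (g x - ψ n x) ∂μ - ∫ x, (f x - φ n x) * g x ∂μ
        - ∫ x, f x * (g x - ψ n x) ∂μ := by
    rw [← integral_sub ((hφ n).integrable_mul_two (hψ n)) (hf.integrable_mul_two hg),
      ← integral_sub (a.integrable_mul_two b) (a.integrable_mul_two hg),
      ← integral_sub c (hf.integrable_mul_two b)]
    congr 1 with x
    ring
  rw [e, Real.norm_eq_abs]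
  have i1 := abs_integral_mul_le a b
  have i2 := abs_integral_mul_le a hg
  have i3 := abs_integral_mul_le hf b
  refine (abs_sub _ _).trans (add_le_add ((abs_sub _ _).trans (add_le_add i1 i2)) i3)

theorem tendsto_integral_sq {f : α → ℝ} {φ : ℕ → α → ℝ} (hf : MemLp f 2 μ)
    (hφ : ∀ n, MemLp (φ n) 2 μ)
    (h1 : Tendsto (fun n => ∫ x, (f x - φ n x) ^ 2 ∂μ) atTop (𝓝 0)) :
    Tendsto (fun n => ∫ x, φ n x ^ 2 ∂μ) atTop (𝓝 (∫ x, f x ^ 2 ∂μ)) := by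
  simpa only [pow_two] using tendsto_integral_mul hf hf hφ hφ h1 h1

theorem tendsto_integral_mul_right {f g : α → ℝ} {φ : ℕ → α → ℝ} (hf : MemLp f 2 μ)
    (hg : MemLp g 2 μ) (hφ : ∀ n, MemLp (φ n) 2 μ)
    (h1 : Tendsto (fun n => ∫ x, (f x - φ n x) ^ 2 ∂μ) atTop (𝓝 0)) :
    Tendsto (fun n => ∫ x, φ n x * g x ∂μ) atTop (𝓝 (∫ x, f x * g x ∂μ)) :=
  tendsto_integral_mul hf hg hφ (fun _ => hg) h1 (by simp)

theorem tendsto_integral_of_sq [IsFiniteMeasure μ] {f : α → ℝ} {φ : ℕ → α → ℝ} (hf : MemLp f 2 μ)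
    (hφ : ∀ n, MemLp (φ n) 2 μ)
    (h1 : Tendsto (fun n => ∫ x, (f x - φ n x) ^ 2 ∂μ) atTop (𝓝 0)) :
    Tendsto (fun n => ∫ x, φ n x ∂μ) atTop (𝓝 (∫ x, f x ∂μ)) := by
  simpa using tendsto_integral_mul_right hf (memLp_const (1 : ℝ)) hφ h1

end L2

/-! ### Smooth functions and their partial derivatives -/

theorem contDiff_partialDeriv (i : Fin 2) {φ : Plane → ℝ} (hφ : ContDiff ℝ ∞ φ) :
    ContDiff ℝ ∞ (partialDeriv i φ) :=
  (hφ.fderiv_right (m := ∞) (by simp)).clm_apply contDiff_const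

theorem partialDeriv_comm (i j : Fin 2) {φ : Plane → ℝ} (hφ : ContDiff ℝ ∞ φ) :
    partialDeriv i (partialDeriv j φ) = partialDeriv j (partialDeriv i φ) := by
  funext x
  have hd : Differentiable ℝ (fderiv ℝ φ) :=
    (hφ.fderiv_right (m := ∞) (by simp)).differentiable (by simp)
  have hs : IsSymmSndFDerivAt ℝ φ x :=
    hφ.contDiffAt.isSymmSndFDerivAt (by
      rw [minSmoothness_of_isRCLikeNormedField]; exact WithTop.coe_le_coe.2 le_top)
  have key : ∀ v w : Plane, fderiv ℝ (fun y => fderiv ℝ φ y v) x w = fderiv ℝ (fderiv ℝ φ) x w v := by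
    intro v w
    rw [fderiv_clm_apply (hd x) (differentiableAt_const v)]
    simp
  unfold partialDeriv
  rw [key, key]
  exact hs _ _

theorem IsTestFunction.partialDeriv {U : Set Plane} {φ : Plane → ℝ} (hφ : IsTestFunction U φ)
    (i : Fin 2) : IsTestFunction U (partialDeriv i φ) := by
  have hs : tsupport (CRMesh.partialDeriv i φ) ⊆ tsupport φ := by
    refine closure_minimal (fun x hx => ?_) isClosed_closure
    by_contra h
    refine hx ?_
    unfold CRMesh.partialDeriv
    rw [fderiv_of_notMem_tsupport (𝕜 := ℝ) h]
    rfl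
  exact ⟨contDiff_partialDeriv i hφ.1, hφ.2.1.of_isClosed_subset isClosed_closure hs,
    hs.trans hφ.2.2⟩

theorem contDiff_iterate_partialDeriv (i : Fin 2) (n : ℕ) {φ : Plane → ℝ} (hφ : ContDiff ℝ ∞ φ) :
    ContDiff ℝ ∞ ((CRMesh.partialDeriv i)^[n] φ) := by
  induction n with
  | zero => exact hφ
  | succ n ih => rw [Function.iterate_succ_apply']; exact contDiff_partialDeriv i ih

/-- The multi-index of the partial derivative `∂/∂xᵢ`. -/
def unitIndex (i : Fin 2) : ℕ × ℕ := if i = 0 then (1, 0) else (0, 1)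

/-- `mixedPartial` applies the derivatives in the second variable first, so an extra `∂₁` has to be
commuted past all of them. This is what links weak derivatives of consecutive orders. -/
theorem mixedPartial_partialDeriv (α : ℕ × ℕ) (i : Fin 2) {φ : Plane → ℝ} (hφ : ContDiff ℝ ∞ φ) :
    mixedPartial α (CRMesh.partialDeriv i φ) = mixedPartial (α + unitIndex i) φ := by
  have hc : ∀ n, (CRMesh.partialDeriv 1)^[n] (CRMesh.partialDeriv 0 φ)
      = CRMesh.partialDeriv 0 ((CRMesh.partialDeriv 1)^[n] φ) := by
    intro n
    induction n with
    | zero => rfl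
    | succ n ih =>
      rw [Function.iterate_succ_apply', ih, Function.iterate_succ_apply',
        partialDeriv_comm 1 0 (contDiff_iterate_partialDeriv 1 n hφ)]
  fin_cases i
  · simp only [mixedPartial, unitIndex, Fin.zero_eta, if_true, Prod.fst_add, Prod.snd_add, add_zero]
    rw [hc, Function.iterate_succ_apply]
  · simp [mixedPartial, unitIndex, Function.iterate_succ_apply]

theorem IsTestFunction.continuous {U : Set Plane} {φ : Plane → ℝ} (hφ : IsTestFunction U φ) :
    Continuous φ := hφ.1.continuous

theorem IsTestFunction.memLp {U : Set Plane} {φ : Plane → ℝ} (hφ : IsTestFunction U φ)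
    (μ : Measure Plane) [IsFiniteMeasureOnCompacts μ] : MemLp φ 2 μ :=
  hφ.continuous.memLp_of_hasCompactSupport hφ.2.1

theorem IsTestFunction.mono {U V : Set Plane} (h : V ⊆ U) {φ : Plane → ℝ}
    (hφ : IsTestFunction V φ) : IsTestFunction U φ := ⟨hφ.1, hφ.2.1, hφ.2.2.trans h⟩

theorem IsTestFunction.eq_zero {U : Set Plane} {φ : Plane → ℝ} (hφ : IsTestFunction U φ) {x : Plane}
    (hx : x ∉ U) : φ x = 0 :=
  image_eq_zero_of_notMem_tsupport fun h => hx (hφ.2.2 h)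

/-- Lets identities for weak derivatives pass between an open set, a subset of it and the whole
plane. -/
theorem IsTestFunction.setIntegral_mul {U V : Set Plane} (hVU : V ⊆ U) {φ : Plane → ℝ}
    (hφ : IsTestFunction V φ) (f : Plane → ℝ) :
    ∫ x in U, f x * φ x = ∫ x in V, f x * φ x := by
  rw [setIntegral_eq_integral_of_forall_compl_eq_zero fun x hx => ?_,
    setIntegral_eq_integral_of_forall_compl_eq_zero fun x hx => ?_]
  · rw [hφ.eq_zero hx, mul_zero]
  · rw [hφ.eq_zero fun h => hx (hVU h), mul_zero]

theorem memLp_of_continuous_of_isBounded {U : Set Plane} (hU : Bornology.IsBounded U)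
    {f : Plane → ℝ} (hf : Continuous f) : MemLp f 2 (volume.restrict U) := by
  have hc : IsCompact (closure U) := hU.isCompact_closure
  have hfin : IsFiniteMeasure (volume.restrict (closure U)) := ⟨by simpa using hc.measure_lt_top⟩
  obtain ⟨C, hC⟩ := hc.exists_bound_of_continuousOn hf.continuousOn
  exact (MemLp.of_bound hf.aestronglyMeasurable C
    (ae_restrict_of_forall_mem isClosed_closure.measurableSet hC)).mono_measure
    (Measure.restrict_mono subset_closure le_rfl)

/-! ### Weak gradients -/

/-- `f` and the components of `g` are square integrable on `U`, and `g` is the weak gradient of `f`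
in `U`. -/
structure HasGrad (U : Set Plane) (f : Plane → ℝ) (g : Fin 2 → Plane → ℝ) : Prop where
  memLp : MemLp f 2 (volume.restrict U)
  grad_memLp : ∀ i, MemLp (g i) 2 (volume.restrict U)
  ibp : ∀ i φ, IsTestFunction U φ →
    ∫ x in U, f x * partialDeriv i φ x = -∫ x in U, g i x * φ x

theorem integral_partialDeriv_eq_neg {f φ : Plane → ℝ} (hf : ContDiff ℝ ∞ f) (i : Fin 2)
    (hφ : ContDiff ℝ ∞ φ) (hc : HasCompactSupport φ) :
    ∫ x, f x * partialDeriv i φ x = -∫ x, partialDeriv i f x * φ x := by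
  have hφ' := (show IsTestFunction Set.univ φ from ⟨hφ, hc, Set.subset_univ _⟩)
  refine integral_mul_fderiv_eq_neg_fderiv_mul_of_integrable ?_ ?_ ?_
    (fun x _ => (hf.differentiable (by simp)) x) (fun x _ => (hφ.differentiable (by simp)) x)
  · exact ((contDiff_partialDeriv i hf).continuous.mul hφ.continuous).integrable_of_hasCompactSupport
      hc.mul_left
  · exact (hf.continuous.mul (contDiff_partialDeriv i hφ).continuous).integrable_of_hasCompactSupport
      (hφ'.partialDeriv i).2.1.mul_left
  · exact (hf.continuous.mul hφ.continuous).integrable_of_hasCompactSupport hc.mul_left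

theorem hasGrad_of_contDiff {U : Set Plane} (hU : Bornology.IsBounded U) {f : Plane → ℝ}
    (hf : ContDiff ℝ ∞ f) : HasGrad U f (fun i => partialDeriv i f) where
  memLp := memLp_of_continuous_of_isBounded hU hf.continuous
  grad_memLp i := memLp_of_continuous_of_isBounded hU (contDiff_partialDeriv i hf).continuous
  ibp i φ hφ := by
    rw [← (hφ.partialDeriv i).setIntegral_mul (Set.subset_univ U),
      ← hφ.setIntegral_mul (Set.subset_univ U), Measure.restrict_univ]
    exact integral_partialDeriv_eq_neg hf i hφ.1 hφ.2.1

theorem hasGrad_const {U : Set Plane} (hU : Bornology.IsBounded U) (c : ℝ) :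
    HasGrad U (fun _ => c) (fun _ _ => 0) := by
  have h := hasGrad_of_contDiff hU (contDiff_const (c := c))
  have e : (fun i => partialDeriv i fun _ : Plane => c) = fun _ _ => (0 : ℝ) := by
    funext i x
    simp [partialDeriv]
  rwa [e] at h

namespace HasGrad

variable {U V : Set Plane} {f f' : Plane → ℝ} {g g' : Fin 2 → Plane → ℝ}

theorem mono (h : HasGrad U f g) (hV : V ⊆ U) : HasGrad V f g where
  memLp := h.memLp.mono_measure (Measure.restrict_mono hV le_rfl)
  grad_memLp i := (h.grad_memLp i).mono_measure (Measure.restrict_mono hV le_rfl)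
  ibp i φ hφ := by
    rw [← (hφ.partialDeriv i).setIntegral_mul hV, ← hφ.setIntegral_mul hV]
    exact h.ibp i φ (hφ.mono hV)

theorem add (h : HasGrad U f g) (h' : HasGrad U f' g') :
    HasGrad U (fun x => f x + f' x) (fun i x => g i x + g' i x) where
  memLp := h.memLp.add h'.memLp
  grad_memLp i := (h.grad_memLp i).add (h'.grad_memLp i)
  ibp i φ hφ := by
    have p := hφ.memLp (volume.restrict U)
    have q := (hφ.partialDeriv i).memLp (volume.restrict U)
    simp only [add_mul]
    rw [integral_add (h.memLp.integrable_mul_two q) (h'.memLp.integrable_mul_two q),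
      integral_add ((h.grad_memLp i).integrable_mul_two p) ((h'.grad_memLp i).integrable_mul_two p),
      h.ibp i φ hφ, h'.ibp i φ hφ, neg_add]

theorem const_mul (h : HasGrad U f g) (c : ℝ) :
    HasGrad U (fun x => c * f x) (fun i x => c * g i x) where
  memLp := h.memLp.const_mul c
  grad_memLp i := (h.grad_memLp i).const_mul c
  ibp i φ hφ := by
    simp only [mul_assoc]
    rw [integral_const_mul, integral_const_mul, h.ibp i φ hφ, mul_neg]

theorem sub (h : HasGrad U f g) (h' : HasGrad U f' g') :
    HasGrad U (fun x => f x - f' x) (fun i x => g i x - g' i x) := by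
  simpa [sub_eq_add_neg] using h.add (h'.const_mul (-1))

theorem sub_const (hU : Bornology.IsBounded U) (h : HasGrad U f g) (c : ℝ) :
    HasGrad U (fun x => f x - c) g := by
  simpa using h.sub (hasGrad_const hU c)

theorem congr (h : HasGrad U f g) (hf : f =ᵐ[volume.restrict U] f')
    (hg : ∀ i, g i =ᵐ[volume.restrict U] g' i) : HasGrad U f' g' where
  memLp := h.memLp.ae_eq hf
  grad_memLp i := (h.grad_memLp i).ae_eq (hg i)
  ibp i φ hφ := by
    rw [← integral_congr_ae (hf.mono fun x hx => by simp only [hx] :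
        (fun x => f x * partialDeriv i φ x) =ᵐ[volume.restrict U] fun x => f' x * partialDeriv i φ x),
      ← integral_congr_ae ((hg i).mono fun x hx => by simp only [hx] :
        (fun x => g i x * φ x) =ᵐ[volume.restrict U] fun x => g' i x * φ x)]
    exact h.ibp i φ hφ

end HasGrad

theorem locallyIntegrableOn_of_memLp {U : Set Plane} {f : Plane → ℝ}
    (hf : MemLp f 2 (volume.restrict U)) : LocallyIntegrableOn f U :=
  locallyIntegrableOn_of_locallyIntegrable_restrict (hf.locallyIntegrable (by norm_num))

/-- The fundamental lemma of the calculus of variations. It makes weak derivatives unique almost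
everywhere, so the choice inside `weakDeriv` does not affect any integral. -/
theorem ae_eq_of_forall_integral_mul_testFunction {U : Set Plane} (hU : IsOpen U) {f g : Plane → ℝ}
    (hf : MemLp f 2 (volume.restrict U)) (hg : MemLp g 2 (volume.restrict U))
    (h : ∀ φ, IsTestFunction U φ → ∫ x in U, f x * φ x = ∫ x in U, g x * φ x) :
    f =ᵐ[volume.restrict U] g := by
  have key := hU.ae_eq_zero_of_integral_contDiff_smul_eq_zero (μ := volume) (f := fun x => f x - g x)
    (locallyIntegrableOn_of_memLp (hf.sub hg)) fun φ h1 h2 h3 => by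
      have hφ : IsTestFunction U φ := ⟨h1, h2, h3⟩
      have p := hφ.memLp (volume.restrict U)
      have e := hφ.setIntegral_mul (Set.subset_univ U) (fun x => f x - g x)
      rw [Measure.restrict_univ] at e
      simp only [smul_eq_mul, mul_comm (φ _)]
      rw [e]
      simp only [sub_mul]
      rw [integral_sub (hf.integrable_mul_two p) (hg.integrable_mul_two p), h φ hφ, sub_self]
  rw [Filter.EventuallyEq, ae_restrict_iff' hU.measurableSet]
  exact key.mono fun x hx hxU => sub_eq_zero.1 (hx hxU)

/-! ### Comparison with the iterated weak derivatives -/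

theorem isWeakDeriv_zero_iff {U : Set Plane} {f g : Plane → ℝ}
    (hf : MemLp f 2 (volume.restrict U)) (hg : MemLp g 2 (volume.restrict U)) :
    IsWeakDeriv U (0, 0) f g ↔ ∀ φ, IsTestFunction U φ → ∫ x in U, f x * φ x = ∫ x in U, g x * φ x := by
  simp [IsWeakDeriv, locallyIntegrableOn_of_memLp hf, locallyIntegrableOn_of_memLp hg, mixedPartial]

theorem isWeakDeriv_unitIndex_iff {U : Set Plane} {f g : Plane → ℝ} (i : Fin 2)
    (hf : MemLp f 2 (volume.restrict U)) (hg : MemLp g 2 (volume.restrict U)) :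
    IsWeakDeriv U (unitIndex i) f g ↔ ∀ φ, IsTestFunction U φ →
      ∫ x in U, f x * partialDeriv i φ x = -∫ x in U, g x * φ x := by
  fin_cases i <;>
  simp [IsWeakDeriv, locallyIntegrableOn_of_memLp hf, locallyIntegrableOn_of_memLp hg, mixedPartial,
    unitIndex]

theorem IsWeakDeriv.ae_eq {U : Set Plane} (hU : IsOpen U) {α : ℕ × ℕ} {f g g' : Plane → ℝ}
    (hg : MemLp g 2 (volume.restrict U)) (hg' : MemLp g' 2 (volume.restrict U))
    (h : IsWeakDeriv U α f g) (h' : IsWeakDeriv U α f g') : g =ᵐ[volume.restrict U] g' :=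
  ae_eq_of_forall_integral_mul_testFunction hU hg hg' fun φ hφ => by
    have e := (h.2.2 φ hφ).symm.trans (h'.2.2 φ hφ)
    exact mul_left_cancel₀ (pow_ne_zero _ (by norm_num)) e

theorem weakDeriv_spec {U : Set Plane} {α : ℕ × ℕ} {f : Plane → ℝ}
    (h : ∃ g, MemLp g 2 (volume.restrict U) ∧ IsWeakDeriv U α f g) :
    MemLp (weakDeriv U α f) 2 (volume.restrict U) ∧ IsWeakDeriv U α f (weakDeriv U α f) := by
  unfold weakDeriv
  rw [dif_pos h]
  exact h.choose_spec

theorem weakDeriv_ae_eq {U : Set Plane} (hU : IsOpen U) {α : ℕ × ℕ} {f g : Plane → ℝ}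
    (hg : MemLp g 2 (volume.restrict U)) (h : IsWeakDeriv U α f g) :
    weakDeriv U α f =ᵐ[volume.restrict U] g := by
  have s := weakDeriv_spec ⟨g, hg, h⟩
  exact s.2.ae_eq hU s.1 hg h

theorem memSobolev_one_iff {U : Set Plane} {f : Plane → ℝ} :
    MemSobolev 1 U f ↔ ∃ g, HasGrad U f g := by
  constructor
  · rintro ⟨hf, h⟩
    have h' := fun i : Fin 2 => h (unitIndex i) (by fin_cases i <;> simp [unitIndex])
    choose g hg hw using h'
    exact ⟨g, hf, hg, fun i => (isWeakDeriv_unitIndex_iff i hf (hg i)).1 (hw i)⟩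
  · rintro ⟨g, h⟩
    refine ⟨h.memLp, fun α hα => ?_⟩
    obtain ⟨a, b⟩ := α
    have : (a, b) = (0, 0) ∨ (a, b) = unitIndex 0 ∨ (a, b) = unitIndex 1 := by
      simp only [unitIndex, Prod.mk.injEq, if_true, one_ne_zero, if_false] at hα ⊢
      omega
    rcases this with e | e | e <;> rw [e]
    · exact ⟨f, h.memLp, (isWeakDeriv_zero_iff h.memLp h.memLp).2 fun _ _ => rfl⟩
    · exact ⟨g 0, h.grad_memLp 0, (isWeakDeriv_unitIndex_iff 0 h.memLp (h.grad_memLp 0)).2 (h.ibp 0)⟩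
    · exact ⟨g 1, h.grad_memLp 1, (isWeakDeriv_unitIndex_iff 1 h.memLp (h.grad_memLp 1)).2 (h.ibp 1)⟩

/-- By uniqueness the chosen derivatives in the definition of the norm may be replaced by any weak
gradient at hand. -/
theorem HasGrad.sobolevNorm_one {U : Set Plane} (hU : IsOpen U) {f : Plane → ℝ}
    {g : Fin 2 → Plane → ℝ} (h : HasGrad U f g) :
    sobolevNorm 1 U f = √((∫ x in U, f x ^ 2) + ((∫ x in U, g 0 x ^ 2) + ∫ x in U, g 1 x ^ 2)) := by
  have e0 := weakDeriv_ae_eq hU h.memLp ((isWeakDeriv_zero_iff h.memLp h.memLp).2 fun _ _ => rfl)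
  have e1 := fun i => weakDeriv_ae_eq hU (h.grad_memLp i)
    ((isWeakDeriv_unitIndex_iff i h.memLp (h.grad_memLp i)).2 (h.ibp i))
  have sq : ∀ {a b : Plane → ℝ}, a =ᵐ[volume.restrict U] b →
      ∫ x in U, a x ^ 2 = ∫ x in U, b x ^ 2 := fun hab =>
    integral_congr_ae (hab.mono fun x hx => by simp only [hx])
  have nn : ∀ a : Plane → ℝ, 0 ≤ ∫ x in U, a x ^ 2 := fun a => integral_nonneg fun x => sq_nonneg _
  have a0 : (1, 0) = unitIndex 0 := rfl
  have a1 : (0, 1) = unitIndex 1 := rfl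
  have A0 : Finset.HasAntidiagonal.antidiagonal 0 = {((0 : ℕ), (0 : ℕ))} := rfl
  have A1 : Finset.HasAntidiagonal.antidiagonal 1 = {((0 : ℕ), (1 : ℕ)), (1, 0)} := rfl
  unfold sobolevNorm sobolevSeminorm
  rw [Finset.sum_range_succ, Finset.sum_range_one, A0, A1, Finset.sum_singleton,
    Finset.sum_pair (by simp), Real.sq_sqrt (nn _), Real.sq_sqrt (add_nonneg (nn _) (nn _)), a0, a1,
    sq e0, sq (e1 0), sq (e1 1), add_comm (∫ x in U, g 1 x ^ 2)]

/-- Test the definition of `∂^α u` with `∂ᵢφ` and that of the next derivative with `φ`, then cancel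
the common sign. Thus membership in `H³` becomes a tower of first-order statements, and only
`HasGrad` is used afterwards. -/
theorem MemSobolev.hasGrad_weakDeriv {k : ℕ} {U : Set Plane} {f : Plane → ℝ} (h : MemSobolev k U f)
    (α : ℕ × ℕ) (hα : α.1 + α.2 + 1 ≤ k) :
    HasGrad U (weakDeriv U α f) (fun i => weakDeriv U (α + unitIndex i) f) where
  memLp := (weakDeriv_spec (h.2 α (by omega))).1
  grad_memLp i := (weakDeriv_spec (h.2 (α + unitIndex i) (by
    fin_cases i <;> simp [unitIndex] <;> omega))).1
  ibp i φ hφ := by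
    have s1 := (weakDeriv_spec (h.2 α (by omega))).2.2.2 _ (hφ.partialDeriv i)
    have s2 := (weakDeriv_spec (h.2 (α + unitIndex i) (by
      fin_cases i <;> simp [unitIndex] <;> omega))).2.2.2 _ hφ
    rw [mixedPartial_partialDeriv α i hφ.1] at s1
    have e := s1.symm.trans s2
    have hi : (α + unitIndex i).1 + (α + unitIndex i).2 = α.1 + α.2 + 1 := by
      fin_cases i <;> simp [unitIndex] <;> omega
    rw [hi, pow_succ, mul_assoc] at e
    have e2 := mul_left_cancel₀ (pow_ne_zero _ (by norm_num)) e
    linarith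

theorem MemSobolev.weakDeriv_zero_ae_eq {k : ℕ} {U : Set Plane} (hU : IsOpen U) {f : Plane → ℝ}
    (h : MemSobolev k U f) : weakDeriv U (0, 0) f =ᵐ[volume.restrict U] f :=
  weakDeriv_ae_eq hU h.1 ((isWeakDeriv_zero_iff h.1 h.1).2 fun _ _ => rfl)

/-! ### Mollification and density of smooth functions in `H¹` of a convex set -/

/-- The convolution of `F` with the normed bump function `ρ`. -/
def mollify (ρ : ContDiffBump (0 : Plane)) (F : Plane → ℝ) (x : Plane) : ℝ :=
  ∫ t, F t * ρ.normed volume (x - t)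

theorem mollify_eq_convolution (ρ : ContDiffBump (0 : Plane)) (F : Plane → ℝ) :
    mollify ρ F = convolution F (ρ.normed volume) (ContinuousLinearMap.lsmul ℝ ℝ) volume := rfl

theorem mollify_apply (ρ : ContDiffBump (0 : Plane)) (F : Plane → ℝ) (x : Plane) :
    mollify ρ F x = ∫ t, ρ.normed volume t * F (x - t) := by
  unfold mollify
  rw [← integral_sub_left_eq_self _ volume x]
  simp [mul_comm]

theorem locallyIntegrable_of_memLp {F : Plane → ℝ} (hF : MemLp F 2 volume) :
    LocallyIntegrable F volume := hF.locallyIntegrable (by norm_num)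

theorem contDiff_mollify (ρ : ContDiffBump (0 : Plane)) {F : Plane → ℝ} (hF : MemLp F 2 volume) :
    ContDiff ℝ ∞ (mollify ρ F) := by
  rw [mollify_eq_convolution]
  exact ρ.hasCompactSupport_normed.contDiff_convolution_right _ (locallyIntegrable_of_memLp hF)
    ρ.contDiff_normed

theorem memLp_comp_sub_left {F : Plane → ℝ} (hF : MemLp F 2 volume) (x : Plane) :
    MemLp (fun t => F (x - t)) 2 volume :=
  hF.comp_measurePreserving (Measure.measurePreserving_sub_left volume x)

/-- Jensen's inequality for the probability density `ρ`, obtained from Cauchy–Schwarz by splitting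
`ρ = √ρ · √ρ`. Integrated, it says that mollification is an `L²` contraction. -/
theorem sq_mollify_le (ρ : ContDiffBump (0 : Plane)) {F : Plane → ℝ} (hF : MemLp F 2 volume)
    (x : Plane) : mollify ρ F x ^ 2 ≤ mollify ρ (fun y => F y ^ 2) x := by
  have hc : Continuous fun t => √(ρ.normed volume t) := ρ.continuous_normed.sqrt
  have hs : HasCompactSupport fun t => √(ρ.normed volume t) :=
    ρ.hasCompactSupport_normed.comp_left Real.sqrt_zero
  have h1 : MemLp (fun t => √(ρ.normed volume t)) 2 (volume : Measure Plane) :=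
    hc.memLp_of_hasCompactSupport hs
  obtain ⟨C, hC⟩ := hs.exists_bound_of_continuous hc
  have h2 : MemLp (fun t => √(ρ.normed volume t) * F (x - t)) 2 (volume : Measure Plane) :=
    (memLp_comp_sub_left hF x).of_le_mul
      (hc.aestronglyMeasurable.mul (memLp_comp_sub_left hF x).aestronglyMeasurable)
      (Eventually.of_forall fun t => by rw [norm_mul]; gcongr; exact hC t)
  have h := sq_integral_mul_le h1 h2
  have e1 : ∀ t, √(ρ.normed volume t) * (√(ρ.normed volume t) * F (x - t))
      = ρ.normed volume t * F (x - t) := fun t => by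
    rw [← mul_assoc, Real.mul_self_sqrt (ρ.nonneg_normed t)]
  have e2 : ∀ t, (√(ρ.normed volume t) * F (x - t)) ^ 2 = ρ.normed volume t * F (x - t) ^ 2 :=
    fun t => by rw [mul_pow, Real.sq_sqrt (ρ.nonneg_normed t)]
  simp only [e1, e2, Real.sq_sqrt (ρ.nonneg_normed _), ρ.integral_normed, one_mul] at h
  rwa [mollify_apply, mollify_apply]

theorem integrable_mollify (ρ : ContDiffBump (0 : Plane)) {F : Plane → ℝ}
    (hF : Integrable F volume) : Integrable (mollify ρ F) volume :=
  hF.integrable_convolution (ContinuousLinearMap.lsmul ℝ ℝ)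
    (ρ.continuous_normed.integrable_of_hasCompactSupport ρ.hasCompactSupport_normed)

theorem integral_mollify (ρ : ContDiffBump (0 : Plane)) {F : Plane → ℝ}
    (hF : Integrable F volume) : ∫ x, mollify ρ F x = ∫ x, F x := by
  have h := integral_convolution (μ := volume) (ν := volume) (ContinuousLinearMap.lsmul ℝ ℝ) hF
    ((ρ.continuous_normed (μ := volume)).integrable_of_hasCompactSupport
      ρ.hasCompactSupport_normed)
  rw [ρ.integral_normed] at h
  exact h.trans (by simp)

theorem memLp_mollify (ρ : ContDiffBump (0 : Plane)) {F : Plane → ℝ} (hF : MemLp F 2 volume) :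
    MemLp (mollify ρ F) 2 volume := by
  have hm := (contDiff_mollify ρ hF).continuous.aestronglyMeasurable (μ := volume)
  refine (memLp_two_iff_integrable_sq hm).2 ?_
  refine (integrable_mollify ρ hF.integrable_sq).mono' (hm.pow 2) (Eventually.of_forall fun x => ?_)
  rw [Real.norm_of_nonneg (sq_nonneg _)]
  exact sq_mollify_le ρ hF x

theorem integral_sq_mollify_le (ρ : ContDiffBump (0 : Plane)) {F : Plane → ℝ}
    (hF : MemLp F 2 volume) : ∫ x, mollify ρ F x ^ 2 ≤ ∫ x, F x ^ 2 := by
  rw [← integral_mollify ρ hF.integrable_sq]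
  exact integral_mono (memLp_mollify ρ hF).integrable_sq (integrable_mollify ρ hF.integrable_sq)
    (sq_mollify_le ρ hF)

theorem mollify_sub (ρ : ContDiffBump (0 : Plane)) {F G : Plane → ℝ} (hF : MemLp F 2 volume)
    (hG : MemLp G 2 volume) (x : Plane) :
    mollify ρ (fun y => F y - G y) x = mollify ρ F x - mollify ρ G x := by
  have hρ : MemLp (ρ.normed volume) 2 (volume : Measure Plane) :=
    ρ.continuous_normed.memLp_of_hasCompactSupport ρ.hasCompactSupport_normed
  simp only [mollify_apply, mul_sub]
  exact integral_sub (hρ.integrable_mul_two (memLp_comp_sub_left hF x))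
    (hρ.integrable_mul_two (memLp_comp_sub_left hG x))

theorem dist_mollify_le (ρ : ContDiffBump (0 : Plane)) {G : Plane → ℝ} (hG : Continuous G)
    {x : Plane} {ε : ℝ} (h : ∀ y ∈ Metric.ball x ρ.rOut, dist (G y) (G x) ≤ ε) :
    dist (mollify ρ G x) (G x) ≤ ε := by
  have := ContDiffBump.dist_normed_convolution_le (φ := ρ) (μ := volume)
    hG.aestronglyMeasurable h
  rw [convolution_def] at this
  rw [mollify_apply]
  exact this

/-- The homothety with centre `x₀` and ratio `l`. -/
def dilate (x₀ : Plane) (l : ℝ) (x : Plane) : Plane := l • x + (1 - l) • x₀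

theorem integral_comp_dilate (x₀ : Plane) {l : ℝ} (F : Plane → ℝ) :
    ∫ x, F (dilate x₀ l x) = (l ^ 2)⁻¹ * ∫ x, F x := by
  have h := Measure.integral_comp_smul (volume : Measure Plane) (fun z => F (z + (1 - l) • x₀)) l
  rw [integral_add_right_eq_self (fun z => F z)] at h
  unfold dilate
  rw [h]
  simp

theorem integrable_comp_dilate (x₀ : Plane) {l : ℝ} (hl : l ≠ 0) {F : Plane → ℝ}
    (hF : Integrable F) : Integrable fun x => F (dilate x₀ l x) :=
  (hF.comp_add_right ((1 - l) • x₀)).comp_smul hl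

theorem continuous_dilate (x₀ : Plane) (l : ℝ) : Continuous (dilate x₀ l) := by
  unfold dilate; fun_prop

theorem contDiff_dilate (x₀ : Plane) (l : ℝ) : ContDiff ℝ ∞ (dilate x₀ l) := by
  unfold dilate; fun_prop

theorem dilate_sub (x₀ : Plane) (l : ℝ) (x : Plane) : dilate x₀ l x - x = (1 - l) • (x₀ - x) := by
  unfold dilate
  module

theorem memLp_comp_dilate (x₀ : Plane) {l : ℝ} (hl : l ≠ 0) {F : Plane → ℝ}
    (hm : Continuous F) (hF : MemLp F 2 volume) : MemLp (fun x => F (dilate x₀ l x)) 2 volume := by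
  have := (hm.comp (continuous_dilate x₀ l)).aestronglyMeasurable (μ := volume)
  exact (memLp_two_iff_integrable_sq this).2 (integrable_comp_dilate x₀ hl hF.integrable_sq)

/-- If a convex set contains a ball about `x₀`, then it contains a ball about each of the points of
its image under a homothety with centre `x₀`. -/
theorem ball_dilate_subset {U : Set Plane} (hU : Convex ℝ U) {x₀ : Plane} {r : ℝ}
    (hr : Metric.ball x₀ r ⊆ U) {l : ℝ} (h0 : 0 ≤ l) (h1 : l < 1) {x : Plane} (hx : x ∈ U) :
    Metric.ball (dilate x₀ l x) ((1 - l) * r) ⊆ U := by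
  intro w hw
  have hl : 0 < 1 - l := by linarith
  have hz : x₀ + (1 - l)⁻¹ • (w - dilate x₀ l x) ∈ U := by
    refine hr ?_
    rw [Metric.mem_ball, dist_eq_norm] at hw ⊢
    rw [add_sub_cancel_left, norm_smul, norm_inv, Real.norm_of_nonneg hl.le, inv_mul_lt_iff₀ hl]
    exact hw
  have := hU hx hz h0 hl.le (by ring)
  convert this using 1
  rw [smul_add, smul_inv_smul₀ hl.ne']
  unfold dilate
  module

/-- Approximate `F` in `L²` by a continuous compactly supported `G`. For `G` uniform continuity
handles both the mollification and the dilation; the error `F - G` survives both operations up to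
the Jacobian `l⁻² ≤ 4`. The threshold `δ` is uniform in the bump and the ratio, which can then tend
to their limits together. -/
theorem integral_sub_mollify_dilate_le {U : Set Plane} (hU : MeasurableSet U)
    (hb : Bornology.IsBounded U)
    (x₀ : Plane) {F : Plane → ℝ} (hF : MemLp F 2 volume) {ε : ℝ} (hε : 0 < ε) :
    ∃ δ > 0, ∀ ρ : ContDiffBump (0 : Plane), ρ.rOut < δ → ∀ l : ℝ, 1 / 2 ≤ l → l ≤ 1 → 1 - l < δ →
      ∫ x in U, (F x - mollify ρ F (dilate x₀ l x)) ^ 2 ≤ ε := by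
  obtain ⟨R, hR⟩ := hb.subset_closedBall x₀
  have hfin : IsFiniteMeasure (volume.restrict U) := ⟨by simpa using hb.measure_lt_top⟩
  have hV : 0 ≤ (volume.restrict U).real Set.univ := measureReal_nonneg
  set V := (volume.restrict U).real Set.univ with hVdef
  obtain ⟨G, hGs, hFG, hGc, hG⟩ := (show MemLp F (ENNReal.ofReal 2) volume by
    simpa using hF).exists_hasCompactSupport_integral_rpow_sub_le
    (p := 2) (by norm_num) (ε := ε / 40) (by positivity)
  replace hG : MemLp G 2 volume := by simpa using hG
  replace hFG : ∫ x, (F x - G x) ^ 2 ≤ ε / 40 := by simpa using hFG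
  have hD : MemLp (fun x => F x - G x) 2 volume := hF.sub hG
  -- A pointwise error `κ` on `U` costs at most `V κ² ≤ ε / 8`; the `+ 1` avoids dividing by zero
  -- when `V = 0`.
  set κ := √(ε / (8 * (V + 1))) with hκ
  have hκ0 : 0 < κ := Real.sqrt_pos.2 (by positivity)
  have hκ2 : V * κ ^ 2 ≤ ε / 8 := by
    rw [hκ, Real.sq_sqrt (by positivity), mul_div_assoc', div_le_div_iff₀ (by positivity) (by norm_num)]
    nlinarith
  obtain ⟨δ₀, hδ₀, hu⟩ := Metric.uniformContinuous_iff.1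
    (hGs.uniformContinuous_of_continuous hGc) (κ / 2) (by positivity)
  set R' := max R 0 + 1 with hR'
  have hR'0 : 0 < R' := by positivity
  -- The first bound limits the radius of mollification, the second the displacement `(1 - l) ‖x₀ -
  -- x‖` caused by the dilation.
  refine ⟨min δ₀ (δ₀ / R'), by positivity, fun ρ hρ l hl hl1 hlδ => ?_⟩
  have hl0 : l ≠ 0 := by linarith
  have hb : ∀ x ∈ U, |G x - mollify ρ G (dilate x₀ l x)| ≤ κ := by
    intro x hx
    have h1 : dist (mollify ρ G (dilate x₀ l x)) (G (dilate x₀ l x)) ≤ κ / 2 :=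
      dist_mollify_le ρ hGc fun y hy => (hu ((Metric.mem_ball.1 hy).trans
        (hρ.trans_le (min_le_left _ _)))).le
    have h2 : dist (G (dilate x₀ l x)) (G x) < κ / 2 := by
      refine hu ?_
      rw [dist_eq_norm, dilate_sub, norm_smul, Real.norm_of_nonneg (by linarith)]
      have h3 : ‖x₀ - x‖ < R' := by
        rw [← dist_eq_norm, dist_comm]
        exact (hR hx).trans_lt ((le_max_left _ _).trans_lt (lt_add_one _))
      calc (1 - l) * ‖x₀ - x‖ ≤ (1 - l) * R' := by gcongr
        _ < δ₀ / R' * R' := by gcongr; exact hlδ.trans_le (min_le_right _ _)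
        _ = δ₀ := by field_simp
    have h4 := dist_triangle_right (G x) (mollify ρ G (dilate x₀ l x)) (G (dilate x₀ l x))
    rw [Real.dist_eq] at h4
    rw [dist_comm] at h2
    linarith
  have mG := memLp_comp_dilate x₀ hl0 (contDiff_mollify ρ hG).continuous (memLp_mollify ρ hG)
  have mD := memLp_comp_dilate x₀ hl0 (contDiff_mollify ρ hD).continuous (memLp_mollify ρ hD)
  have r1 := hD.restrict U
  have r2 : MemLp (fun x => G x - mollify ρ G (dilate x₀ l x)) 2 (volume.restrict U) :=
    (hG.sub mG).restrict U
  have r3 : MemLp (fun x => -mollify ρ (fun y => F y - G y) (dilate x₀ l x)) 2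
    (volume.restrict U) := (mD.restrict U).neg
  have b1 : ∫ x in U, (F x - G x) ^ 2 ≤ ε / 40 :=
    (setIntegral_le_integral hD.integrable_sq (Eventually.of_forall fun x => sq_nonneg _)).trans hFG
  have b2 : ∫ x in U, (G x - mollify ρ G (dilate x₀ l x)) ^ 2 ≤ ε / 8 := by
    refine le_trans ?_ hκ2
    rw [hVdef, ← smul_eq_mul, ← integral_const]
    refine integral_mono_ae r2.integrable_sq (integrable_const _) ?_
    refine (ae_restrict_mem hU).mono fun x hx => ?_
    exact sq_le_sq' (abs_le.1 (hb x hx)).1 (abs_le.1 (hb x hx)).2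
  have b3 : ∫ x in U, (-mollify ρ (fun y => F y - G y) (dilate x₀ l x)) ^ 2 ≤ ε / 10 := by
    simp only [neg_sq]
    refine (setIntegral_le_integral mD.integrable_sq
      (Eventually.of_forall fun x => sq_nonneg _)).trans ?_
    rw [integral_comp_dilate x₀ (fun z => mollify ρ (fun y => F y - G y) z ^ 2)]
    have h1 := (integral_sq_mollify_le ρ hD).trans hFG
    have h2 : (l ^ 2)⁻¹ ≤ 4 := by
      rw [inv_le_comm₀ (by positivity) (by norm_num)]
      nlinarith
    have h3 : 0 ≤ ∫ x, mollify ρ (fun y => F y - G y) x ^ 2 := integral_nonneg fun x => sq_nonneg _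
    calc _ ≤ 4 * (ε / 40) := by gcongr
      _ = ε / 10 := by ring
  have e : ∀ x, F x - mollify ρ F (dilate x₀ l x) = (F x - G x) +
      ((G x - mollify ρ G (dilate x₀ l x)) + -mollify ρ (fun y => F y - G y) (dilate x₀ l x)) := by
    intro x
    rw [mollify_sub ρ hF hG]
    ring
  simp only [e]
  have i1 := integral_add_sq_le r1 (r2.add r3)
  have i2 := integral_add_sq_le r2 r3
  simp only [Pi.add_apply] at i1
  linarith

theorem partialDeriv_mollify (ρ : ContDiffBump (0 : Plane)) {F : Plane → ℝ} (hF : MemLp F 2 volume)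
    (i : Fin 2) (z : Plane) :
    partialDeriv i (mollify ρ F) z = ∫ t, F t * partialDeriv i (ρ.normed volume) (z - t) := by
  have hl := locallyIntegrable_of_memLp hF
  have hd := (ρ.hasCompactSupport_normed (μ := volume)).hasFDerivAt_convolution_right
    (ContinuousLinearMap.lsmul ℝ ℝ) hl (ρ.contDiff_normed (n := 1)) z
  rw [partialDeriv, mollify_eq_convolution, hd.fderiv, convolution_precompR_apply _ hl
    ((ρ.hasCompactSupport_normed (μ := volume)).fderiv ℝ)
    ((ρ.contDiff_normed (μ := volume) (n := 1)).continuous_fderiv (by simp))]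
  rfl

theorem isTestFunction_normed_sub (ρ : ContDiffBump (0 : Plane)) {U : Set Plane} {z : Plane}
    (hz : Metric.closedBall z ρ.rOut ⊆ U) :
    IsTestFunction U (fun t => ρ.normed volume (z - t)) := by
  have hs : tsupport (fun t => ρ.normed volume (z - t)) ⊆ Metric.closedBall z ρ.rOut := by
    refine closure_minimal (fun t ht => ?_) Metric.isClosed_closedBall
    have : z - t ∈ tsupport (ρ.normed volume) := subset_tsupport _ ht
    rw [ρ.tsupport_normed_eq, mem_closedBall_zero_iff, ← dist_eq_norm, dist_comm] at this
    exact this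
  exact ⟨ρ.contDiff_normed.comp (contDiff_const.sub contDiff_id),
    (isCompact_closedBall z ρ.rOut).of_isClosed_subset isClosed_closure hs, hs.trans hz⟩

/-- Inside `U`, away from the boundary, the gradient of the mollification is the mollification of
the weak gradient. -/
theorem HasGrad.partialDeriv_mollify {U : Set Plane} (hU : IsOpen U) {f : Plane → ℝ}
    {g : Fin 2 → Plane → ℝ} (h : HasGrad U f g) (ρ : ContDiffBump (0 : Plane)) {z : Plane}
    (hz : Metric.closedBall z ρ.rOut ⊆ U) (i : Fin 2) :
    partialDeriv i (mollify ρ (U.indicator f)) z = mollify ρ (U.indicator (g i)) z := by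
  rw [CRMesh.partialDeriv_mollify ρ ((memLp_indicator_iff_restrict hU.measurableSet).2 h.memLp),
    mollify]
  have e := h.ibp i _ (isTestFunction_normed_sub ρ hz)
  have d : ∀ t, CRMesh.partialDeriv i (fun t => ρ.normed volume (z - t)) t
      = -CRMesh.partialDeriv i (ρ.normed volume) (z - t) := by
    intro t
    unfold CRMesh.partialDeriv
    have h1 : HasFDerivAt (fun t : Plane => z - t) (-ContinuousLinearMap.id ℝ Plane) t :=
      (hasFDerivAt_id t).const_sub z
    have h2 := ((ρ.contDiff_normed (n := 1)).differentiable (by simp) (z - t)).hasFDerivAt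
      (𝕜 := ℝ) (f := ρ.normed volume)
    have h3 : HasFDerivAt (fun t => ρ.normed volume (z - t)) _ t := h2.comp t h1
    rw [h3.fderiv]
    simp
  simp only [d, mul_neg, integral_neg, neg_inj] at e
  have ind : ∀ (a b : Plane → ℝ), ∫ t, U.indicator a t * b t = ∫ t in U, a t * b t := by
    intro a b
    rw [← integral_indicator hU.measurableSet]
    congr 1 with t
    by_cases ht : t ∈ U <;> simp [ht]
  rw [ind, ind]
  exact e

/-- Functions smooth up to the boundary are dense in `H¹` of a bounded convex open set. -/
theorem HasGrad.exists_smooth_approx {U : Set Plane} (hU : IsOpen U) (hb : Bornology.IsBounded U)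
    (hc : Convex ℝ U) (hne : U.Nonempty) {f : Plane → ℝ} {g : Fin 2 → Plane → ℝ}
    (h : HasGrad U f g) : ∃ φ : ℕ → Plane → ℝ, (∀ n, ContDiff ℝ ∞ (φ n)) ∧
      Tendsto (fun n => ∫ x in U, (f x - φ n x) ^ 2) atTop (𝓝 0) ∧
      ∀ i, Tendsto (fun n => ∫ x in U, (g i x - partialDeriv i (φ n) x) ^ 2) atTop (𝓝 0) := by
  obtain ⟨x₀, hx₀⟩ := hne
  obtain ⟨r, hr, hrU⟩ := Metric.isOpen_iff.1 hU x₀ hx₀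
  have hF : MemLp (U.indicator f) 2 volume :=
    (memLp_indicator_iff_restrict hU.measurableSet).2 h.memLp
  have hG := fun i => (memLp_indicator_iff_restrict hU.measurableSet).2 (h.grad_memLp i)
  let l : ℕ → ℝ := fun n => 1 - 1 / ((n : ℝ) + 2)
  have hl : ∀ n, 1 - l n = 1 / ((n : ℝ) + 2) := fun n => by simp [l]
  have hl2 : ∀ n, 1 / 2 ≤ l n := fun n => by
    have : 1 / ((n : ℝ) + 2) ≤ 1 / 2 := by gcongr; linarith [n.cast_nonneg (α := ℝ)]
    have := hl n
    linarith
  have hl1 : ∀ n, l n < 1 := fun n => by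
    have : 0 < 1 / ((n : ℝ) + 2) := by positivity
    have := hl n
    linarith
  have hlim : Tendsto (fun n => 1 - l n) atTop (𝓝 0) := by
    simp only [hl]
    exact tendsto_const_nhds.div_atTop (tendsto_natCast_atTop_atTop.atTop_add tendsto_const_nhds)
  -- By convexity a ball of radius `(1 - l) r` about each dilated point lies in `U`. With half that
  -- radius the mollification at such a point sees only values of `f` inside `U`, so its gradient is
  -- the mollified weak gradient.
  let ρ : ℕ → ContDiffBump (0 : Plane) := fun n =>
    ⟨(1 - l n) * r / 4, (1 - l n) * r / 2,
      by have := sub_pos.2 (hl1 n); positivity,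
      by have := mul_pos (sub_pos.2 (hl1 n)) hr; linarith⟩
  have hρ : ∀ n, (ρ n).rOut = (1 - l n) * r / 2 := fun n => rfl
  have hρlim : Tendsto (fun n => (ρ n).rOut) atTop (𝓝 0) := by
    simpa [hρ] using (hlim.mul_const r).div_const 2
  have key : ∀ F : Plane → ℝ, MemLp F 2 volume → Tendsto
      (fun n => ∫ x in U, (F x - mollify (ρ n) F (dilate x₀ (l n) x)) ^ 2) atTop (𝓝 0) := by
    intro F hF
    rw [Metric.tendsto_atTop]
    intro ε hε
    obtain ⟨δ, hδ, H⟩ := integral_sub_mollify_dilate_le hU.measurableSet hb x₀ hF (half_pos hε)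
    obtain ⟨N, hN⟩ := eventually_atTop.1 ((hρlim.eventually_lt_const hδ).and
      (hlim.eventually_lt_const hδ))
    refine ⟨N, fun n hn => ?_⟩
    have := H (ρ n) (hN n hn).1 (l n) (hl2 n) (hl1 n).le (hN n hn).2
    rw [Real.dist_eq, sub_zero, abs_of_nonneg (integral_nonneg fun x => sq_nonneg _)]
    linarith
  refine ⟨fun n x => mollify (ρ n) (U.indicator f) (dilate x₀ (l n) x), fun n =>
    (contDiff_mollify _ hF).comp (contDiff_dilate _ _), ?_, fun i => ?_⟩
  · refine (key _ hF).congr fun n => ?_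
    refine setIntegral_congr_fun hU.measurableSet fun x hx => ?_
    simp only [Set.indicator_of_mem hx]
  · have hd : ∀ n, ∀ x ∈ U,
        partialDeriv i (fun x => mollify (ρ n) (U.indicator f) (dilate x₀ (l n) x)) x
        = l n * mollify (ρ n) (U.indicator (g i)) (dilate x₀ (l n) x) := by
      intro n x hx
      have hball : Metric.closedBall (dilate x₀ (l n) x) (ρ n).rOut ⊆ U :=
        (Metric.closedBall_subset_ball (by
          rw [hρ]; have := mul_pos (sub_pos.2 (hl1 n)) hr; linarith)).trans
          (ball_dilate_subset hc hrU (by linarith [hl2 n]) (hl1 n) hx)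
      rw [← h.partialDeriv_mollify hU (ρ n) hball i]
      unfold CRMesh.partialDeriv
      have h1 : HasFDerivAt (dilate x₀ (l n)) (l n • ContinuousLinearMap.id ℝ Plane) x := by
        unfold dilate
        exact ((hasFDerivAt_id x).const_smul (l n)).add_const _
      have h2 := ((contDiff_mollify (ρ n) hF).differentiable (by simp)
        (dilate x₀ (l n) x)).hasFDerivAt
      rw [show (fun x => mollify (ρ n) (U.indicator f) (dilate x₀ (l n) x))
        = mollify (ρ n) (U.indicator f) ∘ dilate x₀ (l n) from rfl, (h2.comp x h1).fderiv]
      simp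
    -- The chain rule puts a factor `l` in front of the mollified gradient; the error is split as `l
    -- (g - mollified g) + (1 - l) g`.
    have lim : Tendsto (fun n => 2 * (l n ^ 2 * ∫ x in U, (U.indicator (g i) x -
        mollify (ρ n) (U.indicator (g i)) (dilate x₀ (l n) x)) ^ 2)
        + 2 * ((1 - l n) ^ 2 * ∫ x in U, g i x ^ 2)) atTop (𝓝 0) := by
      have hlt : Tendsto l atTop (𝓝 1) := by simpa using hlim.const_sub 1
      simpa using (((hlt.pow 2).mul (key _ (hG i))).const_mul 2).add
        (((hlim.pow 2).mul_const (∫ x in U, g i x ^ 2)).const_mul 2)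
    refine squeeze_zero (fun n => integral_nonneg fun x => sq_nonneg _) (fun n => ?_) lim
    have hl0 : l n ≠ 0 := by linarith [hl2 n]
    have m1 : MemLp (fun x => U.indicator (g i) x -
        mollify (ρ n) (U.indicator (g i)) (dilate x₀ (l n) x)) 2 (volume.restrict U) :=
      ((hG i).sub (memLp_comp_dilate x₀ hl0 (contDiff_mollify _ (hG i)).continuous
        (memLp_mollify _ (hG i)))).restrict U
    have i1 := integral_add_sq_le (m1.const_mul (l n)) ((h.grad_memLp i).const_mul (1 - l n))
    simp only [mul_pow, integral_const_mul] at i1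
    refine le_trans (le_of_eq ?_) i1
    refine setIntegral_congr_fun hU.measurableSet fun x hx => ?_
    simp only [hd n x hx, Set.indicator_of_mem hx]
    ring

/-! ### The Poincaré inequality on convex sets -/

/-- The squared `L²(U)` norm. -/
def normSq (U : Set Plane) (f : Plane → ℝ) : ℝ := ∫ x in U, f x ^ 2

/-- The squared `L²(U)` norm of a vector field. -/
def energy (U : Set Plane) (g : Fin 2 → Plane → ℝ) : ℝ := ∑ i, normSq U (g i)

theorem normSq_nonneg (U : Set Plane) (f : Plane → ℝ) : 0 ≤ normSq U f :=
  integral_nonneg fun _ => sq_nonneg _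

theorem energy_nonneg (U : Set Plane) (g : Fin 2 → Plane → ℝ) : 0 ≤ energy U g :=
  Finset.sum_nonneg fun _ _ => normSq_nonneg _ _

theorem isFiniteMeasure_restrict_of_isBounded {U : Set Plane} (hb : Bornology.IsBounded U) :
    IsFiniteMeasure (volume.restrict U) := ⟨by simpa using hb.measure_lt_top⟩

theorem integrable_of_continuous_of_isBounded {U : Set Plane} (hb : Bornology.IsBounded U)
    {f : Plane → ℝ} (hf : Continuous f) : Integrable f (volume.restrict U) :=
  (hf.locallyIntegrable.integrableOn_isCompact hb.isCompact_closure).mono_set subset_closure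

theorem integrable_prod_of_continuous_of_isBounded {U : Set Plane} (hb : Bornology.IsBounded U)
    {F : Plane × Plane → ℝ} (hF : Continuous F) :
    Integrable F ((volume.restrict U).prod (volume.restrict U)) := by
  rw [Measure.prod_restrict]
  exact (hF.locallyIntegrable.integrableOn_isCompact (hb.prod hb).isCompact_closure).mono_set
    subset_closure

theorem hasDerivAt_comp_segment {φ : Plane → ℝ} (hφ : ContDiff ℝ ∞ φ) (x y : Plane) (t : ℝ) :
    HasDerivAt (fun t => φ (dilate y t x))
      (∑ i, partialDeriv i φ (dilate y t x) * (x i - y i)) t := by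
  have h1 : HasDerivAt (fun t : ℝ => dilate y t x) (x - y) t := by
    have h2 : HasDerivAt (fun t : ℝ => t • (x - y) + y) (x - y) t := by
      simpa using ((hasDerivAt_id t).smul_const (x - y)).add_const y
    convert h2 using 2 with t
    unfold dilate
    module
  have h3 := ((hφ.differentiable (by simp)) (dilate y t x)).hasFDerivAt.comp_hasDerivAt t h1
  refine h3.congr_deriv ?_
  have e : x - y = ∑ i, (x i - y i) • EuclideanSpace.single i (1 : ℝ) := by
    ext j
    fin_cases j <;> simp [Fin.sum_univ_two]
  conv_lhs => rw [e]
  simp [partialDeriv, mul_comm]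

/-- The squared length of the classical gradient. -/
def gradSq (φ : Plane → ℝ) (x : Plane) : ℝ := ∑ i, partialDeriv i φ x ^ 2

theorem gradSq_nonneg (φ : Plane → ℝ) (x : Plane) : 0 ≤ gradSq φ x :=
  Finset.sum_nonneg fun _ _ => sq_nonneg _

theorem continuous_gradSq {φ : Plane → ℝ} (hφ : ContDiff ℝ ∞ φ) : Continuous (gradSq φ) :=
  continuous_finsetSum _ fun i _ => (contDiff_partialDeriv i hφ).continuous.pow 2

theorem continuous_dilate_uncurry : Continuous fun p : (Plane × Plane) × ℝ =>
    dilate p.1.2 p.2 p.1.1 := by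
  unfold dilate
  fun_prop

/-- Fundamental theorem of calculus and Cauchy–Schwarz on the segment from `y` to `x`. The segment
is cut at its midpoint and each half is parametrised by a dilation about the farther endpoint with
ratio in `[1/2, 1]`, which keeps the Jacobian away from zero when one endpoint is integrated out. -/
theorem sq_sub_le_integral_gradSq {φ : Plane → ℝ} (hφ : ContDiff ℝ ∞ φ) (x y : Plane) :
    (φ x - φ y) ^ 2 ≤ dist x y ^ 2 * ((∫ t in (1 / 2 : ℝ)..1, gradSq φ (dilate y t x)) +
      ∫ t in (1 / 2 : ℝ)..1, gradSq φ (dilate x t y)) := by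
  have hcd : Continuous fun t : ℝ => dilate y t x :=
    continuous_dilate_uncurry.comp (by fun_prop : Continuous fun t : ℝ => ((x, y), t))
  have hc : Continuous fun t => ∑ i, partialDeriv i φ (dilate y t x) * (x i - y i) :=
    continuous_finsetSum _ fun i _ =>
      ((contDiff_partialDeriv i hφ).continuous.comp hcd).mul_const _
  have hcQ : Continuous fun t => gradSq φ (dilate y t x) := (continuous_gradSq hφ).comp hcd
  have ftc := intervalIntegral.integral_eq_sub_of_hasDerivAt
    (fun t _ => hasDerivAt_comp_segment hφ x y t) (hc.intervalIntegrable 0 1)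
  have e1 : dilate y 1 x = x := by simp [dilate]
  have e0 : dilate y 0 x = y := by simp [dilate]
  rw [e1, e0] at ftc
  have hsplit : (∫ t in (1 / 2 : ℝ)..1, gradSq φ (dilate y t x)) +
      ∫ t in (1 / 2 : ℝ)..1, gradSq φ (dilate x t y) = ∫ t in (0 : ℝ)..1, gradSq φ (dilate y t x) := by
    have : ∀ t : ℝ, dilate x t y = dilate y (1 - t) x := fun t => by unfold dilate; module
    simp only [this]
    rw [intervalIntegral.integral_comp_sub_left (fun t => gradSq φ (dilate y t x)) 1, add_comm]
    norm_num
    exact intervalIntegral.integral_add_adjacent_intervals (hcQ.intervalIntegrable _ _)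
      (hcQ.intervalIntegrable _ _)
  rw [hsplit, ← ftc, intervalIntegral.integral_of_le zero_le_one,
    intervalIntegral.integral_of_le zero_le_one, ← integral_const_mul]
  have hm : MemLp (fun t => ∑ i, partialDeriv i φ (dilate y t x) * (x i - y i)) 2
      (volume.restrict (Set.Ioc (0 : ℝ) 1)) := by
    rw [memLp_two_iff_integrable_sq hc.aestronglyMeasurable]
    exact ((hc.pow 2).integrableOn_Icc).mono_set Set.Ioc_subset_Icc_self
  have cs := sq_integral_le hm
  simp only [measureReal_restrict_apply_univ, Real.volume_real_Ioc, sub_zero, max_eq_left zero_le_one,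
    one_mul] at cs
  refine cs.trans (integral_mono hm.integrable_sq (((continuous_const.mul hcQ).integrableOn_Icc).mono_set
    Set.Ioc_subset_Icc_self) fun t => ?_)
  have hd : dist x y ^ 2 = (x 0 - y 0) ^ 2 + (x 1 - y 1) ^ 2 := by
    rw [EuclideanSpace.dist_eq, Real.sq_sqrt (by positivity)]
    simp [Fin.sum_univ_two, Real.dist_eq]
  simp only [hd, gradSq, Fin.sum_univ_two]
  nlinarith [sq_nonneg (partialDeriv 0 φ (dilate y t x) * (x 1 - y 1)
    - partialDeriv 1 φ (dilate y t x) * (x 0 - y 0))]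

theorem setIntegral_comp_dilate_le {U : Set Plane} (hU : IsOpen U) (hc : Convex ℝ U)
    {Q : Plane → ℝ} (hQ : Integrable Q (volume.restrict U)) (h0 : ∀ x, 0 ≤ Q x) {y : Plane}
    (hy : y ∈ U) {t : ℝ} (ht0 : 0 < t) (ht1 : t ≤ 1) :
    ∫ x in U, Q (dilate y t x) ≤ (t ^ 2)⁻¹ * ∫ x in U, Q x := by
  rw [← integral_indicator hU.measurableSet, ← integral_indicator hU.measurableSet,
    ← integral_comp_dilate y]
  refine integral_mono_of_nonneg (Eventually.of_forall fun x => Set.indicator_nonneg (fun x _ => h0 _) x)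
    (integrable_comp_dilate y ht0.ne' ((integrable_indicator_iff hU.measurableSet).2 hQ))
    (Eventually.of_forall fun x => ?_)
  by_cases hx : x ∈ U
  · have : dilate y t x ∈ U := hc hx hy ht0.le (sub_nonneg.2 ht1) (by ring)
    simp [hx, this]
  · simpa [hx] using Set.indicator_nonneg (fun x _ => h0 x) _

/-- For each ratio in `[1/2, 1]` the dilation maps `U` into itself at the price of a factor at most
`4`; the parameter interval has length `1/2`. -/
theorem setIntegral_integral_segment_le {U : Set Plane} (hU : IsOpen U) (hc : Convex ℝ U)
    (hb : Bornology.IsBounded U) {Q : Plane → ℝ} (hQ : Continuous Q) (h0 : ∀ x, 0 ≤ Q x) {y : Plane}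
    (hy : y ∈ U) :
    ∫ x in U, ∫ t in (1 / 2 : ℝ)..1, Q (dilate y t x) ≤ 2 * ∫ x in U, Q x := by
  have hfin := isFiniteMeasure_restrict_of_isBounded hb
  have hQi := integrable_of_continuous_of_isBounded hb hQ
  have hcd : Continuous fun p : Plane × ℝ => Q (dilate y p.2 p.1) :=
    hQ.comp (continuous_dilate_uncurry.comp (by fun_prop : Continuous fun p : Plane × ℝ => ((p.1, y), p.2)))
  simp only [intervalIntegral.integral_of_le (by norm_num : (1 / 2 : ℝ) ≤ 1)]
  rw [integral_integral_swap]
  · have h1 : ∀ t ∈ Set.Ioc (1 / 2 : ℝ) 1, ∫ x in U, Q (dilate y t x) ≤ 4 * ∫ x in U, Q x := by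
      intro t ht
      refine (setIntegral_comp_dilate_le hU hc hQi h0 hy (by linarith [ht.1]) ht.2).trans ?_
      gcongr
      · exact integral_nonneg h0
      · rw [inv_le_comm₀ (by have := ht.1; positivity) (by norm_num)]
        nlinarith [ht.1]
    have h2 := integral_mono_of_nonneg (μ := volume.restrict (Set.Ioc (1 / 2 : ℝ) 1))
      (Eventually.of_forall fun t => integral_nonneg fun x => h0 (dilate y t x))
      (integrable_const (4 * ∫ x in U, Q x)) ((ae_restrict_mem measurableSet_Ioc).mono h1)
    refine h2.trans (le_of_eq ?_)
    rw [integral_const]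
    norm_num [Real.volume_real_Ioc]
    ring
  · rw [Measure.prod_restrict]
    exact (hcd.locallyIntegrable.integrableOn_isCompact
      (hb.isCompact_closure.prod (isCompact_Icc (a := (1 / 2 : ℝ)) (b := 1)))).mono_set
      (Set.prod_mono subset_closure Set.Ioc_subset_Icc_self)

/-- The double integral of `(φ x - φ y)²` over `U × U` is twice the left-hand side. Integrating the
segment estimate bounds it by `h²` times two equal terms, each at most `2 |U| ∫ |∇φ|²`. -/
theorem variance_le_of_contDiff {U : Set Plane} (hU : IsOpen U) (hc : Convex ℝ U)
    (hb : Bornology.IsBounded U) {h : ℝ} (hdiam : ∀ x ∈ U, ∀ y ∈ U, dist x y ≤ h)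
    {φ : Plane → ℝ} (hφ : ContDiff ℝ ∞ φ) :
    volume.real U * (∫ x in U, φ x ^ 2) - (∫ x in U, φ x) ^ 2
      ≤ 2 * h ^ 2 * (volume.real U * ∫ x in U, gradSq φ x) := by
  have hfin := isFiniteMeasure_restrict_of_isBounded hb
  have hφc := hφ.continuous
  have hφi := integrable_of_continuous_of_isBounded hb hφc
  have hφ2 : Integrable (fun x => φ x ^ 2) (volume.restrict U) :=
    integrable_of_continuous_of_isBounded hb (hφc.pow 2)
  set S : Plane × Plane → ℝ := fun p => ∫ t in (1 / 2 : ℝ)..1, gradSq φ (dilate p.2 t p.1) with hS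
  have hSc : Continuous S :=
    intervalIntegral.continuous_parametric_intervalIntegral_of_continuous'
      (f := fun (p : Plane × Plane) t => gradSq φ (dilate p.2 t p.1))
      ((continuous_gradSq hφ).comp continuous_dilate_uncurry) _ _
  have hS1 := integrable_prod_of_continuous_of_isBounded hb hSc
  have hS2 : Integrable (fun p => S (Prod.swap p))
      ((volume.restrict U).prod (volume.restrict U)) := hS1.swap
  have hL := integrable_prod_of_continuous_of_isBounded hb
    (F := fun p => (φ p.1 - φ p.2) ^ 2) (by fun_prop)
  have lhs : ∫ p, (φ p.1 - φ p.2) ^ 2 ∂(volume.restrict U).prod (volume.restrict U)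
      = 2 * (volume.real U * (∫ x in U, φ x ^ 2) - (∫ x in U, φ x) ^ 2) := by
    rw [integral_prod _ hL]
    have : ∀ x, ∫ y in U, (φ x - φ y) ^ 2
        = φ x ^ 2 * volume.real U - 2 * (∫ y in U, φ y) * φ x + ∫ y in U, φ y ^ 2 := by
      intro x
      have e : ∀ y, (φ x - φ y) ^ 2 = (φ x ^ 2 - 2 * φ x * φ y) + φ y ^ 2 := fun y => by ring
      have i1 : Integrable (fun y => φ x ^ 2 - 2 * φ x * φ y) (volume.restrict U) :=
        (integrable_const _).sub (hφi.const_mul _)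
      simp only [e]
      rw [integral_add i1 hφ2, integral_sub (integrable_const _) (hφi.const_mul _),
        integral_const_mul, integral_const, measureReal_restrict_apply_univ, smul_eq_mul]
      ring
    simp only [this]
    have i2 : Integrable (fun x => φ x ^ 2 * volume.real U - 2 * (∫ y in U, φ y) * φ x)
        (volume.restrict U) := (hφ2.mul_const _).sub (hφi.const_mul _)
    rw [integral_add i2 (integrable_const _), integral_sub (hφ2.mul_const _) (hφi.const_mul _),
      integral_mul_const, integral_const_mul, integral_const, measureReal_restrict_apply_univ,
      smul_eq_mul]
    ring
  have key : ∫ p, S p ∂(volume.restrict U).prod (volume.restrict U)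
      ≤ 2 * (volume.real U * ∫ x in U, gradSq φ x) := by
    rw [integral_prod_symm _ hS1]
    have := integral_mono_ae hS1.integral_prod_right
      (integrable_const (2 * ∫ x in U, gradSq φ x)) ((ae_restrict_mem hU.measurableSet).mono
        fun y hy => setIntegral_integral_segment_le hU hc hb (continuous_gradSq hφ)
          (gradSq_nonneg φ) hy)
    refine this.trans (le_of_eq ?_)
    rw [integral_const, measureReal_restrict_apply_univ, smul_eq_mul]
    ring
  have swap : ∫ p, S p.swap ∂(volume.restrict U).prod (volume.restrict U)
      = ∫ p, S p ∂(volume.restrict U).prod (volume.restrict U) := integral_prod_swap S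
  have hS0 : ∀ p, 0 ≤ S p := fun p =>
    intervalIntegral.integral_nonneg (by norm_num) fun t _ => gradSq_nonneg _ _
  have main : ∫ p, (φ p.1 - φ p.2) ^ 2 ∂(volume.restrict U).prod (volume.restrict U)
      ≤ ∫ p, h ^ 2 * (S p + S p.swap) ∂(volume.restrict U).prod (volume.restrict U) := by
    refine integral_mono_ae hL ((hS1.add hS2).const_mul _) ?_
    rw [Measure.prod_restrict]
    refine (ae_restrict_mem (hU.measurableSet.prod hU.measurableSet)).mono fun p hp => ?_
    refine (sq_sub_le_integral_gradSq hφ p.1 p.2).trans ?_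
    have := pow_le_pow_left₀ dist_nonneg (hdiam _ hp.1 _ hp.2) 2
    exact mul_le_mul_of_nonneg_right this (add_nonneg (hS0 p) (hS0 p.swap))
  rw [lhs, integral_const_mul, integral_add hS1 hS2, swap] at main
  nlinarith [sq_nonneg h]

theorem integral_sub_const_sq {U : Set Plane} (hb : Bornology.IsBounded U) {f : Plane → ℝ}
    (hf : MemLp f 2 (volume.restrict U)) (c : ℝ) :
    ∫ x in U, (f x - c) ^ 2 = (∫ x in U, f x ^ 2) - 2 * c * (∫ x in U, f x) + c ^ 2 * volume.real U := by
  have hfin := isFiniteMeasure_restrict_of_isBounded hb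
  have hi : Integrable f (volume.restrict U) := hf.integrable (by norm_num)
  have e : ∀ x, (f x - c) ^ 2 = (f x ^ 2 - 2 * c * f x) + c ^ 2 := fun x => by ring
  have i1 : Integrable (fun x => f x ^ 2 - 2 * c * f x) (volume.restrict U) :=
    hf.integrable_sq.sub (hi.const_mul _)
  simp only [e]
  rw [integral_add i1 (integrable_const _), integral_sub hf.integrable_sq (hi.const_mul _),
    integral_const_mul, integral_const, measureReal_restrict_apply_univ, smul_eq_mul]
  ring

theorem HasGrad.tendsto_energy {U : Set Plane} (hb : Bornology.IsBounded U) {f : Plane → ℝ}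
    {g : Fin 2 → Plane → ℝ} (hg : HasGrad U f g) {φ : ℕ → Plane → ℝ} (hφ : ∀ n, ContDiff ℝ ∞ (φ n))
    (h : ∀ i, Tendsto (fun n => ∫ x in U, (g i x - partialDeriv i (φ n) x) ^ 2) atTop (𝓝 0)) :
    Tendsto (fun n => ∫ x in U, gradSq (φ n) x) atTop (𝓝 (energy U g)) := by
  have hm := fun n i => memLp_of_continuous_of_isBounded hb
    (contDiff_partialDeriv i (hφ n)).continuous
  have : ∀ n, ∫ x in U, gradSq (φ n) x = ∑ i, ∫ x in U, partialDeriv i (φ n) x ^ 2 := fun n =>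
    integral_finsetSum _ fun i _ => (hm n i).integrable_sq
  simp only [this]
  exact tendsto_finsetSum _ fun i _ => tendsto_integral_sq (hg.grad_memLp i) (fun n => hm n i) (h i)

/-- The smooth case passes to the limit by density. This form keeps the mean of `f` explicit, which
is needed for the interpolation residual, whose mean need not vanish. -/
theorem HasGrad.variance_le {U : Set Plane} (hU : IsOpen U) (hc : Convex ℝ U)
    (hb : Bornology.IsBounded U) {h : ℝ} (hdiam : ∀ x ∈ U, ∀ y ∈ U, dist x y ≤ h)
    {f : Plane → ℝ} {g : Fin 2 → Plane → ℝ} (hg : HasGrad U f g) :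
    volume.real U * normSq U f - (∫ x in U, f x) ^ 2
      ≤ 2 * h ^ 2 * (volume.real U * energy U g) := by
  rcases U.eq_empty_or_nonempty with rfl | hne
  · simp
  have hfin := isFiniteMeasure_restrict_of_isBounded hb
  obtain ⟨φ, hφ, h1, h2⟩ := hg.exists_smooth_approx hU hb hc hne
  have hm := fun n => memLp_of_continuous_of_isBounded hb (hφ n).continuous
  refine le_of_tendsto_of_tendsto'
    (((tendsto_integral_sq hg.memLp hm h1).const_mul _).sub
      ((tendsto_integral_of_sq hg.memLp hm h1).pow 2))
    (((hg.tendsto_energy hb hφ h2).const_mul _).const_mul _)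
    fun n => variance_le_of_contDiff hU hc hb hdiam (hφ n)

/-- The Poincaré inequality on a convex set. -/
theorem HasGrad.poincare {U : Set Plane} (hU : IsOpen U) (hc : Convex ℝ U)
    (hb : Bornology.IsBounded U) {h : ℝ} (hdiam : ∀ x ∈ U, ∀ y ∈ U, dist x y ≤ h)
    {f : Plane → ℝ} {g : Fin 2 → Plane → ℝ} (hg : HasGrad U f g) :
    normSq U (fun x => f x - ⨍ y in U, f y) ≤ 2 * h ^ 2 * energy U g := by
  rcases U.eq_empty_or_nonempty with rfl | hne
  · simp [normSq, energy]
  have hV : 0 < volume.real U := ENNReal.toReal_pos (hU.measure_pos volume hne).ne'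
    hb.measure_lt_top.ne
  have hv := hg.variance_le hU hc hb hdiam
  rw [normSq, integral_sub_const_sq hb hg.memLp, setAverage_eq, smul_eq_mul]
  rw [normSq] at hv
  refine le_of_mul_le_mul_left ?_ hV
  field_simp
  linarith

/-! ### Geometry of a triangle -/

theorem IsTriangle.exists_third {K : Finset Plane} (hK : IsTriangle K) {a b : Plane} (ha : a ∈ K)
    (hb : b ∈ K) (hab : a ≠ b) : ∃ c, c ≠ a ∧ c ≠ b ∧ K = {a, b, c} := by
  have hb' : b ∈ K.erase a := Finset.mem_erase.2 ⟨hab.symm, hb⟩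
  have h1 : ((K.erase a).erase b).card = 1 := by
    rw [Finset.card_erase_of_mem hb', Finset.card_erase_of_mem ha, hK.1]
  obtain ⟨c, hc⟩ := Finset.card_eq_one.1 h1
  have hc' : c ∈ (K.erase a).erase b := hc ▸ Finset.mem_singleton_self c
  simp only [Finset.mem_erase] at hc'
  refine ⟨c, hc'.2.1, hc'.1, ?_⟩
  rw [← Finset.insert_erase ha, ← Finset.insert_erase hb', hc]

theorem IsTriangle.linearIndependent {K : Finset Plane} (hK : IsTriangle K) {a b c : Plane}
    (h : (K : Set Plane) = {a, b, c}) : LinearIndependent ℝ ![a - c, b - c] := by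
  have hmem : ∀ i, ![c, a, b] i ∈ K := by
    intro i
    rw [← Finset.mem_coe, h]
    fin_cases i <;> simp
  have hcard : ({a, b, c} : Set Plane).ncard = 3 := by rw [← h, Set.ncard_coe_finset, hK.1]
  have hne : a ≠ b ∧ a ≠ c ∧ b ≠ c := by
    have h2 : ∀ x y : Plane, ({x, y} : Set Plane).ncard ≤ 2 := fun x y =>
      (Set.ncard_insert_le _ _).trans (by simp)
    refine ⟨?_, ?_, ?_⟩ <;> rintro rfl
    · rw [Set.insert_eq_of_mem (by simp)] at hcard; have := h2 a c; omega
    · rw [Set.pair_comm, Set.insert_eq_of_mem (by simp)] at hcard; have := h2 a b; omega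
    · rw [Set.pair_eq_singleton] at hcard; have := h2 a b; omega
  let e : Fin 3 ↪ K := ⟨fun i => ⟨![c, a, b] i, hmem i⟩, by
    intro i j hij
    have hij' : ![c, a, b] i = ![c, a, b] j := congrArg Subtype.val hij
    fin_cases i <;> fin_cases j <;> simp_all [eq_comm]⟩
  have hA : AffineIndependent ℝ (fun i => ((e i : K) : Plane)) := hK.2.comp_embedding e
  have hL := (affineIndependent_iff_linearIndependent_vsub ℝ _ (0 : Fin 3)).1 hA
  rw [← linearIndependent_equiv (finSuccAboveEquiv (0 : Fin 3))] at hL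
  have e2 : ((fun i : {x : Fin 3 // x ≠ 0} => ((e i : K) : Plane) -ᵥ ((e 0 : K) : Plane)) ∘
      finSuccAboveEquiv (0 : Fin 3)) = ![a - c, b - c] := by
    funext i
    fin_cases i <;> rfl
  rwa [e2] at hL

theorem elem_eq_convexHull {K : Finset Plane} {a b c : Plane} (h : (K : Set Plane) = {a, b, c}) :
    elem K = convexHull ℝ {a, b, c} := by rw [elem, h]

theorem isCompact_elem (K : Finset Plane) : IsCompact (elem K) :=
  K.finite_toSet.isCompact_convexHull ℝ

theorem convex_elem (K : Finset Plane) : Convex ℝ (elem K) := convex_convexHull _ _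

theorem isBounded_elem (K : Finset Plane) : Bornology.IsBounded (elem K) :=
  (isCompact_elem K).isBounded

theorem isBounded_interior_elem (K : Finset Plane) : Bornology.IsBounded (interior (elem K)) :=
  (isBounded_elem K).subset interior_subset

theorem IsTriangle.interior_nonempty {K : Finset Plane} (hK : IsTriangle K) :
    (interior (elem K)).Nonempty := by
  rw [elem, interior_convexHull_nonempty_iff_affineSpan_eq_top]
  have := (hK.2.affineSpan_eq_top_iff_card_eq_finrank_add_one).2 (by simp [hK.1])
  simpa using this

theorem interior_ae_eq {s : Set Plane} (hs : Convex ℝ s) :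
    interior s =ᵐ[volume] s := by
  refine (ae_eq_set).2 ⟨by simp [Set.sdiff_eq_empty.2 interior_subset], ?_⟩
  refine measure_mono_null (fun x hx => ?_) (hs.addHaar_frontier volume)
  exact ⟨subset_closure hx.1, hx.2⟩

theorem restrict_interior_elem (K : Finset Plane) :
    (volume.restrict (interior (elem K)) : Measure Plane) = volume.restrict (elem K) :=
  Measure.restrict_congr_set (interior_ae_eq (convex_elem K))

theorem IsTriangle.volume_pos {K : Finset Plane} (hK : IsTriangle K) :
    0 < volume.real (elem K) :=
  ENNReal.toReal_pos (((isOpen_interior.measure_pos volume hK.interior_nonempty).trans_le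
    (measure_mono interior_subset)).ne') (isBounded_elem K).measure_lt_top.ne

/-! ### Integration over a triangle in coordinates centred at a vertex -/

/-- Here `z` is the relative distance from the vertex `c`, and `y / z` the position on the opposite
edge from `a` to `b`. This form suits both radial integration from `c` and reflections. -/
theorem mem_convexHull_triple {a b c x : Plane} : x ∈ convexHull ℝ {a, b, c} ↔
    ∃ z y : ℝ, 0 ≤ y ∧ y ≤ z ∧ z ≤ 1 ∧ x = c + z • (a - c) + y • (b - a) := by
  rw [show ({a, b, c} : Set Plane) = {c, a, b} by
    rw [Set.insert_comm c, Set.pair_comm c], convexHull_insert (by simp), convexHull_pair]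
  simp only [mem_convexJoin, Set.mem_singleton_iff, exists_eq_left, segment_eq_image, Set.mem_image,
    Set.mem_Icc]
  constructor
  · rintro ⟨_, ⟨s, hs, rfl⟩, z, hz, rfl⟩
    refine ⟨z, z * s, mul_nonneg hz.1 hs.1, mul_le_of_le_one_right hz.1 hs.2, hz.2, ?_⟩
    module
  · rintro ⟨z, y, hy, hyz, hz, rfl⟩
    rcases eq_or_lt_of_le (hy.trans hyz) with h0 | h0
    · have : y = 0 := le_antisymm (hyz.trans h0.symm.le) hy
      refine ⟨a, ⟨0, by simp⟩, 0, by simp, ?_⟩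
      rw [← h0, this]
      module
    · refine ⟨_, ⟨y / z, ⟨by positivity, (div_le_one h0).2 hyz⟩, rfl⟩, z, ⟨h0.le, hz⟩, ?_⟩
      have : y = z * (y / z) := by field_simp
      conv_rhs => rw [this]
      module

theorem intervalIntegral_swap_of_continuous {F : ℝ × ℝ → ℝ} (hF : Continuous F) :
    ∫ z in (0 : ℝ)..1, ∫ s in (0 : ℝ)..1, F (z, s) = ∫ s in (0 : ℝ)..1, ∫ z in (0 : ℝ)..1, F (z, s) := by
  simp only [intervalIntegral.integral_of_le zero_le_one]
  refine integral_integral_swap (f := fun z s => F (z, s)) ?_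
  rw [Measure.prod_restrict]
  exact (hF.locallyIntegrable.integrableOn_isCompact
    ((isCompact_Icc (a := (0 : ℝ)) (b := 1)).prod (isCompact_Icc (a := (0 : ℝ)) (b := 1)))).mono_set
    (Set.prod_mono Set.Ioc_subset_Icc_self Set.Ioc_subset_Icc_self)

theorem integral_plane_eq (G : Plane → ℝ) :
    ∫ p, G p = ∫ q : ℝ × ℝ, G !₂[q.1, q.2] := by
  have h1 := (EuclideanSpace.volume_preserving_symm_measurableEquiv_toLp (Fin 2))
  have h2 := h1.integral_comp' (fun q : Fin 2 → ℝ => G (WithLp.toLp 2 q))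
  have h3 := (volume_preserving_finTwoArrow ℝ).symm.integral_comp'
    (fun q : Fin 2 → ℝ => G (WithLp.toLp 2 q))
  calc ∫ p, G p = ∫ q : Fin 2 → ℝ, G (WithLp.toLp 2 q) := h2
    _ = _ := h3.symm

/-- An affine change of variables followed by `y = z s`, whose Jacobian is the weight `z`. The
constant `D` stays unspecified, since inserting `F = 1` shows later that it is twice the area. -/
theorem exists_integral_triangle_eq {a b c : Plane} (hl : LinearIndependent ℝ ![a - c, b - c]) :
    ∃ D : ℝ, ∀ F : Plane → ℝ, Continuous F → ∫ x in convexHull ℝ {a, b, c}, F x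
      = D * ∫ s in (0 : ℝ)..1, ∫ z in (0 : ℝ)..1, z * F (c + z • (AffineMap.lineMap a b s - c)) := by
  let S : Set Plane := {p | 0 ≤ p 1 ∧ p 1 ≤ p 0 ∧ p 0 ≤ 1}
  let A : Plane → Plane := fun p => c + p 0 • (a - c) + p 1 • (b - a)
  let L : Plane →L[ℝ] Plane := (EuclideanSpace.proj (0 : Fin 2)).smulRight (a - c)
    + (EuclideanSpace.proj (1 : Fin 2)).smulRight (b - a)
  have hA : ∀ p, HasFDerivAt A L p := fun p => by
    have e : A = fun p => L p + c := by funext p; simp [A, L]; abel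
    rw [e]
    exact L.hasFDerivAt.add_const c
  have hS : MeasurableSet S := by
    have c0 : Continuous fun p : Plane => p 0 := by fun_prop
    have c1 : Continuous fun p : Plane => p 1 := by fun_prop
    exact ((isClosed_le continuous_const c1).inter ((isClosed_le c1 c0).inter
      (isClosed_le c0 continuous_const))).measurableSet
  have hinj : Function.Injective A := by
    intro p q hpq
    have h : (p 0 - p 1 - (q 0 - q 1)) • (a - c) + (p 1 - q 1) • (b - c) = 0 := by
      have : A p - A q = 0 := sub_eq_zero.2 hpq
      rw [← this]
      simp only [A]
      module
    obtain ⟨h1, h2⟩ := LinearIndependent.pair_iff.1 hl _ _ h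
    ext i
    fin_cases i <;> simp <;> linarith
  have himg : A '' S = convexHull ℝ {a, b, c} := by
    ext x
    rw [mem_convexHull_triple]
    constructor
    · rintro ⟨p, hp, rfl⟩
      exact ⟨p 0, p 1, hp.1, hp.2.1, hp.2.2, rfl⟩
    · rintro ⟨z, y, h1, h2, h3, rfl⟩
      exact ⟨!₂[z, y], by simpa [S] using ⟨h1, h2, h3⟩, by simp [A]⟩
  refine ⟨|L.det|, fun F hF => ?_⟩
  rw [← himg, integral_image_eq_integral_abs_det_fderiv_smul volume hS
    (fun p _ => (hA p).hasFDerivWithinAt) hinj.injOn, integral_smul, smul_eq_mul]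
  congr 1
  let S' : Set (ℝ × ℝ) := {q | 0 ≤ q.2 ∧ q.2 ≤ q.1 ∧ q.1 ≤ 1}
  have hS'c : IsClosed S' :=
    (isClosed_le continuous_const continuous_snd).inter ((isClosed_le continuous_snd
      continuous_fst).inter (isClosed_le continuous_fst continuous_const))
  have hS' : IsCompact S' := (isCompact_Icc (a := ((0 : ℝ), (0 : ℝ))) (b := (1, 1))).of_isClosed_subset
    hS'c fun q hq => ⟨⟨hq.1.trans hq.2.1, hq.1⟩, ⟨hq.2.2, hq.2.1.trans hq.2.2⟩⟩
  let H : ℝ × ℝ → ℝ := fun q => F (c + q.1 • (a - c) + q.2 • (b - a))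
  have hH : Continuous H := by fun_prop
  have e1 : ∫ p in S, F (A p) = ∫ q, S'.indicator H q := by
    rw [← integral_indicator hS, integral_plane_eq]
    congr 1 with q
  rw [e1, Measure.volume_eq_prod, integral_prod]
  swap
  · rw [← Measure.volume_eq_prod, integrable_indicator_iff hS'.measurableSet]
    exact hH.locallyIntegrable.integrableOn_isCompact hS'
  have e2 : ∀ z, ∫ y, S'.indicator H (z, y)
      = (Set.Icc (0 : ℝ) 1).indicator (fun z => z * ∫ s in (0 : ℝ)..1, H (z, z * s)) z := by
    intro z
    by_cases hz : z ∈ Set.Icc (0 : ℝ) 1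
    · rw [Set.indicator_of_mem hz]
      have : ∀ y, S'.indicator H (z, y) = (Set.Icc 0 z).indicator (fun y => H (z, y)) y := by
        intro y
        by_cases hy : y ∈ Set.Icc 0 z
        · rw [Set.indicator_of_mem hy, Set.indicator_of_mem (show (z, y) ∈ S' from ⟨hy.1, hy.2, hz.2⟩)]
        · rw [Set.indicator_of_notMem hy, Set.indicator_of_notMem fun h : (z, y) ∈ S' => hy ⟨h.1, h.2.1⟩]
      simp only [this]
      rw [integral_indicator measurableSet_Icc, integral_Icc_eq_integral_Ioc,
        ← intervalIntegral.integral_of_le hz.1]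
      rcases eq_or_lt_of_le hz.1 with h0 | h0
      · simp [← h0]
      · rw [intervalIntegral.integral_comp_mul_left (fun y => H (z, y)) h0.ne', smul_eq_mul,
          mul_inv_cancel_left₀ h0.ne']
        simp
    · rw [Set.indicator_of_notMem hz]
      have : ∀ y, S'.indicator H (z, y) = 0 := fun y =>
        Set.indicator_of_notMem (fun h : (z, y) ∈ S' => hz ⟨h.1.trans h.2.1, h.2.2⟩) _
      simp [this]
  simp only [e2]
  rw [integral_indicator measurableSet_Icc, integral_Icc_eq_integral_Ioc,
    ← intervalIntegral.integral_of_le zero_le_one]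
  simp only [← intervalIntegral.integral_const_mul]
  have hc2 : Continuous fun q : ℝ × ℝ => q.1 * H (q.1, q.1 * q.2) := by fun_prop
  rw [intervalIntegral_swap_of_continuous hc2]
  refine intervalIntegral.integral_congr fun s _ => intervalIntegral.integral_congr fun z _ => ?_
  simp only [H, AffineMap.lineMap_apply_module]
  congr 2
  module

/-! ### The mean over an edge as a mean over the triangle -/

/-- The integrand on a triangle with vertex `c` whose mean is the mean of `f` over the edge opposite
to `c`; `g` is the gradient of `f`. -/
def edgeDensity (c : Plane) (f : Plane → ℝ) (g : Fin 2 → Plane → ℝ) (x : Plane) : ℝ :=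
  f x + 1 / 2 * ∑ i, g i x * (x i - c i)

/-- Along the ray from `c` to a point `w` of the edge, the derivative of `½ z² φ(c + z (w - c))` is
exactly `z` times the density. Radial integration leaves `½ φ(w)`, and then one integrates over the
edge. -/
theorem integral_edgeDensity_eq {a b c : Plane} (hl : LinearIndependent ℝ ![a - c, b - c])
    {φ : Plane → ℝ} (hφ : ContDiff ℝ ∞ φ) :
    ∫ x in convexHull ℝ {a, b, c}, edgeDensity c φ (fun i => partialDeriv i φ) x
      = volume.real (convexHull ℝ {a, b, c}) * ∫ t in (0 : ℝ)..1, φ (AffineMap.lineMap a b t) := by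
  obtain ⟨D, hD⟩ := exists_integral_triangle_eq hl
  have hvol : volume.real (convexHull ℝ {a, b, c}) = D * (1 / 2) := by
    have := hD (fun _ => 1) continuous_const
    simpa [Measure.real] using this
  have hdens : Continuous (edgeDensity c φ fun i => partialDeriv i φ) :=
    hφ.continuous.add (continuous_const.mul (continuous_finsetSum _ fun i _ =>
      (contDiff_partialDeriv i hφ).continuous.mul (by fun_prop)))
  rw [hD _ hdens, hvol, mul_assoc, ← intervalIntegral.integral_const_mul (1 / 2)]
  congr 1
  refine intervalIntegral.integral_congr fun s _ => ?_
  set w : Plane := AffineMap.lineMap a b s with hw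
  have hder : ∀ z : ℝ, HasDerivAt (fun z : ℝ => 1 / 2 * (z ^ 2 * φ (dilate c z w)))
      (z * edgeDensity c φ (fun i => partialDeriv i φ) (dilate c z w)) z := by
    intro z
    refine (((hasDerivAt_pow 2 z).mul (hasDerivAt_comp_segment hφ w c z)).const_mul (1 / 2)).congr_deriv ?_
    have hx : ∀ i, dilate c z w i - c i = z * (w i - c i) := fun i => by
      simp [dilate]; ring
    simp only [edgeDensity, hx, Fin.sum_univ_two]
    push_cast
    ring
  have hcont : Continuous fun z : ℝ => z * edgeDensity c φ (fun i => partialDeriv i φ) (dilate c z w) :=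
    continuous_id.mul (hdens.comp (continuous_dilate_uncurry.comp
      (by fun_prop : Continuous fun z : ℝ => ((w, c), z))))
  have ftc := intervalIntegral.integral_eq_sub_of_hasDerivAt (fun z _ => hder z)
    (hcont.intervalIntegrable 0 1)
  have e : ∀ z : ℝ, c + z • (w - c) = dilate c z w := fun z => by unfold dilate; module
  have e1 : dilate c 1 w = w := by simp [dilate]
  simp only [e]
  rw [ftc, e1]
  simp

/-! ### Affine functions -/

/-- The affine function `α + G · x`. -/
def affineFun (α : ℝ) (G : Fin 2 → ℝ) (x : Plane) : ℝ := α + ∑ i, G i * x i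

theorem contDiff_affineFun (α : ℝ) (G : Fin 2 → ℝ) : ContDiff ℝ ∞ (affineFun α G) := by
  unfold affineFun
  fun_prop

theorem partialDeriv_affineFun (α : ℝ) (G : Fin 2 → ℝ) (i : Fin 2) :
    partialDeriv i (affineFun α G) = fun _ => G i := by
  funext x
  have h : HasFDerivAt (affineFun α G)
      (∑ j, G j • (EuclideanSpace.proj j : Plane →L[ℝ] ℝ)) x := by
    have e : affineFun α G = fun x => (∑ j, G j • (EuclideanSpace.proj j : Plane →L[ℝ] ℝ)) x + α := by
      funext x
      simp [affineFun, Fin.sum_univ_two]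
      ring
    rw [e]
    exact (ContinuousLinearMap.hasFDerivAt _).add_const α
  rw [partialDeriv, h.fderiv]
  fin_cases i <;> simp [Fin.sum_univ_two]

theorem hasGrad_affineFun {U : Set Plane} (hb : Bornology.IsBounded U) (α : ℝ) (G : Fin 2 → ℝ) :
    HasGrad U (affineFun α G) (fun i _ => G i) := by
  have := hasGrad_of_contDiff hb (contDiff_affineFun α G)
  simpa only [partialDeriv_affineFun] using this

theorem isPoly_affineFun (α : ℝ) (G : Fin 2 → ℝ) : IsPoly 1 (affineFun α G) := by
  refine ⟨MvPolynomial.C α + ∑ i, MvPolynomial.C (G i) * MvPolynomial.X i, ?_, fun x => ?_⟩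
  · refine (MvPolynomial.totalDegree_add _ _).trans (max_le (by simp) ?_)
    refine (MvPolynomial.totalDegree_finsetSum _ _).trans (Finset.sup_le fun i _ => ?_)
    refine (MvPolynomial.totalDegree_mul _ _).trans ?_
    simp
  · simp [affineFun]

theorem IsPoly.eq_sum {r : ℕ} {f : Plane → ℝ} (hf : IsPoly r f) : ∃ p : MvPolynomial (Fin 2) ℝ,
    (∀ d ∈ p.support, d 0 + d 1 ≤ r) ∧
    ∀ x, f x = ∑ d ∈ p.support, p.coeff d * (x 0 ^ d 0 * x 1 ^ d 1) := by
  obtain ⟨p, hp, h⟩ := hf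
  refine ⟨p, fun d hd => ?_, fun x => ?_⟩
  · have := MvPolynomial.le_totalDegree hd
    rw [Finsupp.sum_fintype _ _ (by simp), Fin.sum_univ_two] at this
    omega
  · rw [h, MvPolynomial.eval_eq']
    simp [Fin.prod_univ_two]

theorem IsPoly.exists_affineFun {f : Plane → ℝ} (hf : IsPoly 1 f) : ∃ α G, f = affineFun α G := by
  obtain ⟨p, hp, h⟩ := hf.eq_sum
  have key : ∀ s : Finset (Fin 2 →₀ ℕ), (∀ d ∈ s, d 0 + d 1 ≤ 1) →
      ∃ α G, ∀ x : Plane, ∑ d ∈ s, p.coeff d * (x 0 ^ d 0 * x 1 ^ d 1) = affineFun α G x := by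
    intro s
    induction s using Finset.induction_on with
    | empty => exact fun _ => ⟨0, 0, fun x => by simp [affineFun]⟩
    | insert d s hd ih =>
      intro H
      obtain ⟨α, G, hG⟩ := ih fun e he => H e (Finset.mem_insert_of_mem he)
      have hd' := H d (Finset.mem_insert_self d s)
      have : (d 0 = 0 ∧ d 1 = 0) ∨ (d 0 = 1 ∧ d 1 = 0) ∨ (d 0 = 0 ∧ d 1 = 1) := by omega
      rcases this with ⟨h0, h1⟩ | ⟨h0, h1⟩ | ⟨h0, h1⟩
      · refine ⟨p.coeff d + α, G, fun x => ?_⟩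
        rw [Finset.sum_insert hd, hG, h0, h1]
        simp [affineFun, Fin.sum_univ_two]; ring
      · refine ⟨α, ![p.coeff d + G 0, G 1], fun x => ?_⟩
        rw [Finset.sum_insert hd, hG, h0, h1]
        simp [affineFun, Fin.sum_univ_two]; ring
      · refine ⟨α, ![G 0, p.coeff d + G 1], fun x => ?_⟩
        rw [Finset.sum_insert hd, hG, h0, h1]
        simp [affineFun, Fin.sum_univ_two]; ring
  obtain ⟨α, G, hG⟩ := key p.support hp
  exact ⟨α, G, funext fun x => (h x).trans (hG x)⟩

/-! ### Edge integrals of `H¹` functions -/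

theorem tendsto_sobolevNorm_one_iff {U : Set Plane} (hU : IsOpen U) (hb : Bornology.IsBounded U)
    {u : Plane → ℝ} {g : Fin 2 → Plane → ℝ} (hu : HasGrad U u g) {φ : ℕ → Plane → ℝ}
    (hφ : ∀ n, ContDiff ℝ ∞ (φ n)) :
    Tendsto (fun n => sobolevNorm 1 U (u - φ n)) atTop (𝓝 0) ↔
      Tendsto (fun n => ∫ x in U, (u x - φ n x) ^ 2) atTop (𝓝 0) ∧
      ∀ i, Tendsto (fun n => ∫ x in U, (g i x - partialDeriv i (φ n) x) ^ 2) atTop (𝓝 0) := by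
  have e : ∀ n, sobolevNorm 1 U (u - φ n) = √((∫ x in U, (u x - φ n x) ^ 2)
      + ((∫ x in U, (g 0 x - partialDeriv 0 (φ n) x) ^ 2)
        + ∫ x in U, (g 1 x - partialDeriv 1 (φ n) x) ^ 2)) := fun n =>
    (hu.sub (hasGrad_of_contDiff hb (hφ n))).sobolevNorm_one hU
  have nn : ∀ a : Plane → ℝ, 0 ≤ ∫ x in U, a x ^ 2 := fun a => integral_nonneg fun x => sq_nonneg _
  simp only [e]
  constructor
  · intro h
    have h2 := h.pow 2
    simp only [Real.sq_sqrt (add_nonneg (nn _) (add_nonneg (nn _) (nn _))), ne_eq,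
      OfNat.ofNat_ne_zero, not_false_eq_true, zero_pow] at h2
    have p := fun n => nn fun x => u x - φ n x
    have q := fun n i => nn fun x => g i x - partialDeriv i (φ n) x
    refine ⟨squeeze_zero (fun n => nn _) (fun n => ?_) h2, Fin.forall_fin_two.2
      ⟨squeeze_zero (fun n => nn _) (fun n => ?_) h2, squeeze_zero (fun n => nn _) (fun n => ?_) h2⟩⟩ <;>
    linarith [p n, q n 0, q n 1]
  · rintro ⟨h1, h2⟩
    simpa using (h1.add ((h2 0).add (h2 1))).sqrt

theorem HasGrad.integral_edgeDensity {U : Set Plane} (hb : Bornology.IsBounded U) {u : Plane → ℝ}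
    {g : Fin 2 → Plane → ℝ} (hu : HasGrad U u g) (c : Plane) :
    ∫ x in U, edgeDensity c u g x
      = (∫ x in U, u x) + 1 / 2 * ∑ i, ∫ x in U, g i x * (x i - c i) := by
  have hfin := isFiniteMeasure_restrict_of_isBounded hb
  have hi : ∀ i : Fin 2, Integrable (fun x => g i x * (x i - c i)) (volume.restrict U) := fun i =>
    (hu.grad_memLp i).integrable_mul_two (memLp_of_continuous_of_isBounded hb (by fun_prop))
  unfold edgeDensity
  rw [integral_add (hu.memLp.integrable (by norm_num))
    ((integrable_finsetSum _ fun i _ => hi i).const_mul _), integral_const_mul,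
    integral_finsetSum _ fun i _ => hi i]

theorem HasGrad.tendsto_integral_edgeDensity {U : Set Plane} (hb : Bornology.IsBounded U)
    {u : Plane → ℝ} {g : Fin 2 → Plane → ℝ} (hu : HasGrad U u g) {φ : ℕ → Plane → ℝ}
    (hφ : ∀ n, ContDiff ℝ ∞ (φ n))
    (h1 : Tendsto (fun n => ∫ x in U, (u x - φ n x) ^ 2) atTop (𝓝 0))
    (h2 : ∀ i, Tendsto (fun n => ∫ x in U, (g i x - partialDeriv i (φ n) x) ^ 2) atTop (𝓝 0))
    (c : Plane) :
    Tendsto (fun n => ∫ x in U, edgeDensity c (φ n) (fun i => partialDeriv i (φ n)) x) atTop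
      (𝓝 (∫ x in U, edgeDensity c u g x)) := by
  have hfin := isFiniteMeasure_restrict_of_isBounded hb
  have hm := fun n => hasGrad_of_contDiff hb (hφ n)
  rw [hu.integral_edgeDensity hb]
  simp only [(hm _).integral_edgeDensity hb]
  exact (tendsto_integral_of_sq hu.memLp (fun n => (hm n).memLp) h1).add
    ((tendsto_finsetSum _ fun i _ => tendsto_integral_mul_right (hu.grad_memLp i)
      (memLp_of_continuous_of_isBounded hb (by fun_prop)) (fun n => (hm n).grad_memLp i)
      (h2 i)).const_mul _)

theorem segmentIntegral_eq {K : Finset Plane} (hK : IsTriangle K) {a b c : Plane}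
    (h : (K : Set Plane) = {a, b, c}) {φ : Plane → ℝ} (hφ : ContDiff ℝ ∞ φ) :
    segmentIntegral φ a b = dist a b * ((volume.real (elem K))⁻¹ *
      ∫ x in interior (elem K), edgeDensity c φ (fun i => partialDeriv i φ) x) := by
  have hv := hK.volume_pos
  rw [restrict_interior_elem, segmentIntegral]
  rw [elem_eq_convexHull h] at hv ⊢
  rw [integral_edgeDensity_eq (hK.linearIndependent h) hφ, inv_mul_cancel_left₀ hv.ne']

/-- The area integral is continuous under `H¹` convergence, so the edge integrals of every smooth
approximating sequence have the same limit; density supplies such a sequence. This settles existence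
and uniqueness of the trace integral together. -/
theorem hasEdgeIntegral_iff {K : Finset Plane} (hK : IsTriangle K) {a b c : Plane}
    (h : (K : Set Plane) = {a, b, c}) {u : Plane → ℝ} {g : Fin 2 → Plane → ℝ}
    (hu : HasGrad (interior (elem K)) u g) (m : ℝ) :
    HasEdgeIntegral K u a b m ↔ m = dist a b * ((volume.real (elem K))⁻¹ *
      ∫ x in interior (elem K), edgeDensity c u g x) := by
  have hb := isBounded_interior_elem K
  have lim : ∀ φ : ℕ → Plane → ℝ, (∀ n, ContDiff ℝ ∞ (φ n)) →
      Tendsto (fun n => sobolevNorm 1 (interior (elem K)) (u - φ n)) atTop (𝓝 0) →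
      Tendsto (fun n => segmentIntegral (φ n) a b) atTop (𝓝 (dist a b * ((volume.real (elem K))⁻¹ *
        ∫ x in interior (elem K), edgeDensity c u g x))) := by
    intro φ hφ hs
    obtain ⟨h1, h2⟩ := (tendsto_sobolevNorm_one_iff isOpen_interior hb hu hφ).1 hs
    simp only [segmentIntegral_eq hK h (hφ _)]
    exact ((hu.tendsto_integral_edgeDensity hb hφ h1 h2 c).const_mul _).const_mul _
  constructor
  · rintro ⟨-, φ, hφ, hs, hm⟩
    exact tendsto_nhds_unique hm (lim φ hφ hs)
  · rintro rfl
    refine ⟨memSobolev_one_iff.2 ⟨g, hu⟩, ?_⟩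
    obtain ⟨φ, hφ, h1, h2⟩ := hu.exists_smooth_approx isOpen_interior hb
      (convex_elem K).interior hK.interior_nonempty
    have hs := (tendsto_sobolevNorm_one_iff isOpen_interior hb hu hφ).2 ⟨h1, h2⟩
    exact ⟨φ, hφ, hs, lim φ hφ hs⟩

/-! ### The Crouzeix–Raviart interpolant -/

/-- The gradient of the Crouzeix–Raviart interpolant on `U`: the mean of the gradient. -/
def crGrad (U : Set Plane) (g : Fin 2 → Plane → ℝ) (i : Fin 2) : ℝ := ⨍ x in U, g i x

/-- The constant term of the Crouzeix–Raviart interpolant on `U` of a function with gradient `g`. -/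
def crConst (U : Set Plane) (u : Plane → ℝ) (g : Fin 2 → Plane → ℝ) : ℝ :=
  (⨍ x in U, u x) + (1 / 2 * ∑ i, (⨍ x in U, g i x * x i)
    - 3 / 2 * ∑ i, crGrad U g i * ⨍ x in U, x i)

theorem LinearIndependent.eq_zero_of_sum_mul_eq_zero {v w : Plane}
    (hl : LinearIndependent ℝ ![v, w]) {s : Fin 2 → ℝ} (h1 : ∑ i, s i * v i = 0)
    (h2 : ∑ i, s i * w i = 0) : s = 0 := by
  rw [Fin.sum_univ_two] at h1 h2
  have hdet : v 0 * w 1 - v 1 * w 0 ≠ 0 := by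
    intro hd
    have p1 := LinearIndependent.pair_iff.1 hl (w 1) (-v 1) (by
      ext i; fin_cases i <;> simp <;> linarith)
    have p0 := LinearIndependent.pair_iff.1 hl (w 0) (-v 0) (by
      ext i; fin_cases i <;> simp <;> linarith)
    have hv : v = 0 := by
      ext i; fin_cases i <;> simp
      · linarith [p0.2]
      · linarith [p1.2]
    exact one_ne_zero (LinearIndependent.pair_iff.1 hl 1 0 (by simp [hv])).1
  have e0 : s 0 * (v 0 * w 1 - v 1 * w 0) = 0 := by linear_combination w 1 * h1 - v 1 * h2
  have e1 : s 1 * (v 0 * w 1 - v 1 * w 0) = 0 := by linear_combination v 0 * h2 - w 0 * h1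
  funext i
  fin_cases i
  · simpa [hdet] using e0
  · simpa [hdet] using e1

/-- The interpolant is characterised by moments over the triangle. -/
theorem isCRInterpolant_affineFun_iff {K : Finset Plane} (hK : IsTriangle K) {u : Plane → ℝ}
    {g : Fin 2 → Plane → ℝ} (hu : HasGrad (interior (elem K)) u g) (α : ℝ) (G : Fin 2 → ℝ) :
    IsCRInterpolant K u (affineFun α G) ↔
      (∀ i, ∫ x in interior (elem K), (g i x - G i) = 0) ∧
      (∫ x in interior (elem K), (u x - affineFun α G x))
        + 1 / 2 * ∑ i, ∫ x in interior (elem K), (g i x - G i) * x i = 0 := by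
  have hb := isBounded_interior_elem K
  have hfin := isFiniteMeasure_restrict_of_isBounded hb
  have hp := hasGrad_affineFun hb α G
  have hd := hu.sub hp
  have hv := hK.volume_pos
  set U := interior (elem K) with hU
  have hmul : ∀ i, ∀ r : ℝ, ∫ x in U, (g i x - G i) * (x i - r)
      = (∫ x in U, (g i x - G i) * x i) - r * ∫ x in U, (g i x - G i) := by
    intro i r
    rw [← integral_const_mul, ← integral_sub ((hd.grad_memLp i).integrable_mul_two
      (memLp_of_continuous_of_isBounded hb (by fun_prop)))
      (((hd.grad_memLp i).integrable (by norm_num)).const_mul r)]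
    congr 1 with x
    ring
  have hdens : ∀ c : Plane, (∫ x in U, edgeDensity c u g x)
      - ∫ x in U, edgeDensity c (affineFun α G) (fun i _ => G i) x
      = ((∫ x in U, (u x - affineFun α G x)) + 1 / 2 * ∑ i, ∫ x in U, (g i x - G i) * x i)
        - 1 / 2 * ∑ i, (∫ x in U, (g i x - G i)) * c i := by
    intro c
    have e1 := hu.integral_edgeDensity hb c
    have e2 := hp.integral_edgeDensity hb c
    have e3 : ∀ i, ∫ x in U, (g i x - G i) * (x i - c i)
        = (∫ x in U, g i x * (x i - c i)) - ∫ x in U, G i * (x i - c i) := by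
      intro i
      have hx : MemLp (fun x : Plane => x i - c i) 2 (volume.restrict U) :=
        memLp_of_continuous_of_isBounded hb (by fun_prop)
      rw [← integral_sub ((hu.grad_memLp i).integrable_mul_two hx)
        ((hp.grad_memLp i).integrable_mul_two hx)]
      simp only [sub_mul]
    have e4 : ∫ x in U, (u x - affineFun α G x) = (∫ x in U, u x) - ∫ x in U, affineFun α G x :=
      integral_sub (hu.memLp.integrable (by norm_num)) (hp.memLp.integrable (by norm_num))
    simp only [hmul] at e3
    rw [e1, e2, e4]
    simp only [Fin.sum_univ_two]
    linarith [e3 0, e3 1]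
  -- The condition on an edge depends on that edge only through an affine expression in the opposite
  -- vertex `c`.
  have hedge : ∀ a b c : Plane, (K : Set Plane) = {a, b, c} → a ≠ b →
      (HasEdgeIntegral K u a b (segmentIntegral (affineFun α G) a b) ↔
        ((∫ x in U, (u x - affineFun α G x)) + 1 / 2 * ∑ i, ∫ x in U, (g i x - G i) * x i)
        - 1 / 2 * ∑ i, (∫ x in U, (g i x - G i)) * c i = 0) := by
    intro a b c h hab
    rw [hasEdgeIntegral_iff hK h hu, segmentIntegral_eq hK h (contDiff_affineFun α G), ← hdens c,
      sub_eq_zero]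
    simp only [partialDeriv_affineFun]
    rw [mul_right_inj' (dist_pos.2 hab).ne', mul_right_inj' (inv_ne_zero hv.ne'), eq_comm]
  constructor
  · rintro ⟨-, H⟩
    obtain ⟨a, b, c, hab, hac, hbc, rfl⟩ := Finset.card_eq_three.1 hK.1
    have hc := (hedge a b c (by simp) hab).1 (H a (by simp) b (by simp) hab)
    have hbb := (hedge a c b (by simp [Set.pair_comm]) hac).1 (H a (by simp) c (by simp) hac)
    have ha := (hedge b c a (by
      push_cast
      rw [Set.insert_comm a, Set.pair_comm a]) hbc).1 (H b (by simp) c (by simp) hbc)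
    have hl := hK.linearIndependent (a := a) (b := b) (c := c) (by simp)
    -- Differences of the three edge conditions say that the integrated gradient defect is
    -- orthogonal to two independent edge vectors, hence zero.
    have h0 := LinearIndependent.eq_zero_of_sum_mul_eq_zero hl
      (s := fun i => ∫ x in U, (g i x - G i)) (by
        simp only [Fin.sum_univ_two, PiLp.sub_apply] at ha hbb hc ⊢; linarith) (by
        simp only [Fin.sum_univ_two, PiLp.sub_apply] at ha hbb hc ⊢; linarith)
    have h0' : ∀ i, ∫ x in U, (g i x - G i) = 0 := fun i => congrFun h0 i
    refine ⟨h0', ?_⟩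
    simpa [h0'] using hc
  · rintro ⟨h0, h1⟩
    refine ⟨isPoly_affineFun α G, fun a ha b hb hab => ?_⟩
    obtain ⟨c, -, -, h⟩ := hK.exists_third ha hb hab
    rw [hedge a b c (by rw [h]; simp) hab, h1]
    simp [h0]

/-- The moment conditions form a triangular linear system: the first fixes `G`, the second then
fixes `α`. The product of `G` with the centroid enters once through the affine function and with
weight `1/2` through the gradient term, which explains the `3/2` in `crConst`. -/
theorem isCRInterpolant_iff_eq {K : Finset Plane} (hK : IsTriangle K) {u : Plane → ℝ}
    {g : Fin 2 → Plane → ℝ} (hu : HasGrad (interior (elem K)) u g) (α : ℝ) (G : Fin 2 → ℝ) :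
    IsCRInterpolant K u (affineFun α G) ↔
      α = crConst (interior (elem K)) u g ∧ G = crGrad (interior (elem K)) g := by
  have hb := isBounded_interior_elem K
  have hfin := isFiniteMeasure_restrict_of_isBounded hb
  have hV : 0 < volume.real (interior (elem K)) := by
    rw [← measureReal_restrict_apply_univ, restrict_interior_elem, measureReal_restrict_apply_univ]
    exact hK.volume_pos
  set U := interior (elem K) with hU
  have hx : ∀ i : Fin 2, MemLp (fun x : Plane => x i) 2 (volume.restrict U) := fun i =>
    memLp_of_continuous_of_isBounded hb (by fun_prop)
  have gi : ∀ i, Integrable (g i) (volume.restrict U) := fun i => (hu.grad_memLp i).integrable (by norm_num)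
  have xi : ∀ i : Fin 2, Integrable (fun x : Plane => x i) (volume.restrict U) := fun i =>
    (hx i).integrable (by norm_num)
  have gxi : ∀ i, Integrable (fun x : Plane => g i x * x i) (volume.restrict U) := fun i =>
    (hu.grad_memLp i).integrable_mul_two (hx i)
  rw [isCRInterpolant_affineFun_iff hK hu, ← hU]
  have e1 : ∀ i, ∫ x in U, (g i x - G i) = (∫ x in U, g i x) - volume.real U * G i := by
    intro i
    rw [integral_sub (gi i) (integrable_const _), integral_const, measureReal_restrict_apply_univ,
      smul_eq_mul]
  have e2 : ∀ i, ∫ x in U, (g i x - G i) * x i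
      = (∫ x in U, g i x * x i) - G i * ∫ x in U, x i := by
    intro i
    simp only [sub_mul]
    rw [integral_sub (gxi i) ((xi i).const_mul _), integral_const_mul]
  have e3 : ∫ x in U, (u x - affineFun α G x)
      = (∫ x in U, u x) - (volume.real U * α + ∑ i, G i * ∫ x in U, x i) := by
    rw [integral_sub (hu.memLp.integrable (by norm_num))
      ((hasGrad_affineFun hb α G).memLp.integrable (by norm_num))]
    unfold affineFun
    rw [integral_add (integrable_const _) (integrable_finsetSum _ fun i _ => (xi i).const_mul _),
      integral_const, measureReal_restrict_apply_univ, smul_eq_mul,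
      integral_finsetSum _ fun i _ => (xi i).const_mul _]
    simp only [integral_const_mul]
  have e4 : (∀ i, ∫ x in U, (g i x - G i) = 0) ↔ G = crGrad U g := by
    rw [funext_iff]
    refine forall_congr' fun i => ?_
    rw [e1, crGrad, setAverage_eq, smul_eq_mul, sub_eq_zero, eq_comm (a := G i),
      inv_mul_eq_iff_eq_mul₀ hV.ne']
  rw [e4, e3]
  constructor
  · rintro ⟨rfl, h⟩
    refine ⟨?_, rfl⟩
    simp only [e2, crConst, setAverage_eq, smul_eq_mul, Fin.sum_univ_two] at h ⊢
    field_simp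
    linarith
  · rintro ⟨rfl, rfl⟩
    refine ⟨rfl, ?_⟩
    simp only [e2, crConst, setAverage_eq, smul_eq_mul, Fin.sum_univ_two]
    field_simp
    ring

theorem crInterpOn_eq {K : Finset Plane} (hK : IsTriangle K) {u : Plane → ℝ}
    {g : Fin 2 → Plane → ℝ} (hu : HasGrad (interior (elem K)) u g) :
    crInterpOn K u = affineFun (crConst (interior (elem K)) u g) (crGrad (interior (elem K)) g) := by
  have hex : ∃ p, IsCRInterpolant K u p := ⟨_, (isCRInterpolant_iff_eq hK hu _ _).2 ⟨rfl, rfl⟩⟩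
  rw [crInterpOn, dif_pos hex]
  obtain ⟨α, G, h⟩ := hex.choose_spec.1.exists_affineFun
  have := hex.choose_spec
  rw [h, isCRInterpolant_iff_eq hK hu] at this
  rw [h, this.1, this.2]

/-! ### Interpolation errors -/

/-- The squared `L²(U)` norm of a matrix field. -/
def energy₂ (U : Set Plane) (H : Fin 2 → Fin 2 → Plane → ℝ) : ℝ := ∑ i, energy U (H i)

theorem energy₂_nonneg (U : Set Plane) (H : Fin 2 → Fin 2 → Plane → ℝ) : 0 ≤ energy₂ U H :=
  Finset.sum_nonneg fun _ _ => energy_nonneg _ _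

/-- The residual of the Crouzeix–Raviart interpolation of a function `u` with gradient `g`. -/
def crResidual (U : Set Plane) (u : Plane → ℝ) (g : Fin 2 → Plane → ℝ) (x : Plane) : ℝ :=
  u x - affineFun (crConst U u g) (crGrad U g) x

theorem volume_real_interior_elem_pos {K : Finset Plane} (hK : IsTriangle K) :
    0 < volume.real (interior (elem K)) := by
  rw [← measureReal_restrict_apply_univ, restrict_interior_elem, measureReal_restrict_apply_univ]
  exact hK.volume_pos

theorem HasGrad.integral_crResidual {K : Finset Plane} (hK : IsTriangle K) {u : Plane → ℝ}
    {g : Fin 2 → Plane → ℝ} (hu : HasGrad (interior (elem K)) u g) :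
    (∀ i, ∫ x in interior (elem K), (g i x - crGrad (interior (elem K)) g i) = 0) ∧
    (∫ x in interior (elem K), crResidual (interior (elem K)) u g x)
      + 1 / 2 * ∑ i, ∫ x in interior (elem K), (g i x - crGrad (interior (elem K)) g i) * x i = 0 :=
  (isCRInterpolant_affineFun_iff hK hu _ _).1 ((isCRInterpolant_iff_eq hK hu _ _).2 ⟨rfl, rfl⟩)

/-- The interpolation error of the Crouzeix–Raviart interpolant. -/
theorem HasGrad.normSq_crResidual_le {K : Finset Plane} (hK : IsTriangle K) {h : ℝ}
    (hdiam : ∀ x ∈ elem K, ∀ y ∈ elem K, dist x y ≤ h) {u : Plane → ℝ} {g : Fin 2 → Plane → ℝ}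
    {H : Fin 2 → Fin 2 → Plane → ℝ} (hu : HasGrad (interior (elem K)) u g)
    (hg : ∀ i, HasGrad (interior (elem K)) (g i) (H i)) :
    normSq (interior (elem K)) (crResidual (interior (elem K)) u g)
      ≤ 5 * h ^ 4 * energy₂ (interior (elem K)) H := by
  have hb := isBounded_interior_elem K
  have hfin := isFiniteMeasure_restrict_of_isBounded hb
  have hV := volume_real_interior_elem_pos hK
  have hm := hu.integral_crResidual hK
  have hd' : ∀ x ∈ interior (elem K), ∀ y ∈ interior (elem K), dist x y ≤ h := fun x hx y hy =>
    hdiam x (interior_subset hx) y (interior_subset hy)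
  obtain ⟨y, hy⟩ := hK.interior_nonempty
  have hcU := (convex_elem K).interior
  have hU : IsOpen (interior (elem K)) := isOpen_interior
  set U := interior (elem K) with hUdef
  have he := hu.sub (hasGrad_affineFun hb (crConst U u g) (crGrad U g))
  set γ : Fin 2 → Plane → ℝ := fun i x => g i x - crGrad U g i with hγ
  have hgrad : energy U γ ≤ 2 * h ^ 2 * energy₂ U H := by
    rw [energy, energy₂, Finset.mul_sum]
    exact Finset.sum_le_sum fun i _ => (hg i).poincare hU hcU hb hd'
  have hvar := he.variance_le hU hcU hb hd'
  -- The mean of the residual is fixed by the first moment of the gradient defect `γ`. As `γ` has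
  -- integral zero, coordinates may be centred at a point `y` of the triangle, where `|x i - y i| ≤
  -- h`.
  have hmean : (∫ x in U, crResidual U u g x) ^ 2 ≤ 1 / 2 * h ^ 2 * (volume.real U * energy U γ) := by
    have hi : ∀ i, ∫ x in U, γ i x * x i = ∫ x in U, γ i x * (x i - y i) := by
      intro i
      have e : ∀ x : Plane, γ i x * (x i - y i) = γ i x * x i - y i * γ i x := fun x => by ring
      simp only [e]
      rw [integral_sub ((he.grad_memLp i).integrable_mul_two
        (memLp_of_continuous_of_isBounded hb (by fun_prop)))
        (((he.grad_memLp i).integrable (by norm_num)).const_mul _), integral_const_mul]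
      have := hm.1 i
      simp only [hγ, this, mul_zero, sub_zero]
    have hbound : ∀ i, (∫ x in U, γ i x * (x i - y i)) ^ 2 ≤ normSq U (γ i) * (h ^ 2 * volume.real U) := by
      intro i
      have hx : MemLp (fun x : Plane => x i - y i) 2 (volume.restrict U) :=
        memLp_of_continuous_of_isBounded hb (by fun_prop)
      refine (sq_integral_mul_le (he.grad_memLp i) hx).trans ?_
      refine mul_le_mul_of_nonneg_left ?_ (normSq_nonneg _ _)
      rw [mul_comm (h ^ 2), ← smul_eq_mul, ← measureReal_restrict_apply_univ, ← integral_const]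
      refine integral_mono_ae hx.integrable_sq (integrable_const _) ?_
      refine (ae_restrict_mem hU.measurableSet).mono fun x hx => ?_
      have h1 : |x i - y i| ≤ h := by
        refine le_trans ?_ (hd' x hx y hy)
        rw [dist_eq_norm]
        exact PiLp.norm_apply_le (x - y) i
      exact sq_le_sq' (abs_le.1 h1).1 (abs_le.1 h1).2
    have e := hm.2
    have e' : (∫ x in U, crResidual U u g x)
        = -(1 / 2) * ((∫ x in U, γ 0 x * (x 0 - y 0)) + ∫ x in U, γ 1 x * (x 1 - y 1)) := by
      rw [Fin.sum_univ_two] at e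
      rw [← hi, ← hi]
      linarith
    rw [e', energy, Fin.sum_univ_two]
    nlinarith [hbound 0, hbound 1, sq_nonneg ((∫ x in U, γ 0 x * (x 0 - y 0))
      - ∫ x in U, γ 1 x * (x 1 - y 1))]
  have hn : 0 ≤ volume.real U * energy U γ := mul_nonneg hV.le (energy_nonneg _ _)
  -- The variance contributes `2 h²` and the squared mean `½ h²`. Poincaré's inequality for the
  -- gradient then adds a factor `2 h²`.
  have h1 : volume.real U * normSq U (crResidual U u g) ≤ 5 / 2 * h ^ 2 * (volume.real U * energy U γ) := by
    have : volume.real U * normSq U (crResidual U u g) - (∫ x in U, crResidual U u g x) ^ 2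
      ≤ 2 * h ^ 2 * (volume.real U * energy U γ) := hvar
    linarith
  have h2 : volume.real U * normSq U (crResidual U u g)
      ≤ volume.real U * (5 * h ^ 4 * energy₂ U H) := by
    refine h1.trans ?_
    have := mul_le_mul_of_nonneg_left hgrad (mul_nonneg (sq_nonneg h) hV.le)
    nlinarith
  exact le_of_mul_le_mul_left h2 hV

/-! ### Additivity and reflection of the interpolation error -/

section Average

variable {U : Set Plane}

theorem setAverage_add {f f' : Plane → ℝ} (hf : Integrable f (volume.restrict U))
    (hf' : Integrable f' (volume.restrict U)) :
    ⨍ x in U, (f x + f' x) = (⨍ x in U, f x) + ⨍ x in U, f' x := by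
  simp only [setAverage_eq, smul_eq_mul]
  rw [integral_add hf hf', mul_add]

theorem setAverage_const_mul (f : Plane → ℝ) (c : ℝ) :
    ⨍ x in U, c * f x = c * ⨍ x in U, f x := by
  simp only [setAverage_eq, smul_eq_mul]
  rw [integral_const_mul]
  ring

theorem setAverage_const' (hV : 0 < volume.real U) (c : ℝ) :
    ⨍ _ in U, c = c := by
  rw [setAverage_eq, integral_const, measureReal_restrict_apply_univ, smul_eq_mul, smul_eq_mul,
    inv_mul_cancel_left₀ hV.ne']

theorem HasGrad.integrable_grad_mul_coord (hb : Bornology.IsBounded U) {u : Plane → ℝ}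
    {g : Fin 2 → Plane → ℝ} (hu : HasGrad U u g) (i j : Fin 2) :
    Integrable (fun x : Plane => g i x * x j) (volume.restrict U) :=
  (hu.grad_memLp i).integrable_mul_two (memLp_of_continuous_of_isBounded hb (by fun_prop))

theorem HasGrad.integrable (hb : Bornology.IsBounded U) {u : Plane → ℝ}
    {g : Fin 2 → Plane → ℝ} (hu : HasGrad U u g) : Integrable u (volume.restrict U) := by
  have hfin := isFiniteMeasure_restrict_of_isBounded hb
  exact hu.memLp.integrable (by norm_num)

theorem HasGrad.integrable_grad (hb : Bornology.IsBounded U) {u : Plane → ℝ}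
    {g : Fin 2 → Plane → ℝ} (hu : HasGrad U u g) (i : Fin 2) :
    Integrable (g i) (volume.restrict U) := by
  have hfin := isFiniteMeasure_restrict_of_isBounded hb
  exact (hu.grad_memLp i).integrable (by norm_num)

theorem crResidual_add (hb : Bornology.IsBounded U) {u u' : Plane → ℝ}
    {g g' : Fin 2 → Plane → ℝ} (hu : HasGrad U u g) (hu' : HasGrad U u' g') (x : Plane) :
    crResidual U (fun x => u x + u' x) (fun i x => g i x + g' i x) x
      = crResidual U u g x + crResidual U u' g' x := by
  have h1 := setAverage_add (hu.integrable hb) (hu'.integrable hb)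
  have h2 := fun i => setAverage_add (hu.integrable_grad hb i) (hu'.integrable_grad hb i)
  have h3 := fun i => setAverage_add (hu.integrable_grad_mul_coord hb i i)
    (hu'.integrable_grad_mul_coord hb i i)
  simp only [crResidual, crConst, crGrad, affineFun, add_mul, h1, h2, h3, Fin.sum_univ_two]
  ring

theorem setAverage_affineFun (hb : Bornology.IsBounded U) (hV : 0 < volume.real U) (α : ℝ)
    (G : Fin 2 → ℝ) :
    ⨍ x in U, affineFun α G x = α + ∑ i, G i * ⨍ x in U, x i := by
  have hfin := isFiniteMeasure_restrict_of_isBounded hb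
  have hx : ∀ i : Fin 2, Integrable (fun x : Plane => G i * x i) (volume.restrict U) := fun i =>
    integrable_of_continuous_of_isBounded hb (by fun_prop)
  have h2 : Integrable (fun x : Plane => G 0 * x 0 + G 1 * x 1) (volume.restrict U) :=
    (hx 0).add (hx 1)
  simp only [affineFun, Fin.sum_univ_two]
  rw [setAverage_add (integrable_const _) h2, setAverage_add (hx 0) (hx 1),
    setAverage_const' hV, setAverage_const_mul, setAverage_const_mul]

theorem crResidual_affineFun (hb : Bornology.IsBounded U) (hV : 0 < volume.real U) (α : ℝ)
    (G : Fin 2 → ℝ) (x : Plane) : crResidual U (affineFun α G) (fun i _ => G i) x = 0 := by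
  simp only [crResidual, crConst, crGrad, setAverage_affineFun hb hV, setAverage_const_mul,
    setAverage_const' hV]
  simp only [affineFun, crGrad, setAverage_const' hV, Fin.sum_univ_two]
  ring

end Average

/-- The point reflection `x ↦ s - x`. -/
def pointReflect (s x : Plane) : Plane := s - x

theorem setIntegral_pointReflect (s : Plane) {U V : Set Plane} (hU : MeasurableSet U)
    (hV : MeasurableSet V) (h : ∀ x, x ∈ U ↔ pointReflect s x ∈ V) (F : Plane → ℝ) :
    ∫ x in V, F x = ∫ x in U, F (pointReflect s x) := by
  rw [← integral_indicator hU, ← integral_indicator hV, ← integral_sub_left_eq_self _ volume s]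
  congr 1 with x
  by_cases hx : x ∈ U
  · have hx' : s - x ∈ V := (h x).1 hx
    simp [hx, hx', pointReflect]
  · have hx' : s - x ∉ V := fun h' => hx ((h x).2 h')
    simp [hx, hx']

theorem volume_real_pointReflect (s : Plane) {U V : Set Plane} (hU : MeasurableSet U)
    (hV : MeasurableSet V) (h : ∀ x, x ∈ U ↔ pointReflect s x ∈ V) :
    volume.real V = volume.real U := by
  simpa using setIntegral_pointReflect s hU hV h (fun _ => 1)

theorem setAverage_pointReflect (s : Plane) {U V : Set Plane} (hU : MeasurableSet U)
    (hV : MeasurableSet V) (h : ∀ x, x ∈ U ↔ pointReflect s x ∈ V) (F : Plane → ℝ) :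
    ⨍ x in V, F x = ⨍ x in U, F (pointReflect s x) := by
  rw [setAverage_eq, setAverage_eq, setIntegral_pointReflect s hU hV h,
    volume_real_pointReflect s hU hV h]

/-- The bilinear form `∫_U (u - Π_CR u)(v - Π⁰ v)`. -/
def errForm (U : Set Plane) (u : Plane → ℝ) (g : Fin 2 → Plane → ℝ) (v : Plane → ℝ) : ℝ :=
  ∫ x in U, crResidual U u g x * (v x - ⨍ y in U, v y)

/-- The quadratic function `α + G · x + ½ x · A x`. -/
def quadFun (α : ℝ) (G : Fin 2 → ℝ) (A : Fin 2 → Fin 2 → ℝ) (x : Plane) : ℝ :=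
  affineFun α G x + 1 / 2 * ∑ i, ∑ j, A i j * (x i * x j)

theorem contDiff_quadFun (α : ℝ) (G : Fin 2 → ℝ) (A : Fin 2 → Fin 2 → ℝ) :
    ContDiff ℝ ∞ (quadFun α G A) := by
  unfold quadFun affineFun
  fun_prop

theorem partialDeriv_quadFun (α : ℝ) (G : Fin 2 → ℝ) {A : Fin 2 → Fin 2 → ℝ}
    (hA : ∀ i j, A i j = A j i) (i : Fin 2) :
    partialDeriv i (quadFun α G A) = affineFun (G i) (A i) := by
  funext x
  have hc : ∀ j : Fin 2, HasFDerivAt (fun x : Plane => x j) (EuclideanSpace.proj j : Plane →L[ℝ] ℝ) x :=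
    fun j => (EuclideanSpace.proj j : Plane →L[ℝ] ℝ).hasFDerivAt
  have hd : HasFDerivAt (quadFun α G A) (∑ j, G j • (EuclideanSpace.proj j : Plane →L[ℝ] ℝ)
      + (1 / 2 : ℝ) • ∑ j, ∑ k, A j k • (x j • (EuclideanSpace.proj k : Plane →L[ℝ] ℝ)
        + x k • (EuclideanSpace.proj j : Plane →L[ℝ] ℝ))) x :=
    ((HasFDerivAt.fun_sum fun j _ => (hc j).const_mul (G j)).const_add α).add
      ((HasFDerivAt.fun_sum fun j _ => HasFDerivAt.fun_sum fun k _ =>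
        ((hc j).mul (hc k)).const_mul (A j k)).const_mul (1 / 2))
  have h10 := hA 1 0
  rw [partialDeriv, hd.fderiv]
  fin_cases i <;> simp [affineFun, Fin.sum_univ_two, h10] <;> ring

theorem hasGrad_quadFun {U : Set Plane} (hb : Bornology.IsBounded U) (α : ℝ) (G : Fin 2 → ℝ)
    {A : Fin 2 → Fin 2 → ℝ} (hA : ∀ i j, A i j = A j i) :
    HasGrad U (quadFun α G A) (fun i => affineFun (G i) (A i)) := by
  have h := hasGrad_of_contDiff hb (contDiff_quadFun α G A)
  simpa only [partialDeriv_quadFun α G hA] using h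

/-- Interpolation commutes with the reflection because all averages do. The gradient changes sign by
the chain rule. -/
theorem crResidual_pointReflect (s : Plane) {U V : Set Plane} (hU : MeasurableSet U)
    (hV : MeasurableSet V) (h : ∀ x, x ∈ U ↔ pointReflect s x ∈ V) (hb : Bornology.IsBounded U)
    (hpos : 0 < volume.real U) {w : Plane → ℝ} {g : Fin 2 → Plane → ℝ}
    (hg : ∀ i, Integrable (fun x => g i (pointReflect s x)) (volume.restrict U))
    (hgx : ∀ i, Integrable (fun x => g i (pointReflect s x) * x i) (volume.restrict U)) (x : Plane) :
    crResidual V w g (pointReflect s x) = crResidual U (fun x => w (pointReflect s x))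
      (fun i x => -g i (pointReflect s x)) x := by
  have hfin := isFiniteMeasure_restrict_of_isBounded hb
  have a1 := fun F => setAverage_pointReflect s hU hV h F
  have hx : ∀ i : Fin 2, Integrable (fun x : Plane => (-1) * x i) (volume.restrict U) := fun i =>
    integrable_of_continuous_of_isBounded hb (by fun_prop)
  have e1 : ∀ i, ⨍ x in U, -g i (pointReflect s x) = -⨍ x in U, g i (pointReflect s x) := fun i => by simp
  have e2 : ∀ i : Fin 2, ⨍ x in U, pointReflect s x i = s i - ⨍ x in U, x i := fun i => by
    have e : ∀ x : Plane, pointReflect s x i = s i + (-1) * x i := fun x => by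
      simp [pointReflect]; ring
    simp only [e]
    rw [setAverage_add (integrable_const _) (hx i), setAverage_const' hpos, setAverage_const_mul]
    ring
  have e3 : ∀ i, ⨍ x in U, g i (pointReflect s x) * pointReflect s x i
      = s i * (⨍ x in U, g i (pointReflect s x)) - ⨍ x in U, g i (pointReflect s x) * x i := fun i => by
    have e : ∀ x : Plane, g i (pointReflect s x) * pointReflect s x i
        = s i * g i (pointReflect s x) + (-1) * (g i (pointReflect s x) * x i) := fun x => by
      simp [pointReflect]; ring
    simp only [e]
    rw [setAverage_add ((hg i).const_mul _) ((hgx i).const_mul _), setAverage_const_mul,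
      setAverage_const_mul]
    ring
  have e4 : ∀ i, ⨍ x in U, -g i (pointReflect s x) * x i
      = -⨍ x in U, g i (pointReflect s x) * x i := fun i => by simp
  simp only [crResidual, crConst, crGrad, a1, e1, e2, e3, e4, affineFun, Fin.sum_univ_two]
  simp only [pointReflect, PiLp.sub_apply]
  ring

/-- On the union of a set and its reflection, the interpolation errors of a quadratic function and
an affine function are orthogonal. -/
theorem errForm_add_errForm_eq_zero (s : Plane) {U V : Set Plane} (hU : IsOpen U)
    (hV : IsOpen V) (h : ∀ x, x ∈ U ↔ pointReflect s x ∈ V) (hb : Bornology.IsBounded U)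
    (hpos : 0 < volume.real U) (α : ℝ) (G : Fin 2 → ℝ) {A : Fin 2 → Fin 2 → ℝ}
    (hA : ∀ i j, A i j = A j i) (β : ℝ) (B : Fin 2 → ℝ) :
    errForm U (quadFun α G A) (fun i => affineFun (G i) (A i)) (affineFun β B)
      + errForm V (quadFun α G A) (fun i => affineFun (G i) (A i)) (affineFun β B) = 0 := by
  have hm := hU.measurableSet
  have hm' := hV.measurableSet
  have hr : Continuous (pointReflect s) := by unfold pointReflect; fun_prop
  -- The residual is even: the reflected quadratic equals the original plus an affine function,
  -- whose residual vanishes.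
  have hres : ∀ x, crResidual V (quadFun α G A) (fun i => affineFun (G i) (A i)) (pointReflect s x)
      = crResidual U (quadFun α G A) (fun i => affineFun (G i) (A i)) x := by
    intro x
    rw [crResidual_pointReflect s hm hm' h hb hpos]
    · let G' : Fin 2 → ℝ := fun i => -2 * G i - ∑ j, A i j * s j
      let α' : ℝ := (∑ i, G i * s i) + 1 / 2 * ∑ i, ∑ j, A i j * (s i * s j)
      have h10 := hA 1 0
      have e1 : (fun x => quadFun α G A (pointReflect s x))
          = fun x => quadFun α G A x + affineFun α' G' x := by
        funext x
        simp only [quadFun, affineFun, pointReflect, Fin.sum_univ_two, PiLp.sub_apply, G', α', h10]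
        ring
      have e2 : (fun i x => -affineFun (G i) (A i) (pointReflect s x))
          = fun i x => affineFun (G i) (A i) x + G' i := by
        funext i x
        simp only [affineFun, pointReflect, Fin.sum_univ_two, PiLp.sub_apply, G']
        ring
      rw [e1, e2, crResidual_add hb (hasGrad_quadFun hb α G hA) (hasGrad_affineFun hb α' G'),
        crResidual_affineFun hb hpos, add_zero]
    · exact fun i => integrable_of_continuous_of_isBounded hb
        ((contDiff_affineFun _ _).continuous.comp hr)
    · exact fun i => integrable_of_continuous_of_isBounded hb
        (((contDiff_affineFun _ _).continuous.comp hr).mul (by fun_prop))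
  -- An affine function minus its mean is odd under the reflection.
  have hv : ∀ x, affineFun β B (pointReflect s x) - ⨍ y in V, affineFun β B y
      = -(affineFun β B x - ⨍ y in U, affineFun β B y) := by
    intro x
    rw [setAverage_pointReflect s hm hm' h]
    have e : (fun x => affineFun β B (pointReflect s x))
        = affineFun (β + ∑ i, B i * s i) (fun i => -B i) := by
      funext x
      simp only [affineFun, pointReflect, Fin.sum_univ_two, PiLp.sub_apply]
      ring
    have e' : ∀ x, affineFun β B (pointReflect s x)
        = affineFun (β + ∑ i, B i * s i) (fun i => -B i) x := congrFun e
    simp only [e']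
    rw [setAverage_affineFun hb hpos, setAverage_affineFun hb hpos]
    simp only [affineFun, Fin.sum_univ_two]
    ring
  have e : errForm V (quadFun α G A) (fun i => affineFun (G i) (A i)) (affineFun β B)
      = -errForm U (quadFun α G A) (fun i => affineFun (G i) (A i)) (affineFun β B) := by
    rw [errForm, errForm, setIntegral_pointReflect s hm hm' h, ← integral_neg]
    simp only [hres, hv, mul_neg]
  rw [e, add_neg_cancel]

/-! ### Pairs of triangles forming a parallelogram -/

theorem volume_convexHull_pair (a b : Plane) : volume (convexHull ℝ {a, b}) = 0 := by
  have hc : Convex ℝ (convexHull ℝ ({a, b} : Set Plane)) := convex_convexHull _ _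
  have hi : interior (convexHull ℝ ({a, b} : Set Plane)) = ∅ := by
    by_contra h
    have h' := interior_convexHull_nonempty_iff_affineSpan_eq_top.1 (Set.nonempty_iff_ne_empty.2 h)
    have h1 := collinear_iff_finrank_le_one.1 (collinear_pair ℝ a b)
    rw [← direction_affineSpan, h', AffineSubspace.direction_top, finrank_top] at h1
    simp at h1
  rw [← measure_congr (interior_ae_eq hc), hi, measure_empty]

theorem FormParallelogram.exists_eq {K L : Finset Plane} (h : FormParallelogram K L) :
    ∃ a b c : Plane, (K : Set Plane) = {a, b, c} ∧ (L : Set Plane) = {a, b, a + b - c} := by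
  obtain ⟨a, b, c, d, hK, hL, hm⟩ := h
  refine ⟨a, b, c, hK, ?_⟩
  rw [midpoint_eq_smul_add, midpoint_eq_smul_add] at hm
  have : a + b = c + d := smul_right_injective Plane (by norm_num : (⅟2 : ℝ) ≠ 0) hm
  rw [hL, this, add_sub_cancel_left]

section Parallelogram

variable {K L : Finset Plane} {a b c : Plane}

theorem mem_elem_of_pointReflect {a b c x : Plane} (hx : x ∈ convexHull ℝ {a, b, c}) :
    pointReflect (a + b) x ∈ convexHull ℝ {a, b, a + b - c} := by
  obtain ⟨z, y, h0, h1, h2, rfl⟩ := mem_convexHull_triple.1 hx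
  -- The reflection exchanges `a` and `b`; after swapping them in the target the coordinates `z`,
  -- `y` are unchanged.
  rw [Set.insert_comm, mem_convexHull_triple]
  refine ⟨z, y, h0, h1, h2, ?_⟩
  unfold pointReflect
  module

theorem mem_elem_iff_pointReflect (hK : (K : Set Plane) = {a, b, c})
    (hL : (L : Set Plane) = {a, b, a + b - c}) (x : Plane) :
    x ∈ elem K ↔ pointReflect (a + b) x ∈ elem L := by
  rw [elem_eq_convexHull hK, elem_eq_convexHull hL]
  refine ⟨mem_elem_of_pointReflect, fun h => ?_⟩
  have := mem_elem_of_pointReflect h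
  simpa [pointReflect] using this

theorem mem_interior_elem_iff_pointReflect (hK : (K : Set Plane) = {a, b, c})
    (hL : (L : Set Plane) = {a, b, a + b - c}) (x : Plane) :
    x ∈ interior (elem K) ↔ pointReflect (a + b) x ∈ interior (elem L) := by
  have e : elem K = Homeomorph.subLeft (a + b) ⁻¹' elem L := by
    ext x
    exact mem_elem_iff_pointReflect hK hL x
  rw [e, ← Homeomorph.preimage_interior]
  rfl

/-- The parallelogram is the image of the unit square, cut by the diagonal `s + t = 1` into the two
triangles. Its convexity, needed for Poincaré's inequality, is read off from this. -/
theorem elem_union_eq (hK : (K : Set Plane) = {a, b, c})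
    (hL : (L : Set Plane) = {a, b, a + b - c}) (x : Plane) : x ∈ elem K ∪ elem L ↔
      ∃ s t : ℝ, s ∈ Set.Icc (0 : ℝ) 1 ∧ t ∈ Set.Icc (0 : ℝ) 1 ∧ x = c + s • (a - c) + t • (b - c) := by
  rw [elem_eq_convexHull hK, elem_eq_convexHull hL, Set.mem_union, mem_convexHull_triple,
    mem_convexHull_triple]
  constructor
  · rintro (⟨z, y, h0, h1, h2, rfl⟩ | ⟨z, y, h0, h1, h2, rfl⟩)
    · exact ⟨z - y, y, ⟨by linarith, by linarith⟩, ⟨h0, by linarith⟩, by module⟩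
    · exact ⟨1 - y, 1 - z + y, ⟨by linarith, by linarith⟩, ⟨by linarith, by linarith⟩, by module⟩
  · rintro ⟨s, t, hs, ht, rfl⟩
    rcases le_total (s + t) 1 with h | h
    · exact Or.inl ⟨s + t, t, ht.1, by linarith [hs.1], h, by module⟩
    · exact Or.inr ⟨2 - s - t, 1 - s, by linarith [hs.2], by linarith [ht.2], by linarith, by module⟩

theorem convex_elem_union (hK : (K : Set Plane) = {a, b, c})
    (hL : (L : Set Plane) = {a, b, a + b - c}) : Convex ℝ (elem K ∪ elem L) := by
  intro x hx y hy p q hp hq hpq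
  rw [elem_union_eq hK hL] at hx hy ⊢
  obtain ⟨s, t, hs, ht, rfl⟩ := hx
  obtain ⟨s', t', hs', ht', rfl⟩ := hy
  refine ⟨p • s + q • s', p • t + q • t', convex_Icc 0 1 hs hs' hp hq hpq,
    convex_Icc 0 1 ht ht' hp hq hpq, ?_⟩
  have : q = 1 - p := by linarith
  subst this
  simp only [smul_eq_mul]
  module

/-- Comparing the coordinates of a common point forces `z = 1`, so the overlap lies on the shared
edge. -/
theorem volume_elem_inter (hT : IsTriangle K) (hK : (K : Set Plane) = {a, b, c})
    (hL : (L : Set Plane) = {a, b, a + b - c}) : volume (elem K ∩ elem L) = 0 := by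
  refine measure_mono_null (fun x hx => ?_) (volume_convexHull_pair a b)
  rw [elem_eq_convexHull hK, elem_eq_convexHull hL, Set.mem_inter_iff, mem_convexHull_triple,
    mem_convexHull_triple] at hx
  obtain ⟨⟨z, y, h0, h1, h2, hx1⟩, ⟨z', y', h0', h1', h2', hx2⟩⟩ := hx
  have e : (z - y - (1 - y')) • (a - c) + (y - (1 - z' + y')) • (b - c) = 0 := by
    have h3 := hx1.symm.trans hx2
    rw [← sub_eq_zero] at h3
    rw [← h3]
    module
  obtain ⟨p, q⟩ := LinearIndependent.pair_iff.1 (hT.linearIndependent hK) _ _ e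
  have hz : z = 1 := by linarith
  rw [convexHull_pair, segment_eq_image]
  refine ⟨y, ⟨h0, by linarith⟩, ?_⟩
  rw [hx1, hz]
  module

theorem dist_le_of_mem_elem_union (hK : (K : Set Plane) = {a, b, c})
    (hL : (L : Set Plane) = {a, b, a + b - c}) {h : ℝ}
    (hdK : ∀ x ∈ elem K, ∀ y ∈ elem K, dist x y ≤ h) (hdL : ∀ x ∈ elem L, ∀ y ∈ elem L, dist x y ≤ h) :
    ∀ x ∈ elem K ∪ elem L, ∀ y ∈ elem K ∪ elem L, dist x y ≤ 2 * h := by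
  have haK : a ∈ elem K := subset_convexHull _ _ (by rw [hK]; simp)
  have haL : a ∈ elem L := subset_convexHull _ _ (by rw [hL]; simp)
  have ha : ∀ x ∈ elem K ∪ elem L, dist x a ≤ h := by
    rintro x (hx | hx)
    · exact hdK x hx a haK
    · exact hdL x hx a haL
  intro x hx y hy
  linarith [dist_triangle_right x y a, ha x hx, ha y hy]

end Parallelogram

/-! ### Local estimates of the error form -/

theorem normSq_mono {U V : Set Plane} (h : U ⊆ V) {f : Plane → ℝ} (hf : MemLp f 2 (volume.restrict V)) :
    normSq U f ≤ normSq V f :=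
  setIntegral_mono_set hf.integrable_sq (Eventually.of_forall fun _ => sq_nonneg _)
    (LE.le.eventuallyLE h)

theorem HasGrad.energy_mono {U V : Set Plane} (h : U ⊆ V) {f : Plane → ℝ} {g : Fin 2 → Plane → ℝ}
    (hf : HasGrad V f g) : energy U g ≤ energy V g :=
  Finset.sum_le_sum fun i _ => normSq_mono h (hf.grad_memLp i)

theorem energy₂_mono {U V : Set Plane} (h : U ⊆ V) {g : Fin 2 → Plane → ℝ}
    {H : Fin 2 → Fin 2 → Plane → ℝ} (hg : ∀ i, HasGrad V (g i) (H i)) : energy₂ U H ≤ energy₂ V H :=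
  Finset.sum_le_sum fun i _ => (hg i).energy_mono h

/-- The squared `L²(U)` norm of a field of third derivatives. -/
def energy₃ (U : Set Plane) (T : Fin 2 → Fin 2 → Fin 2 → Plane → ℝ) : ℝ := ∑ i, energy₂ U (T i)

theorem energy₃_nonneg (U : Set Plane) (T : Fin 2 → Fin 2 → Fin 2 → Plane → ℝ) : 0 ≤ energy₃ U T :=
  Finset.sum_nonneg fun _ _ => energy₂_nonneg _ _

theorem HasGrad.memLp_crResidual {U : Set Plane} (hb : Bornology.IsBounded U) {u : Plane → ℝ}
    {g : Fin 2 → Plane → ℝ} (hu : HasGrad U u g) : MemLp (crResidual U u g) 2 (volume.restrict U) :=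
  (hu.sub (hasGrad_affineFun hb _ _)).memLp

theorem errForm_add_left {U : Set Plane} (hb : Bornology.IsBounded U) {u u' v : Plane → ℝ}
    {g g' gv : Fin 2 → Plane → ℝ} (hu : HasGrad U u g) (hu' : HasGrad U u' g') (hv : HasGrad U v gv) :
    errForm U (fun x => u x + u' x) (fun i x => g i x + g' i x) v
      = errForm U u g v + errForm U u' g' v := by
  have hc := (hv.sub_const hb (⨍ y in U, v y)).memLp
  unfold errForm
  rw [← integral_add ((hu.memLp_crResidual hb).integrable_mul_two hc)
    ((hu'.memLp_crResidual hb).integrable_mul_two hc)]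
  simp only [crResidual_add hb hu hu', add_mul]

theorem errForm_add_right {U : Set Plane} (hb : Bornology.IsBounded U) {u v v' : Plane → ℝ}
    {g gv gv' : Fin 2 → Plane → ℝ} (hu : HasGrad U u g) (hv : HasGrad U v gv)
    (hv' : HasGrad U v' gv') :
    errForm U u g (fun x => v x + v' x) = errForm U u g v + errForm U u g v' := by
  have hr := hu.memLp_crResidual hb
  unfold errForm
  rw [← integral_add (hr.integrable_mul_two (hv.sub_const hb (⨍ y in U, v y)).memLp)
    (hr.integrable_mul_two (hv'.sub_const hb (⨍ y in U, v' y)).memLp),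
    setAverage_add (hv.integrable hb) (hv'.integrable hb)]
  congr 1 with x
  ring

/-- Cauchy–Schwarz between the interpolation error, of order `h²`, and the Poincaré estimate for
`v`, of order `h`. -/
theorem abs_errForm_le {K : Finset Plane} (hK : IsTriangle K) {h : ℝ} (h0 : 0 ≤ h)
    (hdiam : ∀ x ∈ elem K, ∀ y ∈ elem K, dist x y ≤ h) {u v : Plane → ℝ} {g gv : Fin 2 → Plane → ℝ}
    {H : Fin 2 → Fin 2 → Plane → ℝ} (hu : HasGrad (interior (elem K)) u g)
    (hg : ∀ i, HasGrad (interior (elem K)) (g i) (H i)) (hv : HasGrad (interior (elem K)) v gv) :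
    |errForm (interior (elem K)) u g v| ≤ 4 * h ^ 3 *
      (√(energy₂ (interior (elem K)) H) * √(energy (interior (elem K)) gv)) := by
  have hb := isBounded_interior_elem K
  have h1 := hu.normSq_crResidual_le hK hdiam hg
  have h2 := hv.poincare isOpen_interior (convex_elem K).interior hb
    (fun x hx y hy => hdiam x (interior_subset hx) y (interior_subset hy))
  refine (abs_integral_mul_le (hu.memLp_crResidual hb) (hv.sub_const hb _).memLp).trans ?_
  -- Poincaré's constant `2` is enlarged to `16/5` so that the product with `5` is the perfect
  -- square `16`.
  have e : 4 * h ^ 3 * (√(energy₂ (interior (elem K)) H) * √(energy (interior (elem K)) gv))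
      = √((5 * h ^ 4 * energy₂ (interior (elem K)) H) * (16 / 5 * h ^ 2 * energy (interior (elem K)) gv)) := by
    rw [show (5 * h ^ 4 * energy₂ (interior (elem K)) H) * (16 / 5 * h ^ 2 * energy (interior (elem K)) gv)
      = (4 * h ^ 3) ^ 2 * (energy₂ (interior (elem K)) H * energy (interior (elem K)) gv) by ring,
      Real.sqrt_mul (by positivity), Real.sqrt_sq (by positivity), Real.sqrt_mul (energy₂_nonneg _ _)]
  rw [e, Real.sqrt_mul (mul_nonneg (by positivity) (energy₂_nonneg _ _))]
  refine mul_le_mul (Real.sqrt_le_sqrt h1) (Real.sqrt_le_sqrt (h2.trans ?_)) (Real.sqrt_nonneg _)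
    (Real.sqrt_nonneg _)
  have := mul_nonneg (sq_nonneg h) (energy_nonneg (interior (elem K)) gv)
  linarith

theorem normSq_const_average_le {U : Set Plane} (hb : Bornology.IsBounded U)
    (hV : 0 < volume.real U) {f : Plane → ℝ} (hf : MemLp f 2 (volume.restrict U)) :
    normSq U (fun _ => ⨍ y in U, f y) ≤ normSq U f := by
  have hfin := isFiniteMeasure_restrict_of_isBounded hb
  have h := sq_integral_le hf
  rw [measureReal_restrict_apply_univ] at h
  rw [normSq, integral_const, measureReal_restrict_apply_univ, smul_eq_mul, setAverage_eq,
    smul_eq_mul, normSq, mul_pow, ← mul_assoc, inv_pow, ← div_eq_mul_inv, pow_two (volume.real U),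
    div_self_mul_self', inv_mul_le_iff₀ hV]
  exact h

/-- On a parallelogram the error form is of fourth order. -/
theorem abs_errForm_parallelogram_le {K L : Finset Plane} (hK : IsTriangle K) (hL : IsTriangle L)
    (hP : FormParallelogram K L) {h : ℝ} (h0 : 0 ≤ h)
    (hdK : ∀ x ∈ elem K, ∀ y ∈ elem K, dist x y ≤ h) (hdL : ∀ x ∈ elem L, ∀ y ∈ elem L, dist x y ≤ h)
    {u : Plane → ℝ} {g : Fin 2 → Plane → ℝ} {H : Fin 2 → Fin 2 → Plane → ℝ}
    {T : Fin 2 → Fin 2 → Fin 2 → Plane → ℝ} (hu : HasGrad (interior (elem K ∪ elem L)) u g)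
    (hg : ∀ i, HasGrad (interior (elem K ∪ elem L)) (g i) (H i))
    (hH : ∀ i j, HasGrad (interior (elem K ∪ elem L)) (H i j) (T i j))
    (hsymm : ∀ i j, H i j = H j i) :
    |errForm (interior (elem K)) u g u + errForm (interior (elem L)) u g u| ≤ 24 * h ^ 4 *
      (energy (interior (elem K ∪ elem L)) g + energy₂ (interior (elem K ∪ elem L)) H +
        energy₃ (interior (elem K ∪ elem L)) T) := by
  obtain ⟨a, b, c, eK, eL⟩ := hP.exists_eq
  have hKP : interior (elem K) ⊆ interior (elem K ∪ elem L) := interior_mono Set.subset_union_left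
  have hLP : interior (elem L) ⊆ interior (elem K ∪ elem L) := interior_mono Set.subset_union_right
  have hbK := isBounded_interior_elem K
  have hbL := isBounded_interior_elem L
  have hb : Bornology.IsBounded (interior (elem K ∪ elem L)) :=
    ((isBounded_elem K).union (isBounded_elem L)).subset interior_subset
  have hPo : IsOpen (interior (elem K ∪ elem L)) := isOpen_interior
  have hPc : Convex ℝ (interior (elem K ∪ elem L)) := (convex_elem_union eK eL).interior
  have hdP : ∀ x ∈ interior (elem K ∪ elem L), ∀ y ∈ interior (elem K ∪ elem L), dist x y ≤ 2 * h :=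
    fun x hx y hy => dist_le_of_mem_elem_union eK eL hdK hdL x (interior_subset hx) y (interior_subset hy)
  set P := interior (elem K ∪ elem L) with hPdef
  have hVP : 0 < volume.real P := (volume_real_interior_elem_pos hK).trans_le
    (measureReal_mono hKP hb.measure_lt_top.ne)
  -- The comparison quadratic has the mean Hessian, the comparison affine function the mean
  -- gradient. Lower-order coefficients may be zero, since the error form annihilates affine
  -- functions on the left and constants on the right.
  let A : Fin 2 → Fin 2 → ℝ := fun i j => ⨍ x in P, H i j x
  have hA : ∀ i j, A i j = A j i := fun i j => by simp only [A, hsymm i j]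
  let B : Fin 2 → ℝ := fun i => ⨍ x in P, g i x
  have hw := hasGrad_quadFun hb 0 0 hA
  have hgw : ∀ i, HasGrad P (affineFun ((0 : Fin 2 → ℝ) i) (A i)) (fun j _ => A i j) := fun i =>
    hasGrad_affineFun hb _ _
  have hv := hasGrad_affineFun hb 0 B
  have hr := hu.sub hw
  have hgr := fun i => (hg i).sub (hgw i)
  have hz := hu.sub hv
  -- The parallelogram has diameter at most `2 h`, so Poincaré's constant is `2 (2h)² = 8 h²`.
  have E1 : energy P (fun i x => g i x - B i) ≤ 8 * h ^ 2 * energy₂ P H := by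
    rw [energy, energy₂, Finset.mul_sum]
    refine Finset.sum_le_sum fun i _ => ((hg i).poincare hPo hPc hb hdP).trans (le_of_eq ?_)
    ring
  have E2 : energy₂ P (fun i j x => H i j x - A i j) ≤ 8 * h ^ 2 * energy₃ P T := by
    rw [energy₃, energy₂, Finset.mul_sum]
    refine Finset.sum_le_sum fun i _ => ?_
    rw [energy, energy₂, Finset.mul_sum]
    refine Finset.sum_le_sum fun j _ => ((hH i j).poincare hPo hPc hb hdP).trans (le_of_eq ?_)
    ring
  have E3 : energy₂ P (fun i j _ => A i j) ≤ energy₂ P H :=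
    Finset.sum_le_sum fun i _ => Finset.sum_le_sum fun j _ =>
      normSq_const_average_le hb hVP ((hg i).grad_memLp j)
  have bound : ∀ {M : Finset Plane} (hM : IsTriangle M) (hMP : interior (elem M) ⊆ P)
      (hd : ∀ x ∈ elem M, ∀ y ∈ elem M, dist x y ≤ h) {f v : Plane → ℝ} {p q : Fin 2 → Plane → ℝ}
      {R : Fin 2 → Fin 2 → Plane → ℝ} (hf : HasGrad P f p) (hp : ∀ i, HasGrad P (p i) (R i))
      (hv : HasGrad P v q), |errForm (interior (elem M)) f p v|
        ≤ 4 * h ^ 3 * (√(energy₂ P R) * √(energy P q)) := by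
    intro M hM hMP hd f v p q R hf hp hv
    refine (abs_errForm_le hM h0 hd (hf.mono hMP) (fun i => (hp i).mono hMP) (hv.mono hMP)).trans ?_
    gcongr
    · exact energy₂_mono hMP hp
    · exact hv.energy_mono hMP
  -- With `w` the quadratic and `v` the affine comparison function, the form splits as `(u, u) = (u
  -- - w, u) + (w, u - v) + (w, v)`. Each of the first two gains a factor `h`; the last cancels
  -- between the two triangles.
  have split : ∀ {M : Finset Plane}, interior (elem M) ⊆ P →
      errForm (interior (elem M)) u g u
      = errForm (interior (elem M)) (fun x => u x - quadFun 0 0 A x)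
          (fun i x => g i x - affineFun ((0 : Fin 2 → ℝ) i) (A i) x) u
        + (errForm (interior (elem M)) (quadFun 0 0 A) (fun i => affineFun ((0 : Fin 2 → ℝ) i) (A i))
            (fun x => u x - affineFun 0 B x)
          + errForm (interior (elem M)) (quadFun 0 0 A) (fun i => affineFun ((0 : Fin 2 → ℝ) i) (A i))
            (affineFun 0 B)) := by
    intro M hMP
    have hbM := isBounded_interior_elem M
    rw [← errForm_add_right hbM (hw.mono hMP) (hz.mono hMP) (hv.mono hMP)]
    simp only [sub_add_cancel]
    rw [← errForm_add_left hbM (hr.mono hMP) (hw.mono hMP) (hu.mono hMP)]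
    simp only [sub_add_cancel]
  have zero := errForm_add_errForm_eq_zero (a + b) isOpen_interior isOpen_interior
    (mem_interior_elem_iff_pointReflect eK eL) hbK (volume_real_interior_elem_pos hK) 0 0 hA 0 B
  have q1K := bound hK hKP hdK hr hgr hu
  have q1L := bound hL hLP hdL hr hgr hu
  have q2K := bound hK hKP hdK hw hgw hz
  have q2L := bound hL hLP hdL hw hgw hz
  have sq8 : ∀ {x y : ℝ}, 0 ≤ y → x ≤ 8 * h ^ 2 * y → √x ≤ 3 * h * √y := by
    intro x y hy hxy
    rw [← Real.sqrt_sq (by positivity : 0 ≤ 3 * h), ← Real.sqrt_mul (sq_nonneg _)]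
    refine Real.sqrt_le_sqrt (hxy.trans ?_)
    have := mul_nonneg (sq_nonneg h) hy
    nlinarith
  have s1 := sq8 (energy₂_nonneg P H) E1
  have s2 := sq8 (energy₃_nonneg P T) E2
  have s3 := Real.sqrt_le_sqrt E3
  set e1 := energy P g
  set e2 := energy₂ P H
  set e3 := energy₃ P T
  have hh3 : 0 ≤ 4 * h ^ 3 := by positivity
  have t1 : 4 * h ^ 3 * (√(energy₂ P fun i j x => H i j x - A i j) * √e1)
      ≤ 4 * h ^ 3 * ((3 * h * √e3) * √e1) := by gcongr
  have t2 : 4 * h ^ 3 * (√(energy₂ P fun i j _ => A i j) * √(energy P fun i x => g i x - B i))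
      ≤ 4 * h ^ 3 * (√e2 * (3 * h * √e2)) := by gcongr
  have n1 : 0 ≤ e1 := energy_nonneg _ _
  have n2 : 0 ≤ e2 := energy₂_nonneg _ _
  have n3 : 0 ≤ e3 := energy₃_nonneg _ _
  have m2 : √e2 * √e2 = e2 := Real.mul_self_sqrt n2
  have m13 : √e3 * √e1 ≤ e1 + e3 := by
    nlinarith [Real.sq_sqrt n1, Real.sq_sqrt n3, sq_nonneg (√e1 - √e3)]
  have h4 : 0 ≤ h ^ 4 := by positivity
  have u1 : 4 * h ^ 3 * ((3 * h * √e3) * √e1) ≤ 12 * h ^ 4 * (e1 + e3) := by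
    calc 4 * h ^ 3 * ((3 * h * √e3) * √e1) = 12 * h ^ 4 * (√e3 * √e1) := by ring
      _ ≤ _ := by gcongr
  have u2 : 4 * h ^ 3 * (√e2 * (3 * h * √e2)) = 12 * h ^ 4 * e2 := by
    linear_combination (12 * h ^ 4) * m2
  rw [split hKP, split hLP]
  rw [abs_le] at q1K q1L q2K q2L ⊢
  constructor <;> linarith [q1K.1, q1K.2, q1L.1, q1L.2, q2K.1, q2K.2, q2L.1, q2L.2]

/-! ### Piecewise defined interpolants -/

section Piecewise

variable {𝒯 : Finset (Finset Plane)}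

theorem disjoint_interior_elem {K L : Finset Plane} (h : volume (elem K ∩ elem L) = 0) :
    Disjoint (interior (elem K)) (interior (elem L)) := by
  rw [Set.disjoint_iff_inter_eq_empty, ← interior_inter]
  by_contra hne
  exact (isOpen_interior.measure_pos volume (Set.nonempty_iff_ne_empty.2 hne)).ne'
    (measure_mono_null interior_subset h)

theorem piecewise_eq (hd : ∀ K ∈ 𝒯, ∀ L ∈ 𝒯, K ≠ L → volume (elem K ∩ elem L) = 0)
    (F : Finset Plane → Plane → ℝ) {K : Finset Plane} (hK : K ∈ 𝒯) {x : Plane}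
    (hx : x ∈ interior (elem K)) : piecewise 𝒯 F x = F K x := by
  rw [piecewise, Finset.sum_eq_single_of_mem K hK, Set.indicator_of_mem hx]
  intro L hL hLK
  refine Set.indicator_of_notMem (fun hxL => ?_) _
  exact Set.disjoint_left.1 (disjoint_interior_elem (hd L hL K hK hLK)) hxL hx

theorem integral_iUnion_elem_eq_sum (hT : ∀ K ∈ 𝒯, IsTriangle K)
    (hd : ∀ K ∈ 𝒯, ∀ L ∈ 𝒯, K ≠ L → volume (elem K ∩ elem L) = 0) {u v : Plane → ℝ}
    {g gv : Fin 2 → Plane → ℝ} (hu : ∀ K ∈ 𝒯, HasGrad (interior (elem K)) u g)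
    (hv : ∀ K ∈ 𝒯, HasGrad (interior (elem K)) v gv) :
    ∫ x in ⋃ K ∈ 𝒯, elem K, (u x - PiCR 𝒯 u x) * (v x - PiZero 𝒯 v x)
      = ∑ K ∈ 𝒯, errForm (interior (elem K)) u g v := by
  have hae : (⋃ K ∈ 𝒯, interior (elem K) : Set Plane) =ᵐ[volume] ⋃ K ∈ 𝒯, elem K :=
    Filter.EventuallyEq.countable_bUnion 𝒯.countable_toSet fun K _ => interior_ae_eq (convex_elem K)
  have heq : ∀ K ∈ 𝒯, ∀ x ∈ interior (elem K), (u x - PiCR 𝒯 u x) * (v x - PiZero 𝒯 v x)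
      = crResidual (interior (elem K)) u g x * (v x - ⨍ y in interior (elem K), v y) := by
    intro K hK x hx
    rw [PiCR, PiZero, piecewise_eq hd _ hK hx, piecewise_eq hd _ hK hx,
      crInterpOn_eq (hT K hK) (hu K hK), restrict_interior_elem]
    rfl
  rw [← Measure.restrict_congr_set hae, integral_biUnion_finset]
  · refine Finset.sum_congr rfl fun K hK => ?_
    rw [errForm]
    exact setIntegral_congr_fun isOpen_interior.measurableSet (heq K hK)
  · exact fun K _ => isOpen_interior.measurableSet
  · exact fun K hK L hL hKL => disjoint_interior_elem (hd K hK L hL hKL)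
  · intro K hK
    have hb := isBounded_interior_elem K
    refine IntegrableOn.congr_fun ?_ (fun x hx => (heq K hK x hx).symm) isOpen_interior.measurableSet
    exact ((hu K hK).memLp_crResidual hb).integrable_mul_two ((hv K hK).sub_const hb _).memLp

end Piecewise

/-! ### Orthogonality on a parallelogram for polynomials -/

theorem IsPoly.exists_quadFun {f : Plane → ℝ} (hf : IsPoly 2 f) :
    ∃ α G, ∃ A : Fin 2 → Fin 2 → ℝ, (∀ i j, A i j = A j i) ∧ f = quadFun α G A := by
  obtain ⟨p, hp, h⟩ := hf.eq_sum
  have key : ∀ s : Finset (Fin 2 →₀ ℕ), (∀ d ∈ s, d 0 + d 1 ≤ 2) →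
      ∃ α G, ∃ A : Fin 2 → Fin 2 → ℝ, (∀ i j, A i j = A j i) ∧
        ∀ x : Plane, ∑ d ∈ s, p.coeff d * (x 0 ^ d 0 * x 1 ^ d 1) = quadFun α G A x := by
    intro s
    induction s using Finset.induction_on with
    | empty => exact fun _ => ⟨0, 0, 0, by simp, fun x => by simp [quadFun, affineFun]⟩
    | insert d s hd ih =>
      intro H
      obtain ⟨α, G, A, hA, hG⟩ := ih fun e he => H e (Finset.mem_insert_of_mem he)
      have hd' := H d (Finset.mem_insert_self d s)
      have hA' := hA 1 0
      have hs : ∀ a b c : ℝ, ∀ i j : Fin 2, (![![a, b], ![b, c]] : Fin 2 → Fin 2 → ℝ) i j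
          = (![![a, b], ![b, c]] : Fin 2 → Fin 2 → ℝ) j i := by
        intro a b c i j
        fin_cases i <;> fin_cases j <;> rfl
      have : (d 0 = 0 ∧ d 1 = 0) ∨ (d 0 = 1 ∧ d 1 = 0) ∨ (d 0 = 0 ∧ d 1 = 1) ∨
        (d 0 = 2 ∧ d 1 = 0) ∨ (d 0 = 1 ∧ d 1 = 1) ∨ (d 0 = 0 ∧ d 1 = 2) := by omega
      set t := p.coeff d with ht
      -- Adds one monomial to the quadratic already built. The halves match the factor `1/2` in
      -- `quadFun`, so a pure square `t x²` is entered with coefficient `2 t`.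
      have extend : ∀ (α' : ℝ) (G' : Fin 2 → ℝ) (a b c : ℝ), (∀ x : Plane,
          t * (x 0 ^ d 0 * x 1 ^ d 1) = α' + (G' 0 * x 0 + G' 1 * x 1)
            + (a / 2 * (x 0 * x 0) + b * (x 0 * x 1) + c / 2 * (x 1 * x 1))) →
          ∃ α G, ∃ A : Fin 2 → Fin 2 → ℝ, (∀ i j, A i j = A j i) ∧
        ∀ x : Plane, ∑ d ∈ insert d s, p.coeff d * (x 0 ^ d 0 * x 1 ^ d 1) = quadFun α G A x := by
        intro α' G' a b c hx
        refine ⟨α' + α, G' + G, ![![a + A 0 0, b + A 0 1], ![b + A 0 1, c + A 1 1]], hs _ _ _,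
          fun x => ?_⟩
        rw [Finset.sum_insert hd, hG, ← ht, hx]
        simp [quadFun, affineFun, Fin.sum_univ_two, hA']
        ring
      rcases this with ⟨h0, h1⟩ | ⟨h0, h1⟩ | ⟨h0, h1⟩ | ⟨h0, h1⟩ | ⟨h0, h1⟩ | ⟨h0, h1⟩ <;>
        rw [h0, h1] at extend
      · exact extend t 0 0 0 0 fun x => by simp
      · exact extend 0 ![t, 0] 0 0 0 fun x => by simp
      · exact extend 0 ![0, t] 0 0 0 fun x => by simp
      · exact extend 0 0 (2 * t) 0 0 fun x => by simp only [Pi.zero_apply]; ring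
      · exact extend 0 0 0 t 0 fun x => by simp
      · exact extend 0 0 0 0 (2 * t) fun x => by simp only [Pi.zero_apply]; ring
  obtain ⟨α, G, A, hA, hG⟩ := key p.support hp
  exact ⟨α, G, A, hA, funext fun x => (h x).trans (hG x)⟩

theorem FormParallelogram.integral_interpError_eq_zero {K₁ K₂ : Finset Plane} (h₁ : IsTriangle K₁)
    (h₂ : IsTriangle K₂) (hP : FormParallelogram K₁ K₂) {w v : Plane → ℝ} (hw : IsPoly 2 w)
    (hv : IsPoly 1 v) : ∫ x in elem K₁ ∪ elem K₂,
      (w x - PiCR {K₁, K₂} w x) * (v x - PiZero {K₁, K₂} v x) = 0 := by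
  obtain ⟨a, b, c, e₁, e₂⟩ := hP.exists_eq
  obtain ⟨α, G, A, hA, rfl⟩ := hw.exists_quadFun
  obtain ⟨β, B, rfl⟩ := hv.exists_affineFun
  have hnull := volume_elem_inter h₁ e₁ e₂
  have hne : K₁ ≠ K₂ := by
    rintro rfl
    rw [Set.inter_self] at hnull
    have := h₁.volume_pos
    simp [Measure.real, hnull] at this
  have hd : ∀ K ∈ ({K₁, K₂} : Finset (Finset Plane)), ∀ L ∈ ({K₁, K₂} : Finset (Finset Plane)),
      K ≠ L → volume (elem K ∩ elem L) = 0 := by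
    intro K hK L hL hKL
    simp only [Finset.mem_insert, Finset.mem_singleton] at hK hL
    rcases hK with rfl | rfl <;> rcases hL with rfl | rfl
    · exact absurd rfl hKL
    · exact hnull
    · rwa [Set.inter_comm]
    · exact absurd rfl hKL
  have hT : ∀ K ∈ ({K₁, K₂} : Finset (Finset Plane)), IsTriangle K := by
    simp [h₁, h₂]
  have hU : (⋃ K ∈ ({K₁, K₂} : Finset (Finset Plane)), elem K) = elem K₁ ∪ elem K₂ := by simp
  rw [← hU, integral_iUnion_elem_eq_sum hT hd
    (fun K _ => hasGrad_quadFun (isBounded_interior_elem K) α G hA)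
    (fun K _ => hasGrad_affineFun (isBounded_interior_elem K) β B), Finset.sum_pair hne]
  exact errForm_add_errForm_eq_zero (a + b) isOpen_interior isOpen_interior
    (mem_interior_elem_iff_pointReflect e₁ e₂) (isBounded_interior_elem K₁)
    (volume_real_interior_elem_pos h₁) α G hA β B

/-! ### Geometry and combinatorics of conforming triangulations -/

theorem volume_convexHull_eq_zero {S : Finset Plane} (hS : S.card ≤ 2) :
    volume (convexHull ℝ (S : Set Plane)) = 0 := by
  have h : S.card = 0 ∨ S.card = 1 ∨ S.card = 2 := by omega
  rcases h with h | h | h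
  · rw [Finset.card_eq_zero.1 h]; simp
  · obtain ⟨a, rfl⟩ := Finset.card_eq_one.1 h; simp
  · obtain ⟨a, b, -, rfl⟩ := Finset.card_eq_two.1 h
    rw [Finset.coe_pair]
    exact volume_convexHull_pair a b

namespace Triangulation

variable {Ω : Set Plane} (T : Triangulation Ω) {K L : Finset Plane}

theorem elem_subset_closure (hK : K ∈ T.elems) : elem K ⊆ closure Ω := by
  rw [← T.cover]
  exact Set.subset_biUnion_of_mem (u := fun K => elem K) hK

theorem interior_elem_subset (hΩ : interior (closure Ω) = Ω) (hK : K ∈ T.elems) :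
    interior (elem K) ⊆ Ω :=
  (interior_mono (T.elem_subset_closure hK)).trans hΩ.subset

theorem interior_elem_union_subset (hΩ : interior (closure Ω) = Ω) (hK : K ∈ T.elems)
    (hL : L ∈ T.elems) : interior (elem K ∪ elem L) ⊆ Ω :=
  (interior_mono (Set.union_subset (T.elem_subset_closure hK)
    (T.elem_subset_closure hL))).trans hΩ.subset

open Classical in
theorem card_inter_le (hK : K ∈ T.elems) (hL : L ∈ T.elems) (hKL : K ≠ L) : (K ∩ L).card ≤ 2 := by
  by_contra hc
  have h1 := (T.isTriangle K hK).1
  have h2 := (T.isTriangle L hL).1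
  have e1 : K ∩ L = K := Finset.eq_of_subset_of_card_le Finset.inter_subset_left (by omega)
  have e2 : K ∩ L = L := Finset.eq_of_subset_of_card_le Finset.inter_subset_right (by omega)
  exact hKL (e1.symm.trans e2)

theorem volume_inter_eq_zero (hK : K ∈ T.elems) (hL : L ∈ T.elems) (hKL : K ≠ L) :
    volume (elem K ∩ elem L) = 0 := by
  classical
  have h := T.conforming K hK L hL
  rw [← Finset.coe_inter] at h
  exact measure_mono_null h (volume_convexHull_eq_zero (T.card_inter_le hK hL hKL))

theorem dist_le_meshSize (hK : K ∈ T.elems) :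
    ∀ x ∈ elem K, ∀ y ∈ elem K, dist x y ≤ T.meshSize := by
  intro x hx y hy
  refine (Metric.dist_le_diam_of_mem (isBounded_elem K) hx hy).trans ?_
  exact le_ciSup (f := fun K : T.elems => Metric.diam (elem (K : Finset Plane)))
    (Set.finite_range _).bddAbove ⟨K, hK⟩

theorem meshSize_nonneg : 0 ≤ T.meshSize :=
  Real.iSup_nonneg fun _ => Metric.diam_nonneg

theorem iUnion_interior_elem_ae_eq :
    (⋃ K ∈ T.elems, interior (elem K) : Set Plane) =ᵐ[volume] closure Ω := by
  rw [← T.cover]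
  exact Filter.EventuallyEq.countable_bUnion T.elems.countable_toSet
    fun K _ => interior_ae_eq (convex_elem K)

theorem iUnion_interior_elem_subset (hΩ : interior (closure Ω) = Ω) :
    (⋃ K ∈ T.elems, interior (elem K) : Set Plane) ⊆ Ω :=
  Set.iUnion₂_subset fun _ hK => T.interior_elem_subset hΩ hK

/-- `Ω` lies between the union of the open elements and its own closure, and these differ by a null
set. In particular `∂Ω` is null. -/
theorem iUnion_interior_elem_ae_eq_self (hΩ : interior (closure Ω) = Ω) :
    (⋃ K ∈ T.elems, interior (elem K) : Set Plane) =ᵐ[volume] Ω := by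
  refine (T.iUnion_interior_elem_subset hΩ).eventuallyLE.antisymm ?_
  exact subset_closure.eventuallyLE.trans T.iUnion_interior_elem_ae_eq.symm.le

theorem setIntegral_eq_iUnion (hΩ : interior (closure Ω) = Ω) (f : Plane → ℝ) :
    ∫ x in Ω, f x = ∫ x in ⋃ K ∈ T.elems, elem K, f x := by
  rw [T.cover]
  exact setIntegral_congr_set ((T.iUnion_interior_elem_ae_eq_self hΩ).symm.trans
    T.iUnion_interior_elem_ae_eq)

theorem pairwiseDisjoint : (T.elems : Set (Finset Plane)).Pairwise
    (Function.onFun Disjoint fun K => interior (elem K)) :=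
  fun _ hK _ hL hKL => disjoint_interior_elem (T.volume_inter_eq_zero hK hL hKL)

theorem normSq_iUnion_interior {𝒯 : Finset (Finset Plane)} (h𝒯 : 𝒯 ⊆ T.elems)
    (hΩ : interior (closure Ω) = Ω) {f : Plane → ℝ} (hf : MemLp f 2 (volume.restrict Ω)) :
    normSq (⋃ K ∈ 𝒯, interior (elem K)) f = ∑ K ∈ 𝒯, normSq (interior (elem K)) f := by
  unfold normSq
  refine integral_biUnion_finset _ (fun K _ => isOpen_interior.measurableSet)
    (T.pairwiseDisjoint.mono (Finset.coe_subset.2 h𝒯)) fun K hK => ?_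
  exact (hf.mono_measure (Measure.restrict_mono (T.interior_elem_subset hΩ (h𝒯 hK))
    le_rfl)).integrable_sq

theorem normSq_eq_sum (hΩ : interior (closure Ω) = Ω) {f : Plane → ℝ}
    (hf : MemLp f 2 (volume.restrict Ω)) :
    normSq Ω f = ∑ K ∈ T.elems, normSq (interior (elem K)) f := by
  rw [← T.normSq_iUnion_interior subset_rfl hΩ hf]
  exact setIntegral_congr_set (T.iUnion_interior_elem_ae_eq_self hΩ).symm

/-! ### Neighbours across an edge and the double counting -/

open Classical in
/-- The elements that share an edge with `K`. -/
def neighbors (K : Finset Plane) : Finset (Finset Plane) := {L ∈ T.elems | (K ∩ L).card = 2}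

open Classical in
theorem mem_neighbors : L ∈ T.neighbors K ↔ L ∈ T.elems ∧ (K ∩ L).card = 2 := by
  simp [neighbors]

variable {T}

theorem Uniform.formParallelogram (hu : T.Uniform) (hK : K ∈ T.elems) (hL : L ∈ T.neighbors K) :
    FormParallelogram K L := by
  classical
  rw [mem_neighbors] at hL
  refine hu K hK L hL.1 ?_
  rw [← Finset.coe_inter, Set.ncard_coe_finset]
  exact hL.2

open Classical in
-- The fourth vertex of the parallelogram is `a + b - c`, so a neighbour is determined by `K` and
-- the shared edge. Hence `L ↦ K ∩ L` is injective on neighbours, which bounds their number by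
-- three.
theorem Uniform.eq_insert (hu : T.Uniform) (hK : K ∈ T.elems) (hL : L ∈ T.neighbors K) :
    L = insert (∑ x ∈ K ∩ L, x - ∑ x ∈ K \ (K ∩ L), x) (K ∩ L) := by
  obtain ⟨a, b, c, e₁, e₂⟩ := (hu.formParallelogram hK hL).exists_eq
  obtain ⟨hL, hcard⟩ := T.mem_neighbors.1 hL
  have e₁' : K = {a, b, c} := Finset.coe_injective (by rw [e₁]; simp)
  have e₂' : L = {a, b, a + b - c} := Finset.coe_injective (by rw [e₂]; simp)
  have h3 := (T.isTriangle K hK).1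
  have hab : a ≠ b := by
    rintro rfl
    rw [e₁'] at h3
    have := Finset.card_le_two (a := a) (b := c)
    simp only [Finset.mem_insert, true_or, Finset.insert_eq_of_mem] at h3
    omega
  have hS : K ∩ L = {a, b} := by
    refine (Finset.eq_of_subset_of_card_le (fun x hx => ?_) ?_).symm
    · rw [e₁', e₂']
      simp only [Finset.mem_insert, Finset.mem_singleton, Finset.mem_inter] at hx ⊢
      tauto
    · rw [hcard, Finset.card_pair hab]
  have hc : c ∉ ({a, b} : Finset Plane) := by
    intro hc
    have : K = {a, b} := by
      rw [e₁']
      ext x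
      simp only [Finset.mem_insert, Finset.mem_singleton] at hc ⊢
      constructor
      · rintro (h | h | rfl) <;> tauto
      · tauto
    rw [this] at h3
    have := Finset.card_le_two (a := a) (b := b)
    omega
  have hd : K \ {a, b} = {c} := by
    rw [e₁']
    ext x
    simp only [Finset.mem_insert, Finset.mem_singleton, Finset.mem_sdiff] at hc ⊢
    constructor
    · tauto
    · rintro rfl; tauto
  rw [hS, hd, Finset.sum_pair hab, Finset.sum_singleton]
  conv_lhs => rw [e₂']
  ext x
  simp only [Finset.mem_insert, Finset.mem_singleton]
  tauto

open Classical in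
theorem Uniform.card_neighbors_le (hu : T.Uniform) (hK : K ∈ T.elems) :
    (T.neighbors K).card ≤ 3 := by
  have h3 : (K.powersetCard 2).card = 3 := by
    rw [Finset.card_powersetCard, (T.isTriangle K hK).1]; rfl
  rw [← h3]
  refine Finset.card_le_card_of_injOn (fun L => K ∩ L) (fun L hL => ?_) ?_
  · rw [Finset.mem_coe, Finset.mem_powersetCard]
    exact ⟨Finset.inter_subset_left, (T.mem_neighbors.1 hL).2⟩
  · intro L hL M hM (h : K ∩ L = K ∩ M)
    rw [hu.eq_insert hK hL, hu.eq_insert hK hM, h]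

open Classical in
/-- An edge of an element contained in the open set `Ω` is shared with another element. -/
theorem exists_inter_eq_pair (hΩo : IsOpen Ω) (hK : K ∈ T.elems) (hKΩ : elem K ⊆ Ω) {a b : Plane}
    (ha : a ∈ K) (hb : b ∈ K) (hab : a ≠ b) : ∃ L ∈ T.elems, K ∩ L = {a, b} := by
  obtain ⟨c, hca, hcb, hKc⟩ := (T.isTriangle K hK).exists_third ha hb hab
  have hKc' : (K : Set Plane) = {a, b, c} := by rw [hKc]; simp
  have hl := (T.isTriangle K hK).linearIndependent hKc'
  set m := midpoint ℝ a b with hm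
  have hmab : m ∈ convexHull ℝ ({a, b} : Set Plane) := by
    rw [convexHull_pair]
    exact midpoint_mem_segment a b
  have hmK : m ∈ elem K := by
    refine convexHull_mono ?_ hmab
    rw [hKc']
    intro x hx
    simp only [Set.mem_insert_iff, Set.mem_singleton_iff] at hx ⊢
    tauto
  -- Moving from the midpoint of the edge away from the opposite vertex leaves `K` at once.
  have hout : ∀ t : ℝ, 0 < t → m + t • (m - c) ∉ elem K := by
    intro t ht hmem
    rw [elem_eq_convexHull hKc', mem_convexHull_triple] at hmem
    obtain ⟨z, y, -, -, hz, hx⟩ := hmem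
    have hmc : m = c + (1 / 2 : ℝ) • (a - c) + (1 / 2 : ℝ) • (b - c) := by
      rw [hm, midpoint_eq_smul_add, invOf_eq_inv]
      module
    have : (1 / 2 * (1 + t) - z + y) • (a - c) + (1 / 2 * (1 + t) - y) • (b - c) = 0 := by
      have h0 : m + t • (m - c) - (c + z • (a - c) + y • (b - a)) = 0 := sub_eq_zero.2 hx
      rw [← h0, hmc]
      module
    obtain ⟨h1, h2⟩ := LinearIndependent.pair_iff.1 hl _ _ this
    linarith
  -- The points just beyond the edge still lie in `Ω`, hence in other elements. These are finitely
  -- many closed sets, so one of them contains the midpoint.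
  have hcl : m ∈ closure (⋃ L ∈ T.elems.erase K, elem L) := by
    have hlim : Tendsto (fun t : ℝ => m + t • (m - c)) (𝓝[>] 0) (𝓝 m) := by
      have : Tendsto (fun t : ℝ => m + t • (m - c)) (𝓝 0) (𝓝 (m + (0 : ℝ) • (m - c))) :=
        Continuous.tendsto (by fun_prop) 0
      rw [zero_smul, add_zero] at this
      exact this.mono_left nhdsWithin_le_nhds
    refine mem_closure_of_tendsto hlim ?_
    filter_upwards [hlim.eventually (hΩo.mem_nhds (hKΩ hmK)), self_mem_nhdsWithin] with t h1 h2
    have h3 : m + t • (m - c) ∈ ⋃ L ∈ T.elems, elem L := T.cover ▸ subset_closure h1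
    simp only [Set.mem_iUnion, exists_prop] at h3 ⊢
    obtain ⟨L, hL, h4⟩ := h3
    refine ⟨L, Finset.mem_erase.2 ⟨?_, hL⟩, h4⟩
    rintro rfl
    exact hout t h2 h4
  have hclosed : IsClosed (⋃ L ∈ T.elems.erase K, elem L) :=
    Set.Finite.isClosed_biUnion (Finset.finite_toSet _) fun L _ => (isCompact_elem L).isClosed
  rw [hclosed.closure_eq] at hcl
  simp only [Set.mem_iUnion, exists_prop, Finset.mem_erase] at hcl
  obtain ⟨L, ⟨hLK, hL⟩, hmL⟩ := hcl
  refine ⟨L, hL, ?_⟩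
  have hmS := T.conforming K hK L hL ⟨hmK, hmL⟩
  have habK : ({a, b} : Finset Plane) ⊆ K := by
    intro x hx
    simp only [Finset.mem_insert, Finset.mem_singleton] at hx
    rcases hx with rfl | rfl <;> assumption
  -- Conformity puts the midpoint into the hull of `K ∩ L`; affine independence lets this hull be
  -- intersected with the edge at the level of vertices. If a vertex of the edge were missing from
  -- `L`, the midpoint would have to be an endpoint.
  have hmI : m ∈ convexHull ℝ (((K ∩ L) ∩ {a, b} : Finset Plane) : Set Plane) := by
    rw [Finset.coe_inter, (T.isTriangle K hK).2.convexHull_inter Finset.inter_subset_left habK]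
    refine ⟨by rwa [Finset.coe_inter], by simpa using hmab⟩
  have hsub : ({a, b} : Finset Plane) ⊆ K ∩ L := by
    by_contra hns
    have hlt : ((K ∩ L) ∩ {a, b}).card < 2 := by
      refine lt_of_lt_of_eq ?_ (Finset.card_pair hab)
      refine Finset.card_lt_card ⟨Finset.inter_subset_right, fun h => hns (h.trans
        Finset.inter_subset_left)⟩
    have h01 : ((K ∩ L) ∩ {a, b}).card = 0 ∨ ((K ∩ L) ∩ {a, b}).card = 1 := by omega
    rcases h01 with h | h
    · rw [Finset.card_eq_zero.1 h] at hmI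
      simp at hmI
    · obtain ⟨p, hp⟩ := Finset.card_eq_one.1 h
      have hpm : p ∈ ({a, b} : Finset Plane) :=
        Finset.inter_subset_right (s₁ := K ∩ L) (hp ▸ Finset.mem_singleton_self p)
      rw [hp] at hmI
      simp only [Finset.coe_singleton, convexHull_singleton, Set.mem_singleton_iff] at hmI
      simp only [Finset.mem_insert, Finset.mem_singleton] at hpm
      rcases hpm with rfl | rfl
      · exact hab ((midpoint_eq_left_iff ℝ).1 (hm ▸ hmI))
      · exact hab ((midpoint_eq_right_iff ℝ).1 (hm ▸ hmI))
  refine (Finset.eq_of_subset_of_card_le hsub ?_).symm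
  rw [Finset.card_pair hab]
  exact T.card_inter_le hK hL (Ne.symm hLK)

open Classical in
theorem three_le_card_neighbors (hΩo : IsOpen Ω) (hK : K ∈ T.elems) (hKΩ : elem K ⊆ Ω) :
    3 ≤ (T.neighbors K).card := by
  have h3 : (K.powersetCard 2).card = 3 := by
    rw [Finset.card_powersetCard, (T.isTriangle K hK).1]; rfl
  rw [← h3]
  refine Finset.card_le_card_of_surjOn (fun L => K ∩ L) fun S hS => ?_
  rw [Finset.mem_coe, Finset.mem_powersetCard] at hS
  obtain ⟨hSK, hS2⟩ := hS
  obtain ⟨a, b, hab, rfl⟩ := Finset.card_eq_two.1 hS2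
  obtain ⟨L, hL, h⟩ := exists_inter_eq_pair hΩo hK hKΩ (hSK (by simp)) (hSK (by simp)) hab
  exact ⟨L, T.mem_neighbors.2 ⟨hL, by rw [h, hS2]⟩, h⟩

open Classical in
-- Double counting: adjacency is symmetric, so both summands give the same total.
theorem sum_neighbors_add (T : Triangulation Ω) (f : Finset Plane → ℝ) :
    ∑ K ∈ T.elems, ∑ L ∈ T.neighbors K, (f K + f L)
      = 2 * ∑ K ∈ T.elems, (T.neighbors K).card * f K := by
  have h : ∑ K ∈ T.elems, ∑ L ∈ T.neighbors K, f L
      = ∑ L ∈ T.elems, ∑ K ∈ T.neighbors L, f L := by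
    refine Finset.sum_comm' fun K L => ?_
    simp only [mem_neighbors, Finset.inter_comm L K]
    tauto
  simp only [Finset.sum_add_distrib, h, Finset.sum_const, nsmul_eq_mul]
  ring

open Classical in
/-- The elements that meet the boundary of `Ω`. -/
def boundaryElems (T : Triangulation Ω) : Finset (Finset Plane) :=
  {K ∈ T.elems | (elem K ∩ frontier Ω).Nonempty}

open Classical in
theorem mem_boundaryElems : K ∈ T.boundaryElems ↔
    K ∈ T.elems ∧ (elem K ∩ frontier Ω).Nonempty := by
  simp [boundaryElems]

theorem boundaryElems_subset : T.boundaryElems ⊆ T.elems := fun _ h => (mem_boundaryElems.1 h).1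

theorem elem_subset_of_notMem_boundaryElems (hΩo : IsOpen Ω) (hK : K ∈ T.elems)
    (h : K ∉ T.boundaryElems) : elem K ⊆ Ω := by
  intro x hx
  by_contra hxΩ
  refine h (mem_boundaryElems.2 ⟨hK, x, hx, ?_⟩)
  rw [hΩo.frontier_eq]
  exact ⟨T.elem_subset_closure hK hx, hxΩ⟩

/-- With `n K` the number of neighbours, `3 ∑ B K = ∑ n K · B K + ∑ (3 - n K) B K`. The first sum is
half a sum over adjacent pairs; the second lives on boundary elements, since an element inside `Ω`
has all three neighbours. -/
theorem Uniform.abs_sum_le (hu : T.Uniform) (hΩo : IsOpen Ω) {B e : Finset Plane → ℝ} {c : ℝ}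
    (hc : 0 ≤ c) (he : ∀ K ∈ T.elems, 0 ≤ e K)
    (hB : ∀ K ∈ T.elems, ∀ L ∈ T.neighbors K, |B K + B L| ≤ c * (e K + e L)) :
    |∑ K ∈ T.elems, B K| ≤ c * ∑ K ∈ T.elems, e K + ∑ K ∈ T.boundaryElems, |B K| := by
  have h1 := T.sum_neighbors_add B
  have h2 := T.sum_neighbors_add e
  have h3 : |∑ K ∈ T.elems, ∑ L ∈ T.neighbors K, (B K + B L)|
      ≤ c * ∑ K ∈ T.elems, ∑ L ∈ T.neighbors K, (e K + e L) := by
    rw [Finset.mul_sum]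
    refine (Finset.abs_sum_le_sum_abs _ _).trans (Finset.sum_le_sum fun K hK => ?_)
    rw [Finset.mul_sum]
    exact (Finset.abs_sum_le_sum_abs _ _).trans (Finset.sum_le_sum fun L hL => hB K hK L hL)
  have h4 : ∑ K ∈ T.elems, (T.neighbors K).card * e K ≤ 3 * ∑ K ∈ T.elems, e K := by
    rw [Finset.mul_sum]
    refine Finset.sum_le_sum fun K hK => mul_le_mul_of_nonneg_right ?_ (he K hK)
    exact_mod_cast hu.card_neighbors_le hK
  have h5 : |∑ K ∈ T.elems, (3 - (T.neighbors K).card) * B K|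
      ≤ 3 * ∑ K ∈ T.boundaryElems, |B K| := by
    have : ∑ K ∈ T.elems, (3 - ((T.neighbors K).card : ℝ)) * B K
        = ∑ K ∈ T.boundaryElems, (3 - ((T.neighbors K).card : ℝ)) * B K := by
      refine (Finset.sum_subset boundaryElems_subset fun K hK hKb => ?_).symm
      have := le_antisymm (hu.card_neighbors_le hK)
        (three_le_card_neighbors hΩo hK (elem_subset_of_notMem_boundaryElems hΩo hK hKb))
      simp [this]
    rw [this, Finset.mul_sum]
    refine (Finset.abs_sum_le_sum_abs _ _).trans (Finset.sum_le_sum fun K hK => ?_)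
    have h6 : ((T.neighbors K).card : ℝ) ≤ 3 := by
      exact_mod_cast hu.card_neighbors_le (boundaryElems_subset hK)
    rw [abs_mul]
    refine mul_le_mul_of_nonneg_right ?_ (abs_nonneg _)
    rw [abs_of_nonneg (by linarith)]
    have : (0 : ℝ) ≤ (T.neighbors K).card := by positivity
    linarith
  have h7 : 3 * ∑ K ∈ T.elems, B K = ∑ K ∈ T.elems, (T.neighbors K).card * B K
      + ∑ K ∈ T.elems, (3 - ((T.neighbors K).card : ℝ)) * B K := by
    rw [← Finset.sum_add_distrib, Finset.mul_sum]
    exact Finset.sum_congr rfl fun K _ => by ring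
  rw [h1, h2, abs_mul, abs_two] at h3
  have h8 : 3 * |∑ K ∈ T.elems, B K| ≤ |∑ K ∈ T.elems, (T.neighbors K).card * B K|
      + |∑ K ∈ T.elems, (3 - ((T.neighbors K).card : ℝ)) * B K| := by
    have := abs_add_le (∑ K ∈ T.elems, (T.neighbors K).card * B K)
      (∑ K ∈ T.elems, (3 - ((T.neighbors K).card : ℝ)) * B K)
    rw [← h7, abs_mul] at this
    simpa using this
  have h9 := mul_le_mul_of_nonneg_left h4 hc
  linarith

end Triangulation

/-! ### Square integrals over boundary strips -/

theorem hasDerivAt_sq_mul_sq_dilate {φ : Plane → ℝ} (hφ : ContDiff ℝ ∞ φ) (x y : Plane) (t : ℝ) :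
    HasDerivAt (fun t => t ^ 2 * φ (dilate y t x) ^ 2)
      (2 * t * φ (dilate y t x) ^ 2 + t ^ 2 * (2 * φ (dilate y t x) *
        ∑ i, partialDeriv i φ (dilate y t x) * (x i - y i))) t := by
  have h1 := (hasDerivAt_id t).pow 2
  have h2 := (hasDerivAt_comp_segment hφ x y t).pow 2
  refine (h1.mul h2).congr_deriv ?_
  simp

/-- Integrate the derivative of `t² φ²` along the dilation. The weight `t²` is the Jacobian in the
plane, so after integration in `x` the left side compares the mass on a set with that on its
contracted copy. The `5` is `4`, from `2 t ≤ 4 t²` for `t ≥ 1/2`, plus `1` from Young's inequality.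
-/
theorem sq_sub_sq_mul_sq_dilate_le {φ : Plane → ℝ} (hφ : ContDiff ℝ ∞ φ) {x y : Plane} {R : ℝ}
    (hR : dist x y ≤ R) {l : ℝ} (h0 : 1 / 2 ≤ l) (h1 : l ≤ 1) :
    φ x ^ 2 - l ^ 2 * φ (dilate y l x) ^ 2 ≤ ∫ t in l..1,
      t ^ 2 * (5 * φ (dilate y t x) ^ 2 + R ^ 2 * gradSq φ (dilate y t x)) := by
  have hcd : Continuous fun t : ℝ => dilate y t x :=
    continuous_dilate_uncurry.comp (by fun_prop : Continuous fun t : ℝ => ((x, y), t))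
  have hcp : Continuous fun t : ℝ => φ (dilate y t x) := hφ.continuous.comp hcd
  have hcs : Continuous fun t => ∑ i, partialDeriv i φ (dilate y t x) * (x i - y i) :=
    continuous_finsetSum _ fun i _ =>
      ((contDiff_partialDeriv i hφ).continuous.comp hcd).mul_const _
  have hcQ : Continuous fun t => gradSq φ (dilate y t x) := (continuous_gradSq hφ).comp hcd
  have ftc := intervalIntegral.integral_eq_sub_of_hasDerivAt
    (fun t _ => hasDerivAt_sq_mul_sq_dilate hφ x y t)
    ((by fun_prop : Continuous fun t => 2 * t * φ (dilate y t x) ^ 2 + t ^ 2 * (2 * φ (dilate y t x) *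
        ∑ i, partialDeriv i φ (dilate y t x) * (x i - y i))).intervalIntegrable l 1)
  have e1 : dilate y 1 x = x := by simp [dilate]
  rw [e1, one_pow, one_mul] at ftc
  rw [← ftc]
  refine intervalIntegral.integral_mono_on h1 (Continuous.intervalIntegrable (by fun_prop) _ _)
    (Continuous.intervalIntegrable (by fun_prop) _ _) fun t ht => ?_
  have hd : dist x y ^ 2 = (x 0 - y 0) ^ 2 + (x 1 - y 1) ^ 2 := by
    rw [EuclideanSpace.dist_eq, Real.sq_sqrt (by positivity)]
    simp [Fin.sum_univ_two, Real.dist_eq]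
  have hR2 : (x 0 - y 0) ^ 2 + (x 1 - y 1) ^ 2 ≤ R ^ 2 := hd ▸ pow_le_pow_left₀ dist_nonneg hR 2
  have ht' : 1 / 2 ≤ t := h0.trans ht.1
  set p := φ (dilate y t x)
  set a := partialDeriv 0 φ (dilate y t x) with ha
  set b := partialDeriv 1 φ (dilate y t x) with hb
  have hg : gradSq φ (dilate y t x) = a ^ 2 + b ^ 2 := by simp [gradSq, Fin.sum_univ_two, ha, hb]
  rw [hg, Fin.sum_univ_two]
  have h2 : 2 * t * p ^ 2 ≤ t ^ 2 * (4 * p ^ 2) := by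
    have : 2 * t ≤ t ^ 2 * 4 := by nlinarith
    nlinarith [mul_le_mul_of_nonneg_right this (sq_nonneg p)]
  have h3 : 2 * p * (a * (x 0 - y 0) + b * (x 1 - y 1)) ≤ p ^ 2 + R ^ 2 * (a ^ 2 + b ^ 2) := by
    have h4 : (a * (x 0 - y 0) + b * (x 1 - y 1)) ^ 2 ≤ R ^ 2 * (a ^ 2 + b ^ 2) := by
      nlinarith [sq_nonneg (a * (x 1 - y 1) - b * (x 0 - y 0)), sq_nonneg a, sq_nonneg b]
    nlinarith [sq_nonneg (p - (a * (x 0 - y 0) + b * (x 1 - y 1)))]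
  have h5 := mul_le_mul_of_nonneg_left h3 (sq_nonneg t)
  linarith

/-- The weight `t²` cancels the Jacobian exactly, so only the length `1 - l` of the parameter
interval remains. This is the small factor of the strip estimate. -/
theorem setIntegral_integral_sq_mul_dilate_le {U : Set Plane} (hU : IsOpen U) (hc : Convex ℝ U)
    (hb : Bornology.IsBounded U) {Q : Plane → ℝ} (hQ : Continuous Q) (h0 : ∀ x, 0 ≤ Q x) {y : Plane}
    (hy : y ∈ U) {l : ℝ} (hl0 : 0 < l) (hl1 : l ≤ 1) :
    ∫ x in U, ∫ t in l..1, t ^ 2 * Q (dilate y t x) ≤ (1 - l) * ∫ x in U, Q x := by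
  have hfin := isFiniteMeasure_restrict_of_isBounded hb
  have hQi := integrable_of_continuous_of_isBounded hb hQ
  have hcd : Continuous fun p : Plane × ℝ => p.2 ^ 2 * Q (dilate y p.2 p.1) :=
    (by fun_prop : Continuous fun p : Plane × ℝ => p.2 ^ 2).mul (hQ.comp
      (continuous_dilate_uncurry.comp (by fun_prop : Continuous fun p : Plane × ℝ => ((p.1, y), p.2))))
  simp only [intervalIntegral.integral_of_le hl1]
  rw [integral_integral_swap]
  · have h1 : ∀ t ∈ Set.Ioc l 1, ∫ x in U, t ^ 2 * Q (dilate y t x) ≤ ∫ x in U, Q x := by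
      intro t ht
      have ht0 : 0 < t := hl0.trans ht.1
      rw [integral_const_mul]
      have := mul_le_mul_of_nonneg_left (setIntegral_comp_dilate_le hU hc hQi h0 hy ht0 ht.2)
        (sq_nonneg t)
      rwa [mul_inv_cancel_left₀ (by positivity)] at this
    have h2 := integral_mono_of_nonneg (μ := volume.restrict (Set.Ioc l 1))
      (Eventually.of_forall fun t => integral_nonneg fun x =>
        mul_nonneg (sq_nonneg t) (h0 (dilate y t x)))
      (integrable_const (∫ x in U, Q x)) ((ae_restrict_mem measurableSet_Ioc).mono h1)
    refine h2.trans (le_of_eq ?_)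
    rw [integral_const, measureReal_restrict_apply_univ, Real.volume_real_Ioc_of_le hl1, smul_eq_mul]
  · rw [Measure.prod_restrict]
    exact (hcd.locallyIntegrable.integrableOn_isCompact
      (hb.isCompact_closure.prod (isCompact_Icc (a := l) (b := 1)))).mono_set
      (Set.prod_mono subset_closure Set.Ioc_subset_Icc_self)

section Strip

variable {U V : Set Plane} {y : Plane} {R l : ℝ}

/-- The contracted copy of `U` avoids `V`, so its mass is at most that of `U \ V`. The mass on `V`
is therefore at most the loss under contraction. -/
theorem normSq_strip_le_of_contDiff (hU : IsOpen U) (hc : Convex ℝ U) (hb : Bornology.IsBounded U)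
    (hy : y ∈ U) (hR : ∀ x ∈ U, dist x y ≤ R) (hl0 : 1 / 2 ≤ l) (hl1 : l ≤ 1) (hVU : V ⊆ U)
    (hV : MeasurableSet V) (hVl : ∀ x ∈ U, dilate y l x ∉ V) {φ : Plane → ℝ} (hφ : ContDiff ℝ ∞ φ) :
    normSq V φ ≤ (1 - l) * ∫ x in U, (5 * φ x ^ 2 + R ^ 2 * gradSq φ x) := by
  have hl : 0 < l := by linarith
  have hφc := hφ.continuous
  have hφ2 : IntegrableOn (fun x => φ x ^ 2) U :=
    integrable_of_continuous_of_isBounded hb (hφc.pow 2)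
  have hm : MeasurableSet (U \ V) := hU.measurableSet.diff hV
  have hφd : Integrable (fun x => l ^ 2 * φ (dilate y l x) ^ 2) (volume.restrict U) :=
    integrable_of_continuous_of_isBounded hb
      (continuous_const.mul ((hφc.comp (continuous_dilate y l)).pow 2))
  have h1 : ∫ x in U, φ (dilate y l x) ^ 2 ≤ (l ^ 2)⁻¹ * ∫ x in U \ V, φ x ^ 2 := by
    rw [← integral_indicator hU.measurableSet, ← integral_indicator hm, ← integral_comp_dilate y]
    refine integral_mono_of_nonneg (Eventually.of_forall fun x =>
      Set.indicator_nonneg (fun x _ => sq_nonneg _) x) (integrable_comp_dilate y hl.ne'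
        ((integrable_indicator_iff hm).2 (hφ2.mono_set Set.sdiff_subset)))
      (Eventually.of_forall fun x => ?_)
    by_cases hx : x ∈ U
    · have : dilate y l x ∈ U \ V :=
        ⟨hc hx hy hl.le (sub_nonneg.2 hl1) (by ring), hVl x hx⟩
      simp only [Set.indicator_of_mem hx, Set.indicator_of_mem this]
      exact le_rfl
    · simpa [hx] using Set.indicator_nonneg (s := U \ V) (f := fun x => φ x ^ 2)
        (fun x _ => sq_nonneg _) _
  have h2 : (∫ x in V, φ x ^ 2) + ∫ x in U \ V, φ x ^ 2 = ∫ x in U, φ x ^ 2 := by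
    rw [← setIntegral_union Set.disjoint_sdiff_right hm (hφ2.mono_set hVU)
      (hφ2.mono_set Set.sdiff_subset), Set.union_sdiff_cancel hVU]
  have h3 : normSq V φ ≤ ∫ x in U, (φ x ^ 2 - l ^ 2 * φ (dilate y l x) ^ 2) := by
    rw [integral_sub hφ2 hφd, integral_const_mul]
    have := mul_le_mul_of_nonneg_left h1 (sq_nonneg l)
    rw [mul_inv_cancel_left₀ (by positivity)] at this
    unfold normSq
    linarith
  have hQ : Continuous fun x => 5 * φ x ^ 2 + R ^ 2 * gradSq φ x :=
    (continuous_const.mul (hφc.pow 2)).add (continuous_const.mul (continuous_gradSq hφ))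
  refine h3.trans ((setIntegral_mono_on (hφ2.sub hφd) ?_ hU.measurableSet fun x hx =>
    sq_sub_sq_mul_sq_dilate_le hφ (hR x hx) hl0 hl1).trans
      (setIntegral_integral_sq_mul_dilate_le hU hc hb hQ (fun x => by
        have := gradSq_nonneg φ x; positivity) hy hl hl1))
  refine integrable_of_continuous_of_isBounded hb ?_
  refine intervalIntegral.continuous_parametric_intervalIntegral_of_continuous'
    (f := fun (x : Plane) t => t ^ 2 * (5 * φ (dilate y t x) ^ 2 + R ^ 2 * gradSq φ (dilate y t x)))
    ?_ _ _
  exact (by fun_prop : Continuous fun p : Plane × ℝ => p.2 ^ 2).mul (hQ.comp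
      (continuous_dilate_uncurry.comp (by fun_prop : Continuous fun p : Plane × ℝ => ((p.1, y), p.2))))

theorem HasGrad.normSq_strip_le (hU : IsOpen U) (hc : Convex ℝ U) (hb : Bornology.IsBounded U)
    (hy : y ∈ U) (hR : ∀ x ∈ U, dist x y ≤ R) (hl0 : 1 / 2 ≤ l) (hl1 : l ≤ 1) (hVU : V ⊆ U)
    (hV : MeasurableSet V) (hVl : ∀ x ∈ U, dilate y l x ∉ V) {f : Plane → ℝ}
    {g : Fin 2 → Plane → ℝ} (hf : HasGrad U f g) :
    normSq V f ≤ (1 - l) * (5 * normSq U f + R ^ 2 * energy U g) := by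
  obtain ⟨φ, hφ, h1, h2⟩ := hf.exists_smooth_approx hU hb hc ⟨y, hy⟩
  have hmem : ∀ n, MemLp (φ n) 2 (volume.restrict U) := fun n =>
    memLp_of_continuous_of_isBounded hb (hφ n).continuous
  have hres : volume.restrict V ≤ volume.restrict U := Measure.restrict_mono hVU le_rfl
  have t1 : Tendsto (fun n => normSq V (φ n)) atTop (𝓝 (normSq V f)) := by
    refine tendsto_integral_sq (hf.memLp.mono_measure hres) (fun n => (hmem n).mono_measure hres) ?_
    refine squeeze_zero (fun n => integral_nonneg fun x => sq_nonneg _) (fun n => ?_) h1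
    exact normSq_mono hVU (f := fun x => f x - φ n x) (hf.memLp.sub (hmem n))
  have t2 : Tendsto (fun n => (1 - l) * (5 * normSq U (φ n) + R ^ 2 * ∫ x in U, gradSq (φ n) x)) atTop
      (𝓝 ((1 - l) * (5 * normSq U f + R ^ 2 * energy U g))) :=
    (((tendsto_integral_sq hf.memLp hmem h1).const_mul 5).add
      ((hf.tendsto_energy hb hφ h2).const_mul _)).const_mul _
  refine le_of_tendsto_of_tendsto' t1 t2 fun n => ?_
  refine (normSq_strip_le_of_contDiff hU hc hb hy hR hl0 hl1 hVU hV hVl (hφ n)).trans (le_of_eq ?_)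
  rw [integral_add ((hmem n).integrable_sq.const_mul 5)
    ((integrable_of_continuous_of_isBounded hb (continuous_gradSq (hφ n))).const_mul _),
    integral_const_mul, integral_const_mul]
  rfl

end Strip

/-! ### The strip of elements meeting the boundary -/

namespace Triangulation

variable {Ω : Set Plane} {K : Finset Plane}

theorem meshSize_pos (T : Triangulation Ω) (hK : K ∈ T.elems) : 0 < T.meshSize := by
  obtain ⟨a, b, c, hab, -, -, h⟩ := Finset.card_eq_three.1 (T.isTriangle K hK).1
  have ha : a ∈ elem K := subset_convexHull ℝ _ (by simp [h])
  have hb : b ∈ elem K := subset_convexHull ℝ _ (by simp [h])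
  exact (dist_pos.2 hab).trans_le (T.dist_le_meshSize hK a ha b hb)

/-- The union of the interiors of the elements that meet the boundary. -/
def boundaryStrip (T : Triangulation Ω) : Set Plane := ⋃ K ∈ T.boundaryElems, interior (elem K)

theorem isOpen_boundaryStrip (T : Triangulation Ω) : IsOpen T.boundaryStrip :=
  isOpen_biUnion fun _ _ => isOpen_interior

theorem boundaryStrip_subset (T : Triangulation Ω) (hΩ : interior (closure Ω) = Ω) :
    T.boundaryStrip ⊆ Ω :=
  Set.iUnion₂_subset fun _ hK => T.interior_elem_subset hΩ (boundaryElems_subset hK)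

/-- A dilated point has a ball of radius `(1 - l) r` inside `Ω`. An element containing it has
smaller diameter and so cannot reach the boundary. -/
theorem dilate_notMem_boundaryStrip (T : Triangulation Ω) (hΩo : IsOpen Ω) {U : Set Plane}
    (hUΩ : U ⊆ Ω) (hc : Convex ℝ U) {y : Plane} {r : ℝ} (hr : Metric.ball y r ⊆ U) {l : ℝ}
    (hl0 : 0 ≤ l) (hl1 : l < 1) (hl : T.meshSize < (1 - l) * r) {x : Plane} (hx : x ∈ U) :
    dilate y l x ∉ T.boundaryStrip := by
  intro hmem
  simp only [boundaryStrip, Set.mem_iUnion, exists_prop] at hmem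
  obtain ⟨K, hK, hxK⟩ := hmem
  obtain ⟨hK, z, hzK, hz⟩ := mem_boundaryElems.1 hK
  rw [hΩo.frontier_eq] at hz
  refine hz.2 (hUΩ (ball_dilate_subset hc hr hl0 hl1 hx ?_))
  rw [Metric.mem_ball]
  exact (T.dist_le_meshSize hK z hzK _ (interior_subset hxK)).trans_lt hl

theorem exists_normSq_boundaryStrip_inter_le (hΩo : IsOpen Ω) {U : Set Plane} (hU : IsOpen U) (hUΩ : U ⊆ Ω) (hc : Convex ℝ U) (hb : Bornology.IsBounded U)
    (hne : U.Nonempty) : ∃ C, 0 ≤ C ∧ ∀ T : Triangulation Ω, ∀ f g, HasGrad Ω f g →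
      normSq (T.boundaryStrip ∩ U) f ≤ C * T.meshSize * (normSq Ω f + energy Ω g) := by
  obtain ⟨y, hy⟩ := hne
  obtain ⟨r, hr0, hr⟩ := Metric.isOpen_iff.1 hU y hy
  obtain ⟨R, hR⟩ := hb.subset_closedBall y
  refine ⟨(10 + 2 * R ^ 2) / r, by positivity, fun T f g hf => ?_⟩
  have hfU := hf.mono hUΩ
  have h0 := normSq_nonneg Ω f
  have h1 := energy_nonneg Ω g
  have h2 : normSq U f ≤ normSq Ω f := normSq_mono hUΩ hf.memLp
  have h3 : energy U g ≤ energy Ω g := hf.energy_mono hUΩ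
  rcases T.boundaryElems.eq_empty_or_nonempty with he | ⟨K, hK⟩
  · have : T.boundaryStrip = ∅ := by simp [boundaryStrip, he]
    rw [this, Set.empty_inter]
    simp only [normSq, setIntegral_empty]
    have := T.meshSize_nonneg
    positivity
  have hh := T.meshSize_pos (boundaryElems_subset hK)
  set h := T.meshSize
  rcases le_or_gt h (r / 4) with hle | hgt
  -- With `l = 1 - 2h/r` the distance gained is `(1 - l) r = 2h > h`, while `h ≤ r/4` ensures `l ≥
  -- 1/2`.
  · have key := hfU.normSq_strip_le (V := T.boundaryStrip ∩ U) (l := 1 - 2 * h / r) hU hc hb hy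
      (fun x hx => hR hx) (by rw [le_sub_comm, div_le_iff₀ hr0]; linarith)
      (by have : 0 ≤ 2 * h / r := by positivity
          linarith) Set.inter_subset_right
      (T.isOpen_boundaryStrip.measurableSet.inter hU.measurableSet) (fun x hx hmem => by
        have hpos : 0 < 2 * h / r := by positivity
        refine T.dilate_notMem_boundaryStrip hΩo hUΩ hc hr ?_ (by linarith) ?_ hx hmem.1
        · rw [sub_nonneg, div_le_iff₀ hr0]; linarith
        · rw [sub_sub_cancel, div_mul_cancel₀ _ hr0.ne']
          change h < 2 * h
          linarith)
    refine key.trans ?_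
    rw [sub_sub_cancel]
    have e : (10 + 2 * R ^ 2) / r * h * (normSq Ω f + energy Ω g)
        = 2 * h / r * ((5 + R ^ 2) * (normSq Ω f + energy Ω g)) := by ring
    rw [e]
    refine mul_le_mul_of_nonneg_left ?_ (by positivity)
    nlinarith [sq_nonneg R, normSq_nonneg U f, energy_nonneg U g]
  -- A coarse mesh, `h > r/4`: the factor in front is at least `1` and the trivial bound suffices.
  · have h4 : normSq (T.boundaryStrip ∩ U) f ≤ normSq Ω f :=
      normSq_mono (Set.inter_subset_right.trans hUΩ) hf.memLp
    have h5 : 1 ≤ (10 + 2 * R ^ 2) / r * h := by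
      rw [div_mul_eq_mul_div, le_div_iff₀ hr0]
      nlinarith [mul_nonneg (sq_nonneg R) hh.le]
    nlinarith

/-- The strip of `T` is covered, up to a null set, by the finitely many convex open elements of the
fixed triangulation `T₀`. Hence the constant does not depend on `T`. -/
theorem exists_sum_boundaryElems_normSq_le (hΩo : IsOpen Ω) (hΩ : interior (closure Ω) = Ω)
    (T₀ : Triangulation Ω) : ∃ C, 0 ≤ C ∧ ∀ T : Triangulation Ω, ∀ f g, HasGrad Ω f g →
      ∑ K ∈ T.boundaryElems, normSq (interior (elem K)) f
        ≤ C * T.meshSize * (normSq Ω f + energy Ω g) := by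
  have h : ∀ K : T₀.elems, ∃ C, 0 ≤ C ∧ ∀ T : Triangulation Ω, ∀ f g, HasGrad Ω f g →
      normSq (T.boundaryStrip ∩ interior (elem (K : Finset Plane))) f
        ≤ C * T.meshSize * (normSq Ω f + energy Ω g) := fun K =>
    exists_normSq_boundaryStrip_inter_le hΩo isOpen_interior (T₀.interior_elem_subset hΩ K.2)
      (convex_elem _).interior (isBounded_interior_elem _) (T₀.isTriangle K K.2).interior_nonempty
  choose C hC0 hC using h
  refine ⟨∑ K ∈ T₀.elems.attach, C K, Finset.sum_nonneg fun K _ => hC0 K, fun T f g hf => ?_⟩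
  have hS := T.boundaryStrip_subset hΩ
  have e1 : (⋃ K ∈ T₀.elems, T.boundaryStrip ∩ interior (elem K) : Set Plane)
      =ᵐ[volume] T.boundaryStrip := by
    rw [← Set.inter_iUnion₂]
    have := (ae_eq_refl T.boundaryStrip).inter (T₀.iUnion_interior_elem_ae_eq_self hΩ)
    rwa [Set.inter_eq_left.2 hS] at this
  rw [← T.normSq_iUnion_interior boundaryElems_subset hΩ hf.memLp]
  change normSq T.boundaryStrip f ≤ _
  have e2 : normSq T.boundaryStrip f
      = ∑ K ∈ T₀.elems, normSq (T.boundaryStrip ∩ interior (elem K)) f := by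
    unfold normSq
    rw [← setIntegral_congr_set e1]
    refine integral_biUnion_finset _ (fun K _ => T.isOpen_boundaryStrip.measurableSet.inter
      isOpen_interior.measurableSet) (fun K hK L hL hKL => ?_) fun K hK => ?_
    · exact (T₀.pairwiseDisjoint hK hL hKL).mono Set.inter_subset_right Set.inter_subset_right
    · exact (hf.memLp.mono_measure (Measure.restrict_mono (Set.inter_subset_left.trans hS)
        le_rfl)).integrable_sq
  rw [e2, ← Finset.sum_attach, Finset.sum_mul, Finset.sum_mul]
  exact Finset.sum_le_sum fun K _ => hC K T f g hf

end Triangulation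

/-! ### Poincaré's inequality on a connected triangulated domain -/

section Poincare

variable {Ω W W₁ W₂ : Set Plane}

/-- Poincaré's inequality modulo constants on `W`, with the gradient taken on `Ω`. -/
def PoincareOn (Ω W : Set Plane) : Prop :=
  ∃ C, 0 ≤ C ∧ ∀ f g, HasGrad Ω f g → ∃ c, normSq W (fun x => f x - c) ≤ C * energy Ω g

theorem normSq_add_le {U : Set Plane} {f g : Plane → ℝ} (hf : MemLp f 2 (volume.restrict U))
    (hg : MemLp g 2 (volume.restrict U)) :
    normSq U (fun x => f x + g x) ≤ 2 * normSq U f + 2 * normSq U g :=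
  integral_add_sq_le hf hg

theorem normSq_union_le {U V : Set Plane} {f : Plane → ℝ}
    (hf : MemLp f 2 (volume.restrict (U ∪ V))) :
    normSq (U ∪ V) f ≤ normSq U f + normSq V f := by
  have hU := hf.mono_measure (Measure.restrict_mono Set.subset_union_left le_rfl)
  have hV := hf.mono_measure (Measure.restrict_mono Set.subset_union_right le_rfl)
  unfold normSq
  rw [← integral_add_measure hU.integrable_sq hV.integrable_sq]
  exact integral_mono_measure (Measure.restrict_union_le U V)
    (Eventually.of_forall fun x => sq_nonneg _) (hU.integrable_sq.add_measure hV.integrable_sq)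

theorem PoincareOn.of_convex (hW : IsOpen W) (hc : Convex ℝ W) (hb : Bornology.IsBounded W)
    (hWΩ : W ⊆ Ω) : PoincareOn Ω W := by
  refine ⟨2 * Metric.diam W ^ 2, by positivity, fun f g hf => ⟨_, ((hf.mono hWΩ).poincare hW hc hb
    fun x hx y hy => Metric.dist_le_diam_of_mem hb hx hy).trans ?_⟩⟩
  exact mul_le_mul_of_nonneg_left (hf.energy_mono hWΩ) (by positivity)

/-- The constants approximating `f` on the two sets can be compared on the overlap, which has
positive measure. -/
theorem PoincareOn.union (hb : Bornology.IsBounded Ω) (h₁ : PoincareOn Ω W₁) (h₂ : PoincareOn Ω W₂)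
    (hW₁ : IsOpen W₁) (hW₂ : IsOpen W₂) (hΩ₁ : W₁ ⊆ Ω) (hΩ₂ : W₂ ⊆ Ω)
    (hne : (W₁ ∩ W₂).Nonempty) : PoincareOn Ω (W₁ ∪ W₂) := by
  obtain ⟨C₁, hC₁, h₁⟩ := h₁
  obtain ⟨C₂, hC₂, h₂⟩ := h₂
  have hbI : Bornology.IsBounded (W₁ ∩ W₂) := hb.subset (Set.inter_subset_left.trans hΩ₁)
  have hv : 0 < volume.real (W₁ ∩ W₂) :=
    ENNReal.toReal_pos ((hW₁.inter hW₂).measure_pos volume hne).ne' hbI.measure_lt_top.ne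
  set v := volume.real (W₁ ∩ W₂)
  set V := volume.real W₂
  have hV : 0 ≤ V := measureReal_nonneg
  refine ⟨C₁ + 2 * C₂ + 2 * (V / v * (2 * C₁ + 2 * C₂)), by positivity, fun f g hf => ?_⟩
  obtain ⟨c₁, e₁⟩ := h₁ f g hf
  obtain ⟨c₂, e₂⟩ := h₂ f g hf
  refine ⟨c₁, ?_⟩
  have hf₁ := (hf.sub_const hb c₁)
  have hf₂ := (hf.sub_const hb c₂)
  have hconst : ∀ (S : Set Plane) (c : ℝ), normSq S (fun _ => c) = volume.real S * c ^ 2 := by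
    intro S c
    simp [normSq]
  have k1 := normSq_union_le (hf₁.mono (Set.union_subset hΩ₁ hΩ₂)).memLp
  have k2 : normSq W₂ (fun x => f x - c₁) ≤ 2 * normSq W₂ (fun x => f x - c₂)
      + 2 * (V * (c₂ - c₁) ^ 2) := by
    rw [← hconst]
    have := normSq_add_le (hf₂.mono hΩ₂).memLp
      (hasGrad_const (hb.subset hΩ₂) (c₂ - c₁)).memLp
    simpa using this
  have hI : W₁ ∩ W₂ ⊆ Ω := Set.inter_subset_left.trans hΩ₁
  have k3 : v * (c₂ - c₁) ^ 2 ≤ 2 * normSq W₁ (fun x => f x - c₁)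
      + 2 * normSq W₂ (fun x => f x - c₂) := by
    rw [← hconst]
    have := normSq_add_le (hf₁.mono hI).memLp
      ((hf₂.mono hI).const_mul (-1)).memLp
    have e : ∀ x, f x - c₁ + -1 * (f x - c₂) = c₂ - c₁ := fun x => by ring
    simp only [e] at this
    have e' : normSq (W₁ ∩ W₂) (fun x => -1 * (f x - c₂))
      = normSq (W₁ ∩ W₂) (fun x => f x - c₂) := by
      simp only [normSq, neg_one_mul, neg_sq]
    rw [e'] at this
    have m1 := normSq_mono (Set.inter_subset_left (t := W₂)) (hf₁.mono hΩ₁).memLp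
    have m2 := normSq_mono (Set.inter_subset_right (s := W₁)) (hf₂.mono hΩ₂).memLp
    linarith
  have k4 : V * (c₂ - c₁) ^ 2 ≤ V / v * (2 * C₁ + 2 * C₂) * energy Ω g := by
    have : V * (c₂ - c₁) ^ 2 = V / v * (v * (c₂ - c₁) ^ 2) := by field_simp
    rw [this, mul_assoc]
    exact mul_le_mul_of_nonneg_left (by linarith) (by positivity)
  linarith

/-- The points that can be joined to `W₀` form an open set. Attaching one more ball shows it is also
relatively closed in `Ω`, so connectedness gives all of `Ω`. -/
theorem PoincareOn.exists_mem (hΩo : IsOpen Ω) (hΩc : IsConnected Ω) (hb : Bornology.IsBounded Ω)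
    {W₀ : Set Plane} (hW₀ : IsOpen W₀) (hne : W₀.Nonempty) (hW₀Ω : W₀ ⊆ Ω) (h₀ : PoincareOn Ω W₀) :
    ∀ x ∈ Ω, ∃ W, IsOpen W ∧ W ⊆ Ω ∧ W₀ ⊆ W ∧ x ∈ W ∧ PoincareOn Ω W := by
  set A : Set Plane := {x | ∃ W, IsOpen W ∧ W ⊆ Ω ∧ W₀ ⊆ W ∧ x ∈ W ∧ PoincareOn Ω W}
  have hA : IsOpen A := by
    rw [isOpen_iff_forall_mem_open]
    rintro x ⟨W, h1, h2, h3, h4, h5⟩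
    exact ⟨W, fun y hy => ⟨W, h1, h2, h3, hy, h5⟩, h1, h4⟩
  obtain ⟨x₀, hx₀⟩ := hne
  refine hΩc.isPreconnected.subset_of_closure_inter_subset hA
    ⟨x₀, hW₀Ω hx₀, W₀, hW₀, hW₀Ω, subset_rfl, hx₀, h₀⟩ ?_
  rintro x ⟨hxA, hx⟩
  obtain ⟨r, hr, hball⟩ := Metric.isOpen_iff.1 hΩo x hx
  obtain ⟨y, ⟨W, h1, h2, h3, h4, h5⟩, hy⟩ := Metric.mem_closure_iff.1 hxA r hr
  have hyb : y ∈ Metric.ball x r := by rwa [Metric.mem_ball, dist_comm]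
  exact ⟨W ∪ Metric.ball x r, h1.union Metric.isOpen_ball, Set.union_subset h2 hball,
    h3.trans Set.subset_union_left, Or.inr (Metric.mem_ball_self hr),
    h5.union hb (PoincareOn.of_convex Metric.isOpen_ball (convex_ball x r) Metric.isBounded_ball hball)
      h1 Metric.isOpen_ball h2 hball ⟨y, h4, hyb⟩⟩

/-- Join each of the finitely many open elements to a fixed ball and glue. The resulting set has
full measure in `Ω`, so no regularity of the boundary is used beyond the triangulation. -/
theorem Triangulation.poincareOn (T : Triangulation Ω) (hΩo : IsOpen Ω) (hΩc : IsConnected Ω)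
    (hb : Bornology.IsBounded Ω) (hΩ : interior (closure Ω) = Ω) : PoincareOn Ω Ω := by
  obtain ⟨x₀, hx₀⟩ := hΩc.nonempty
  obtain ⟨r, hr, hball⟩ := Metric.isOpen_iff.1 hΩo x₀ hx₀
  set W₀ := Metric.ball x₀ r
  have hx₀' : x₀ ∈ W₀ := Metric.mem_ball_self hr
  have h₀ : PoincareOn Ω W₀ :=
    PoincareOn.of_convex Metric.isOpen_ball (convex_ball x₀ r) Metric.isBounded_ball hball
  have hex := PoincareOn.exists_mem hΩo hΩc hb Metric.isOpen_ball ⟨x₀, hx₀'⟩ hball h₀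
  have key : ∀ s ⊆ T.elems, ∃ W, IsOpen W ∧ W ⊆ Ω ∧ W₀ ⊆ W ∧ (∀ K ∈ s, interior (elem K) ⊆ W) ∧
      PoincareOn Ω W := by
    classical
    intro s
    induction s using Finset.induction_on with
    | empty => exact fun _ => ⟨W₀, Metric.isOpen_ball, hball, subset_rfl, by simp, h₀⟩
    | insert K s hK ih =>
      intro hs
      obtain ⟨W, h1, h2, h3, h4, h5⟩ := ih ((Finset.subset_insert K s).trans hs)
      have hKT := hs (Finset.mem_insert_self K s)
      have hKΩ := T.interior_elem_subset hΩ hKT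
      obtain ⟨x, hx⟩ := (T.isTriangle K hKT).interior_nonempty
      obtain ⟨W', k1, k2, k3, k4, k5⟩ := hex x (hKΩ hx)
      have hP := (h5.union hb k5 h1 k1 h2 k2 ⟨x₀, h3 hx₀', k3 hx₀'⟩).union hb
        (PoincareOn.of_convex isOpen_interior (convex_elem K).interior (isBounded_interior_elem K) hKΩ)
        (h1.union k1) isOpen_interior (Set.union_subset h2 k2) hKΩ ⟨x, Or.inr k4, hx⟩
      refine ⟨_, (h1.union k1).union isOpen_interior,
        Set.union_subset (Set.union_subset h2 k2) hKΩ,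
        h3.trans (Set.subset_union_left.trans Set.subset_union_left), fun L hL => ?_, hP⟩
      rcases Finset.mem_insert.1 hL with rfl | hL
      · exact Set.subset_union_right
      · exact (h4 L hL).trans (Set.subset_union_left.trans Set.subset_union_left)
  obtain ⟨W, -, h2, -, h4, C, hC, h5⟩ := key T.elems subset_rfl
  refine ⟨C, hC, fun f g hf => ?_⟩
  obtain ⟨c, hc⟩ := h5 f g hf
  refine ⟨c, le_trans ?_ hc⟩
  have e : normSq Ω (fun x => f x - c)
      = normSq (⋃ K ∈ T.elems, interior (elem K)) (fun x => f x - c) :=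
    setIntegral_congr_set (T.iUnion_interior_elem_ae_eq_self hΩ).symm
  rw [e]
  exact normSq_mono (Set.iUnion₂_subset h4) ((hf.sub_const hb c).mono h2).memLp

end Poincare

/-! ### Smooth functions in the closure of the test functions vanish on the boundary -/

section Vanishing

variable {Ω : Set Plane} {q : Plane → ℝ} {φ : ℕ → Plane → ℝ}

/-- Integration by parts on `Ω` without a boundary term, against every smooth `ψ`: true for test
functions and stable under the limit. -/
theorem integral_mul_partialDeriv_eq_neg_of_tendsto (hb : Bornology.IsBounded Ω)
    (hq : ContDiff ℝ ∞ q) (hφ : ∀ n, IsTestFunction Ω (φ n))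
    (h1 : Tendsto (fun n => ∫ x in Ω, (q x - φ n x) ^ 2) atTop (𝓝 0))
    (h2 : ∀ i, Tendsto (fun n => ∫ x in Ω, (partialDeriv i q x - partialDeriv i (φ n) x) ^ 2)
      atTop (𝓝 0)) (i : Fin 2) {ψ : Plane → ℝ} (hψ : ContDiff ℝ ∞ ψ) :
    ∫ x in Ω, q x * partialDeriv i ψ x = -∫ x in Ω, partialDeriv i q x * ψ x := by
  have m : ∀ {f : Plane → ℝ}, ContDiff ℝ ∞ f → MemLp f 2 (volume.restrict Ω) := fun hf =>
    memLp_of_continuous_of_isBounded hb hf.continuous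
  have hψ' := contDiff_partialDeriv i hψ
  have t1 := tendsto_integral_mul_right (m hq) (m hψ') (fun n => m (hφ n).1) h1
  have t2 := (tendsto_integral_mul_right (m (contDiff_partialDeriv i hq)) (m hψ)
    (fun n => m (contDiff_partialDeriv i (hφ n).1)) (h2 i)).neg
  refine tendsto_nhds_unique t1 (t2.congr fun n => ?_)
  have e := integral_partialDeriv_eq_neg hψ i (hφ n).1 (hφ n).2.1
  have e1 := (hφ n).setIntegral_mul (Set.subset_univ Ω) (partialDeriv i ψ)
  have e2 := ((hφ n).partialDeriv i).setIntegral_mul (Set.subset_univ Ω) ψ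
  rw [setIntegral_univ] at e1 e2
  simp only [mul_comm (partialDeriv i (φ n) _), mul_comm (φ n _)]
  rw [← e1, ← e2]
  linarith

theorem contDiff_div_of_tsupport_subset {U : Set Plane} (hq : ContDiff ℝ ∞ q)
    (h0 : ∀ x ∈ U, q x ≠ 0) {η : Plane → ℝ} (hη : IsTestFunction U η) :
    ContDiff ℝ ∞ fun x => η x / q x := by
  rw [contDiff_iff_contDiffAt]
  intro x
  by_cases hx : x ∈ tsupport η
  · exact hη.1.contDiffAt.div hq.contDiffAt (h0 x (hη.2.2 hx))
  · refine (contDiffAt_const (c := (0 : ℝ))).congr_of_eventuallyEq ?_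
    filter_upwards [notMem_tsupport_iff_eventuallyEq.1 hx] with y hy
    simp [hy]

theorem partialDeriv_mul (i : Fin 2) {f g : Plane → ℝ} (hf : ContDiff ℝ ∞ f) (hg : ContDiff ℝ ∞ g)
    (x : Plane) : partialDeriv i (fun x => f x * g x) x
      = f x * partialDeriv i g x + partialDeriv i f x * g x := by
  unfold partialDeriv
  rw [fderiv_fun_mul (hf.differentiable (by simp) x) (hg.differentiable (by simp) x)]
  simp [mul_comm]

/-- If `q z ≠ 0`, take `ψ = η / q` with `η` supported near `z`: integration by parts becomes `∫_Ω
∂ᵢη = 0`. So the indicator of `Ω` has zero weak gradient on a ball about `z` and, by the variance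
inequality, is constant there. But the ball meets both `Ω` and, as `Ω` is the interior of its
closure, the complement of that closure in positive measure. -/
theorem eq_zero_of_mem_frontier (hΩo : IsOpen Ω) (hb : Bornology.IsBounded Ω)
    (hΩ : interior (closure Ω) = Ω) (hq : ContDiff ℝ ∞ q) (hφ : ∀ n, IsTestFunction Ω (φ n))
    (h1 : Tendsto (fun n => ∫ x in Ω, (q x - φ n x) ^ 2) atTop (𝓝 0))
    (h2 : ∀ i, Tendsto (fun n => ∫ x in Ω, (partialDeriv i q x - partialDeriv i (φ n) x) ^ 2)
      atTop (𝓝 0)) {z : Plane} (hz : z ∈ frontier Ω) : q z = 0 := by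
  by_contra hne
  obtain ⟨r, hr, hball⟩ := Metric.isOpen_iff.1 (isOpen_ne_fun hq.continuous continuous_const) z hne
  set B := Metric.ball z r with hB
  have hBb : Bornology.IsBounded B := Metric.isBounded_ball
  have hBo : IsOpen B := Metric.isOpen_ball
  have key : ∀ i, ∀ η, IsTestFunction B η → ∫ x in Ω, partialDeriv i η x = 0 := by
    intro i η hη
    have hψ := contDiff_div_of_tsupport_subset hq hball hη
    have e := integral_mul_partialDeriv_eq_neg_of_tendsto hb hq hφ h1 h2 i hψ
    have hqψ : (fun x => q x * (η x / q x)) = η := by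
      funext x
      by_cases hx : x ∈ B
      · exact mul_div_cancel₀ _ (hball hx)
      · simp [hη.eq_zero hx]
    have e' : ∀ x, partialDeriv i η x = q x * partialDeriv i (fun x => η x / q x) x
        + partialDeriv i q x * (η x / q x) := fun x => by
      rw [← partialDeriv_mul i hq hψ, hqψ]
    have i1 : Integrable (fun x => q x * partialDeriv i (fun x => η x / q x) x)
        (volume.restrict Ω) := integrable_of_continuous_of_isBounded hb
      (hq.continuous.mul (contDiff_partialDeriv i hψ).continuous)
    have i2 : Integrable (fun x => partialDeriv i q x * (η x / q x)) (volume.restrict Ω) :=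
      integrable_of_continuous_of_isBounded hb ((contDiff_partialDeriv i hq).continuous.mul hψ.continuous)
    simp only [e']
    rw [integral_add i1 i2, e, neg_add_cancel]
  have hfin := isFiniteMeasure_restrict_of_isBounded hBb
  have hG : HasGrad B (Ω.indicator fun _ => (1 : ℝ)) (fun _ _ => 0) := by
    refine ⟨(memLp_const (1 : ℝ)).indicator hΩo.measurableSet, fun i => MemLp.zero', fun i η hη => ?_⟩
    rw [← (hη.partialDeriv i).setIntegral_mul (Set.subset_univ B), setIntegral_univ]
    have : ∀ x, Ω.indicator (fun _ => (1 : ℝ)) x * partialDeriv i η x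
        = Ω.indicator (partialDeriv i η) x := fun x => by
      by_cases hx : x ∈ Ω <;> simp [hx]
    simp only [this]
    rw [integral_indicator hΩo.measurableSet, key i η hη]
    simp
  have hv := hG.variance_le hBo (convex_ball z r) hBb
    (fun x hx y hy => Metric.dist_le_diam_of_mem hBb hx hy)
  have e1 : normSq B (Ω.indicator fun _ => (1 : ℝ)) = volume.real (Ω ∩ B) := by
    have : ∀ x, Ω.indicator (fun _ => (1 : ℝ)) x ^ 2 = Ω.indicator (fun _ => (1 : ℝ)) x := fun x => by
      by_cases hx : x ∈ Ω <;> simp [hx]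
    simp only [normSq, this]
    rw [integral_indicator hΩo.measurableSet, Measure.restrict_restrict hΩo.measurableSet]
    simp
  have e2 : ∫ x in B, Ω.indicator (fun _ => (1 : ℝ)) x = volume.real (Ω ∩ B) := by
    rw [integral_indicator hΩo.measurableSet, Measure.restrict_restrict hΩo.measurableSet]
    simp
  have e3 : energy B (fun _ _ => 0) = 0 := by simp [energy, normSq]
  rw [e1, e2, e3] at hv
  rw [hΩo.frontier_eq] at hz
  have hlt := hBb.measure_lt_top (μ := volume)
  have hpos : ∀ {S : Set Plane}, IsOpen S → S ⊆ B → S.Nonempty → 0 < volume.real S :=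
    fun hS hSB hne => ENNReal.toReal_pos (hS.measure_pos volume hne).ne'
      ((measure_mono hSB).trans_lt hlt).ne
  have p1 : 0 < volume.real (Ω ∩ B) := by
    refine hpos (hΩo.inter hBo) Set.inter_subset_right ?_
    obtain ⟨y, hy, hyz⟩ := Metric.mem_closure_iff.1 hz.1 r hr
    exact ⟨y, hy, by rwa [hB, Metric.mem_ball, dist_comm]⟩
  have p2 : 0 < volume.real (B \ closure Ω) := by
    refine hpos (hBo.sdiff isClosed_closure) Set.sdiff_subset ?_
    by_contra hemp
    rw [Set.not_nonempty_iff_eq_empty, Set.sdiff_eq_empty] at hemp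
    exact hz.2 (hΩ ▸ interior_maximal hemp hBo (Metric.mem_ball_self hr))
  have p3 : volume.real (Ω ∩ B) + volume.real (B \ closure Ω) ≤ volume.real B := by
    rw [← measureReal_union (Set.disjoint_left.2 fun x hx hx' => hx'.2 (subset_closure hx.1))
      (hBo.sdiff isClosed_closure).measurableSet
      ((measure_mono Set.inter_subset_right).trans_lt hlt).ne
      ((measure_mono Set.sdiff_subset).trans_lt hlt).ne]
    exact measureReal_mono (Set.union_subset Set.inter_subset_right Set.sdiff_subset) hlt.ne
  nlinarith

end Vanishing

/-! ### Quadratic functions that vanish on the boundary of a polygonal domain -/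

section Quadratic

variable {Ω : Set Plane}

theorem subset_of_disjoint_frontier {S : Set Plane} (hS : IsPreconnected S) (hΩo : IsOpen Ω)
    (hne : (S ∩ Ω).Nonempty) (hd : Disjoint S (frontier Ω)) : S ⊆ Ω := by
  refine hS.subset_of_closure_inter_subset hΩo hne ?_
  rintro x ⟨hx, hxS⟩
  by_contra hxΩ
  exact Set.disjoint_left.1 hd hxS (by rw [hΩo.frontier_eq]; exact ⟨hx, hxΩ⟩)

/-- Removing finitely many points leaves the plane connected, so a finite frontier would force `Ω`
to fill the rest of the plane. -/
theorem frontier_infinite (hΩo : IsOpen Ω) (hne : Ω.Nonempty) (hb : Bornology.IsBounded Ω) :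
    (frontier Ω).Infinite := by
  intro hfin
  have hc : IsPreconnected (frontier Ω)ᶜ :=
    (hfin.countable.isPathConnected_compl_of_one_lt_rank (by
      rw [← Module.finrank_eq_rank, finrank_euclideanSpace_fin]
      exact_mod_cast one_lt_two)).isConnected.isPreconnected
  obtain ⟨x, hx⟩ := hne
  have hsub := subset_of_disjoint_frontier hc hΩo
    ⟨x, fun h => (hΩo.frontier_eq ▸ h).2 hx, hx⟩ disjoint_compl_left
  refine NormedSpace.unbounded_univ ℝ Plane (hb.closure.subset fun y _ => ?_)
  by_cases hy : y ∈ frontier Ω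
  · exact frontier_subset_closure hy
  · exact subset_closure (hsub hy)

theorem exists_pos_add_smul_mem_frontier (hΩo : IsOpen Ω) (hb : Bornology.IsBounded Ω) {x τ : Plane}
    (hx : x ∈ Ω) (hτ : τ ≠ 0) : ∃ t : ℝ, 0 < t ∧ x + t • τ ∈ frontier Ω := by
  by_contra! hno
  have hpc : IsPreconnected ((fun t : ℝ => x + t • τ) '' Set.Ici 0) :=
    isPreconnected_Ici.image _ (Continuous.continuousOn (by fun_prop))
  have hsub := subset_of_disjoint_frontier hpc hΩo ⟨x, ⟨0, by simp, by simp⟩, hx⟩ (by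
    rw [Set.disjoint_left]
    rintro _ ⟨t, ht, rfl⟩ hmem
    rcases (Set.mem_Ici.1 ht).eq_or_lt with h | h
    · subst h
      rw [hΩo.frontier_eq] at hmem
      exact hmem.2 (by simpa using hx)
    · exact hno t h hmem)
  obtain ⟨R, hR⟩ := hb.subset_closedBall x
  have hτ' : 0 < ‖τ‖ := norm_pos_iff.2 hτ
  have h := hR (hsub ⟨(|R| + 1) / ‖τ‖, Set.mem_Ici.2 (by positivity), rfl⟩)
  rw [Metric.mem_closedBall, dist_eq_norm, add_sub_cancel_left, norm_smul, Real.norm_eq_abs,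
    abs_of_nonneg (by positivity), div_mul_cancel₀ _ hτ'.ne'] at h
  linarith [le_abs_self R]

theorem quadFun_add_smul (α : ℝ) (G : Fin 2 → ℝ) (A : Fin 2 → Fin 2 → ℝ) (x τ : Plane) :
    ∃ β : ℝ, ∀ t : ℝ, quadFun α G A (x + t • τ)
      = quadFun α G A x + β * t + 1 / 2 * (∑ i, ∑ j, A i j * (τ i * τ j)) * t ^ 2 := by
  refine ⟨∑ i, G i * τ i + 1 / 2 * ∑ i, ∑ j, A i j * (x i * τ j + τ i * x j), fun t => ?_⟩
  simp only [quadFun, affineFun, Fin.sum_univ_two, PiLp.add_apply, PiLp.smul_apply, smul_eq_mul]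
  ring

theorem finite_setOf_quadratic_eq_zero {a b c : ℝ} (ha : a ≠ 0) :
    {t : ℝ | c + b * t + a * t ^ 2 = 0}.Finite := by
  have hp : Polynomial.C a * Polynomial.X ^ 2 + Polynomial.C b * Polynomial.X + Polynomial.C c ≠ 0 := by
    intro h
    have := congrArg (fun p => Polynomial.coeff p 2) h
    simp at this
    exact ha this
  refine (Polynomial.finite_setOfPred_isRoot hp).subset fun t ht => ?_
  have ht' : c + b * t + a * t ^ 2 = 0 := ht
  simp only [Set.mem_ofPred_eq, Polynomial.IsRoot.def, Polynomial.eval_add, Polynomial.eval_mul,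
    Polynomial.eval_C, Polynomial.eval_pow, Polynomial.eval_X]
  linarith

/-- A point of the triangle with all barycentric coordinates positive is interior. Otherwise one
vanishes and the point lies on the line through two vertices, which is all that is needed. -/
theorem IsTriangle.exists_eq_add_smul {K : Finset Plane} (hK : IsTriangle K) {x : Plane}
    (hx : x ∈ elem K) (hxi : x ∉ interior (elem K)) :
    ∃ p ∈ K, ∃ q ∈ K, p ≠ q ∧ ∃ t : ℝ, x = p + t • (q - p) := by
  obtain ⟨a, b, c, hab, hac, hbc, hKe⟩ := Finset.card_eq_three.1 hK.1
  have hKc : (K : Set Plane) = {a, b, c} := by rw [hKe]; simp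
  have ha : a ∈ K := by simp [hKe]
  have hb : b ∈ K := by simp [hKe]
  have hc : c ∈ K := by simp [hKe]
  have hl := hK.linearIndependent hKc
  set B := basisOfLinearIndependentOfCardEqFinrank hl (by simp) with hB
  have hBc : ⇑B = ![a - c, b - c] := coe_basisOfLinearIndependentOfCardEqFinrank hl (by simp)
  set s : Plane → ℝ := fun y => B.coord 0 (y - c) with hs
  set t : Plane → ℝ := fun y => B.coord 1 (y - c) with ht
  have hsc : Continuous s := (LinearMap.continuous_of_finiteDimensional _).comp (by fun_prop)
  have htc : Continuous t := (LinearMap.continuous_of_finiteDimensional _).comp (by fun_prop)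
  have hrep : ∀ y, y = c + s y • (a - c) + t y • (b - c) := by
    intro y
    have := B.sum_repr (y - c)
    rw [Fin.sum_univ_two, hBc] at this
    simp only [Matrix.cons_val_zero, Matrix.cons_val_one] at this
    rw [add_assoc]
    exact (sub_eq_iff_eq_add'.1 this.symm)
  have hmem : ∀ y, y ∈ elem K ↔ 0 ≤ s y ∧ 0 ≤ t y ∧ s y + t y ≤ 1 := by
    intro y
    rw [elem_eq_convexHull hKc, mem_convexHull_triple]
    constructor
    · rintro ⟨z, w, h0, h1, h2, h3⟩
      have h4 : (s y - (z - w)) • (a - c) + (t y - w) • (b - c) = 0 := by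
        have h5 : c + s y • (a - c) + t y • (b - c) - (c + z • (a - c) + w • (b - a)) = 0 := by
          rw [← hrep y, ← h3, sub_self]
        rw [← h5]
        module
      obtain ⟨h6, h7⟩ := LinearIndependent.pair_iff.1 hl _ _ h4
      refine ⟨by linarith, by linarith, by linarith⟩
    · rintro ⟨h0, h1, h2⟩
      refine ⟨s y + t y, t y, h1, by linarith, h2, ?_⟩
      conv_lhs => rw [hrep y]
      module
  have hopen : IsOpen {y | 0 < s y ∧ 0 < t y ∧ s y + t y < 1} :=
    (isOpen_lt continuous_const hsc).inter ((isOpen_lt continuous_const htc).inter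
      (isOpen_lt (hsc.add htc) continuous_const))
  have hsub : {y | 0 < s y ∧ 0 < t y ∧ s y + t y < 1} ⊆ interior (elem K) :=
    interior_maximal (fun y hy => (hmem y).2 ⟨hy.1.le, hy.2.1.le, hy.2.2.le⟩) hopen
  obtain ⟨h0, h1, h2⟩ := (hmem x).1 hx
  have hx' := hrep x
  rcases h0.eq_or_lt with e | h0
  · refine ⟨c, hc, b, hb, hbc.symm, t x, ?_⟩
    rwa [← e, zero_smul, add_zero] at hx'
  rcases h1.eq_or_lt with e | h1
  · refine ⟨c, hc, a, ha, hac.symm, s x, ?_⟩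
    rwa [← e, zero_smul, add_zero] at hx'
  rcases h2.eq_or_lt with e | h2
  · refine ⟨a, ha, b, hb, hab, t x, ?_⟩
    rw [← eq_sub_iff_add_eq] at e
    rw [e] at hx'
    refine hx'.trans ?_
    module
  · exact absurd (hsub ⟨h0, h1, h2⟩) hxi

theorem Triangulation.exists_frontier_eq_add_smul (T : Triangulation Ω) (hΩo : IsOpen Ω)
    (hΩ : interior (closure Ω) = Ω) {z : Plane} (hz : z ∈ frontier Ω) :
    ∃ K ∈ T.elems, ∃ p ∈ K, ∃ q ∈ K, p ≠ q ∧ ∃ t : ℝ, z = p + t • (q - p) := by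
  rw [hΩo.frontier_eq] at hz
  have h1 := hz.1
  rw [← T.cover] at h1
  simp only [Set.mem_iUnion, exists_prop] at h1
  obtain ⟨K, hK, hzK⟩ := h1
  exact ⟨K, hK, (T.isTriangle K hK).exists_eq_add_smul hzK
    fun h => hz.2 (T.interior_elem_subset hΩ hK h)⟩

/-- If `τ ≠ 0` is isotropic for `A`, the quadratic is affine along lines in direction `τ` and
vanishes at frontier points on both sides of any `x` in `Ω`. If there is no such `τ`, it has
finitely many zeros on each edge line; these finitely many lines contain the frontier, which would
then be finite. -/
theorem Triangulation.quadFun_eq_zero (T : Triangulation Ω) (hΩo : IsOpen Ω) (hne : Ω.Nonempty)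
    (hb : Bornology.IsBounded Ω) (hΩ : interior (closure Ω) = Ω) {α : ℝ} {G : Fin 2 → ℝ}
    {A : Fin 2 → Fin 2 → ℝ} (h : ∀ z ∈ frontier Ω, quadFun α G A z = 0) :
    ∀ x ∈ Ω, quadFun α G A x = 0 := by
  by_cases hiso : ∃ τ : Plane, τ ≠ 0 ∧ ∑ i, ∑ j, A i j * (τ i * τ j) = 0
  · obtain ⟨τ, hτ, hA⟩ := hiso
    intro x hx
    obtain ⟨β, hβ⟩ := quadFun_add_smul α G A x τ
    obtain ⟨t, ht, h1⟩ := exists_pos_add_smul_mem_frontier hΩo hb hx hτ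
    obtain ⟨s, hs, h2⟩ := exists_pos_add_smul_mem_frontier hΩo hb hx (neg_ne_zero.2 hτ)
    have e1 := h _ h1
    have e2 := h _ h2
    rw [smul_neg, ← neg_smul] at e2
    rw [hβ, hA] at e1 e2
    have : β * (t + s) = 0 := by linarith
    have hβ0 : β = 0 := (mul_eq_zero.1 this).resolve_right (by positivity)
    rw [hβ0] at e1
    linarith
  · push Not at hiso
    refine absurd ?_ (frontier_infinite hΩo hne hb)
    have hfin : (⋃ K ∈ T.elems, ⋃ p ∈ K, ⋃ q ∈ K, ⋃ (_ : p ≠ q),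
        (fun t : ℝ => p + t • (q - p)) '' {t | quadFun α G A (p + t • (q - p)) = 0}).Finite := by
      refine T.elems.finite_toSet.biUnion fun K _ => K.finite_toSet.biUnion fun p _ =>
        K.finite_toSet.biUnion fun q _ => Set.finite_iUnion fun hpq => Set.Finite.image _ ?_
      obtain ⟨β, hβ⟩ := quadFun_add_smul α G A p (q - p)
      simp only [hβ]
      exact finite_setOf_quadratic_eq_zero
        (mul_ne_zero (by norm_num) (hiso _ (sub_ne_zero.2 (Ne.symm hpq))))
    refine hfin.subset fun z hz => ?_
    obtain ⟨K, hK, p, hp, q, hq, hpq, t, rfl⟩ := T.exists_frontier_eq_add_smul hΩo hΩ hz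
    simp only [Set.mem_iUnion]
    exact ⟨K, hK, p, hp, q, hq, hpq, t, h _ hz, rfl⟩

theorem partialDeriv_eq_zero_of_eqOn (hΩo : IsOpen Ω) {f : Plane → ℝ} (h : ∀ x ∈ Ω, f x = 0)
    (i : Fin 2) : ∀ x ∈ Ω, partialDeriv i f x = 0 := by
  intro x hx
  have : f =ᶠ[𝓝 x] fun _ => 0 := Filter.mem_of_superset (hΩo.mem_nhds hx) h
  rw [partialDeriv, this.fderiv_eq]
  simp

theorem quadFun_coeff_eq_zero (hΩo : IsOpen Ω) (hne : Ω.Nonempty) {α : ℝ} {G : Fin 2 → ℝ}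
    {A : Fin 2 → Fin 2 → ℝ} (hA : ∀ i j, A i j = A j i) (h : ∀ x ∈ Ω, quadFun α G A x = 0) :
    α = 0 ∧ G = 0 ∧ A = 0 := by
  obtain ⟨x, hx⟩ := hne
  have h1 : ∀ i, ∀ x ∈ Ω, affineFun (G i) (A i) x = 0 := fun i => by
    rw [← partialDeriv_quadFun α G hA]
    exact partialDeriv_eq_zero_of_eqOn hΩo h i
  have hA0 : A = 0 := by
    funext i j
    have := partialDeriv_eq_zero_of_eqOn hΩo (h1 i) j x hx
    rwa [partialDeriv_affineFun] at this
  have hG0 : G = 0 := by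
    funext i
    have := h1 i x hx
    simpa [affineFun, hA0] using this
  refine ⟨?_, hG0, hA0⟩
  have := h x hx
  simpa [quadFun, affineFun, hA0, hG0] using this

end Quadratic

/-! ### Lower order semi-norms are bounded by the semi-norm of order three -/

section LowerOrder

variable {Ω : Set Plane}

/-- The squared norm of `H¹` of a function `f` with gradient `g`. -/
def hOneSq (Ω : Set Plane) (f : Plane → ℝ) (g : Fin 2 → Plane → ℝ) : ℝ := normSq Ω f + energy Ω g

theorem hOneSq_nonneg (Ω : Set Plane) (f : Plane → ℝ) (g : Fin 2 → Plane → ℝ) :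
    0 ≤ hOneSq Ω f g := add_nonneg (normSq_nonneg _ _) (energy_nonneg _ _)

theorem energy_add_le {g g' : Fin 2 → Plane → ℝ} (hg : ∀ i, MemLp (g i) 2 (volume.restrict Ω))
    (hg' : ∀ i, MemLp (g' i) 2 (volume.restrict Ω)) :
    energy Ω (fun i x => g i x + g' i x) ≤ 2 * energy Ω g + 2 * energy Ω g' := by
  unfold energy
  rw [Finset.mul_sum, Finset.mul_sum, ← Finset.sum_add_distrib]
  exact Finset.sum_le_sum fun i _ => normSq_add_le (hg i) (hg' i)

theorem HasGrad.hOneSq_add_le {f f' : Plane → ℝ} {g g' : Fin 2 → Plane → ℝ} (h : HasGrad Ω f g)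
    (h' : HasGrad Ω f' g') : hOneSq Ω (fun x => f x + f' x) (fun i x => g i x + g' i x)
      ≤ 2 * hOneSq Ω f g + 2 * hOneSq Ω f' g' := by
  have h1 := normSq_add_le h.memLp h'.memLp
  have h2 := energy_add_le h.grad_memLp h'.grad_memLp
  unfold hOneSq
  linarith

theorem normSq_const_mul (f : Plane → ℝ) (c : ℝ) :
    normSq Ω (fun x => c * f x) = c ^ 2 * normSq Ω f := by
  simp only [normSq, mul_pow, integral_const_mul]

theorem hOneSq_const_mul (f : Plane → ℝ) (g : Fin 2 → Plane → ℝ) (c : ℝ) :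
    hOneSq Ω (fun x => c * f x) (fun i x => c * g i x) = c ^ 2 * hOneSq Ω f g := by
  simp only [hOneSq, energy, normSq_const_mul, Fin.sum_univ_two]
  ring

theorem normSq_le_of_abs_le (hb : Bornology.IsBounded Ω) {f : Plane → ℝ}
    {B : ℝ} (h : ∀ x ∈ Ω, |f x| ≤ B) : normSq Ω f ≤ volume.real Ω * B ^ 2 := by
  have := norm_setIntegral_le_of_norm_le_const (μ := volume) (f := fun x => f x ^ 2) (C := B ^ 2)
    hb.measure_lt_top fun x hx => by
      rw [Real.norm_eq_abs, abs_pow]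
      exact pow_le_pow_left₀ (abs_nonneg _) (h x hx) 2
  exact (le_abs_self _).trans (this.trans_eq (mul_comm _ _))

/-- Coefficients of quadratic functions. -/
abbrev QuadCoeff : Type := ℝ × (Fin 2 → ℝ) × (Fin 2 → Fin 2 → ℝ)

namespace QuadCoeff

/-- The quadratic function with the given coefficients. -/
def toFun (p : QuadCoeff) : Plane → ℝ := quadFun p.1 p.2.1 p.2.2

/-- The gradient of a quadratic function with a symmetric matrix. -/
def grad (p : QuadCoeff) (i : Fin 2) : Plane → ℝ := affineFun (p.2.1 i) (p.2.2 i)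

/-- The coefficient matrix is symmetric. -/
def Symm (p : QuadCoeff) : Prop := ∀ i j, p.2.2 i j = p.2.2 j i

variable {p : QuadCoeff}

theorem Symm.hasGrad (hp : p.Symm) (hb : Bornology.IsBounded Ω) : HasGrad Ω p.toFun p.grad :=
  hasGrad_quadFun hb _ _ hp

theorem toFun_sub (p p' : QuadCoeff) (x : Plane) : (p - p').toFun x = p.toFun x - p'.toFun x := by
  simp only [toFun, quadFun, affineFun, Fin.sum_univ_two, Prod.fst_sub, Prod.snd_sub, Pi.sub_apply]
  ring

theorem grad_sub (p p' : QuadCoeff) (i : Fin 2) (x : Plane) :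
    (p - p').grad i x = p.grad i x - p'.grad i x := by
  simp only [grad, affineFun, Fin.sum_univ_two, Prod.fst_sub, Prod.snd_sub, Pi.sub_apply]
  ring

theorem toFun_smul (c : ℝ) (p : QuadCoeff) (x : Plane) : (c • p).toFun x = c * p.toFun x := by
  simp only [toFun, quadFun, affineFun, Fin.sum_univ_two, Prod.smul_fst, Prod.smul_snd,
    Pi.smul_apply, smul_eq_mul]
  ring

theorem grad_smul (c : ℝ) (p : QuadCoeff) (i : Fin 2) (x : Plane) :
    (c • p).grad i x = c * p.grad i x := by
  simp only [grad, affineFun, Fin.sum_univ_two, Prod.smul_fst, Prod.smul_snd,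
    Pi.smul_apply, smul_eq_mul]
  ring

theorem abs_fst_le (p : QuadCoeff) : |p.1| ≤ ‖p‖ := norm_fst_le p

theorem abs_linear_le (p : QuadCoeff) (i : Fin 2) : |p.2.1 i| ≤ ‖p‖ :=
  (norm_le_pi_norm p.2.1 i).trans ((norm_fst_le p.2).trans (norm_snd_le p))

theorem abs_matrix_le (p : QuadCoeff) (i j : Fin 2) : |p.2.2 i j| ≤ ‖p‖ :=
  ((norm_le_pi_norm (p.2.2 i) j).trans (norm_le_pi_norm p.2.2 i)).trans
    ((norm_snd_le p.2).trans (norm_snd_le p))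

theorem exists_hOneSq_le (hb : Bornology.IsBounded Ω) :
    ∃ M, 0 ≤ M ∧ ∀ p : QuadCoeff, hOneSq Ω p.toFun p.grad ≤ M * ‖p‖ ^ 2 := by
  obtain ⟨R, hR⟩ := hb.subset_closedBall 0
  have hx : ∀ x ∈ Ω, ∀ i, |x i| ≤ |R| := by
    intro x hx i
    have h1 := hR hx
    rw [mem_closedBall_zero_iff] at h1
    exact (PiLp.norm_apply_le x i).trans (h1.trans (le_abs_self R))
  set r := |R|
  have hr : 0 ≤ r := abs_nonneg R
  refine ⟨volume.real Ω * (1 + 2 * r + 2 * r ^ 2) ^ 2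
    + 2 * (volume.real Ω * (1 + 2 * r) ^ 2), by positivity, fun p => ?_⟩
  have haff : ∀ (α : ℝ) (G : Fin 2 → ℝ), |α| ≤ ‖p‖ → (∀ i, |G i| ≤ ‖p‖) → ∀ x ∈ Ω,
      |affineFun α G x| ≤ (1 + 2 * r) * ‖p‖ := by
    intro α G h0 h1 x hxΩ
    have e : ∀ i, |G i * x i| ≤ ‖p‖ * r := fun i => by
      rw [abs_mul]; exact mul_le_mul (h1 i) (hx x hxΩ i) (abs_nonneg _) (norm_nonneg _)
    have := abs_add_le α (∑ i, G i * x i)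
    have := abs_add_le (G 0 * x 0) (G 1 * x 1)
    have := e 0
    have := e 1
    rw [affineFun]
    rw [Fin.sum_univ_two] at *
    linarith
  have h1 : normSq Ω p.toFun ≤ volume.real Ω * ((1 + 2 * r + 2 * r ^ 2) * ‖p‖) ^ 2 := by
    refine normSq_le_of_abs_le hb fun x hxΩ => ?_
    have e : ∀ i j, |p.2.2 i j * (x i * x j)| ≤ ‖p‖ * (r * r) := fun i j => by
      rw [abs_mul, abs_mul]
      exact mul_le_mul (abs_matrix_le p i j) (mul_le_mul (hx x hxΩ i) (hx x hxΩ j) (abs_nonneg _) hr)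
        (by positivity) (norm_nonneg _)
    have e0 := haff _ _ (abs_fst_le p) (abs_linear_le p) x hxΩ
    have e1 : |∑ i, ∑ j, p.2.2 i j * (x i * x j)| ≤ 4 * (‖p‖ * (r * r)) := by
      have h2 := (Finset.abs_sum_le_sum_abs (fun i => ∑ j, p.2.2 i j * (x i * x j))
        Finset.univ).trans (Finset.sum_le_sum fun i _ => (Finset.abs_sum_le_sum_abs _ _).trans
          (Finset.sum_le_sum fun j _ => e i j))
      refine h2.trans (le_of_eq ?_)
      simp only [Finset.sum_const, Finset.card_univ, Fintype.card_fin, nsmul_eq_mul]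
      norm_num
      ring
    rw [toFun, quadFun]
    refine (abs_add_le _ _).trans ?_
    rw [abs_mul, abs_of_pos (by norm_num : (0 : ℝ) < 1 / 2)]
    linarith
  have h2 : ∀ i, normSq Ω (p.grad i) ≤ volume.real Ω * ((1 + 2 * r) * ‖p‖) ^ 2 := fun i =>
    normSq_le_of_abs_le hb fun x hxΩ =>
      haff _ _ (abs_linear_le p i) (abs_matrix_le p i) x hxΩ
  have := h2 0
  have := h2 1
  rw [hOneSq, energy, Fin.sum_univ_two]
  linarith

end QuadCoeff

/-- Compactness in the finite-dimensional space of coefficients. Counterexamples with constants `n +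
1`, scaled to unit norm, accumulate at a unit `a` whose quadratic is an `H¹` limit of test
functions. It vanishes on the frontier, hence on `Ω`, so `a = 0`, a contradiction. -/
theorem Triangulation.exists_norm_quadCoeff_sq_le (T : Triangulation Ω) (hΩo : IsOpen Ω)
    (hne : Ω.Nonempty) (hb : Bornology.IsBounded Ω) (hΩ : interior (closure Ω) = Ω) :
    ∃ C, 0 ≤ C ∧ ∀ p : QuadCoeff, p.Symm → ∀ φ, IsTestFunction Ω φ → ‖p‖ ^ 2 ≤ C *
      hOneSq Ω (fun x => p.toFun x - φ x) (fun i x => p.grad i x - partialDeriv i φ x) := by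
  by_contra! hno
  choose p hp φ hφ hlt using fun n : ℕ => hno ((n : ℝ) + 1) (by positivity)
  have hpos : ∀ n, 0 < ‖p n‖ := by
    intro n
    have h1 := hlt n
    have h2 := hOneSq_nonneg Ω (fun x => (p n).toFun x - φ n x)
      (fun i x => (p n).grad i x - partialDeriv i (φ n) x)
    have h3 : 0 < ‖p n‖ ^ 2 := lt_of_le_of_lt (by positivity) h1
    exact (norm_nonneg _).lt_of_ne' (sq_pos_iff.1 h3)
  set p' : ℕ → QuadCoeff := fun n => ‖p n‖⁻¹ • p n with hp'
  set φ' : ℕ → Plane → ℝ := fun n x => ‖p n‖⁻¹ * φ n x with hφ'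
  have hpd : ∀ n i x, partialDeriv i (fun x => ‖p n‖⁻¹ * φ n x) x = ‖p n‖⁻¹ * partialDeriv i (φ n) x := by
    intro n i x
    rw [partialDeriv, fderiv_const_mul ((hφ n).1.differentiable (by simp) x)]
    rfl
  have hφ't : ∀ n, IsTestFunction Ω (φ' n) := fun n =>
    ⟨contDiff_const.mul (hφ n).1, (hφ n).2.1.mul_left,
      (closure_mono (Function.support_mul_subset_right _ _)).trans (hφ n).2.2⟩
  set D : ℕ → ℝ := fun n => hOneSq Ω (fun x => (p' n).toFun x - φ' n x)
      (fun i x => (p' n).grad i x - partialDeriv i (φ' n) x) with hD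
  have hD1 : ∀ n, D n ≤ 1 / ((n : ℝ) + 1) := by
    intro n
    have e : D n = (‖p n‖⁻¹) ^ 2 * hOneSq Ω (fun x => (p n).toFun x - φ n x)
        (fun i x => (p n).grad i x - partialDeriv i (φ n) x) := by
      rw [← hOneSq_const_mul]
      simp only [hD, hp', hpd, hφ', QuadCoeff.toFun_smul, QuadCoeff.grad_smul, mul_sub]
    rw [e, le_div_iff₀ (by positivity), inv_pow, inv_mul_eq_div, div_mul_eq_mul_div,
      div_le_one (by have := hpos n; positivity), mul_comm]
    exact (hlt n).le
  have hsphere : ∀ n, p' n ∈ Metric.sphere (0 : QuadCoeff) 1 := by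
    intro n
    rw [mem_sphere_zero_iff_norm, hp', norm_smul, norm_inv, norm_norm,
      inv_mul_cancel₀ (hpos n).ne']
  obtain ⟨a, ha, ns, hns, hlim⟩ := (isCompact_sphere (0 : QuadCoeff) 1).tendsto_subseq hsphere
  have hp's : ∀ n, (p' n).Symm := fun n i j => by
    simp only [hp', Prod.smul_snd, Pi.smul_apply, hp n i j]
  have has : a.Symm := by
    intro i j
    have hc : ∀ i j, Tendsto (fun n => (p' (ns n)).2.2 i j) atTop (𝓝 (a.2.2 i j)) := fun i j =>
      ((by fun_prop : Continuous fun p : QuadCoeff => p.2.2 i j).tendsto a).comp hlim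
    exact tendsto_nhds_unique (hc i j) ((hc j i).congr fun n => hp's (ns n) j i)
  obtain ⟨M, hM0, hM⟩ := QuadCoeff.exists_hOneSq_le hb
  have hle : ∀ n, hOneSq Ω (fun x => a.toFun x - φ' (ns n) x)
      (fun i x => a.grad i x - partialDeriv i (φ' (ns n)) x)
        ≤ 2 * (M * ‖a - p' (ns n)‖ ^ 2) + 2 * D (ns n) := by
    intro n
    have hsub : (a - p' (ns n)).Symm := fun i j => by
      simp only [Prod.snd_sub, Pi.sub_apply, has i j, hp's (ns n) i j]
    have h1 := (hsub.hasGrad hb).hOneSq_add_le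
      (((hp's (ns n)).hasGrad hb).sub (hasGrad_of_contDiff hb (hφ't (ns n)).1))
    simp only [QuadCoeff.toFun_sub, QuadCoeff.grad_sub, sub_add_sub_cancel] at h1
    exact h1.trans (add_le_add (mul_le_mul_of_nonneg_left (hM _) zero_le_two) le_rfl)
  have hzero : Tendsto (fun n => hOneSq Ω (fun x => a.toFun x - φ' (ns n) x)
      (fun i x => a.grad i x - partialDeriv i (φ' (ns n)) x)) atTop (𝓝 0) := by
    have t1 : Tendsto (fun n => ‖a - p' (ns n)‖) atTop (𝓝 0) := by
      have := (tendsto_const_nhds (x := a)).sub hlim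
      rw [sub_self] at this
      simpa using this.norm
    have t2 : Tendsto (fun n => D (ns n)) atTop (𝓝 0) :=
      (squeeze_zero (fun n => hOneSq_nonneg _ _ _) hD1 tendsto_one_div_add_atTop_nhds_zero_nat).comp
        hns.tendsto_atTop
    have t3 := (((t1.pow 2).const_mul M).const_mul 2).add (t2.const_mul 2)
    simp only [ne_eq, OfNat.ofNat_ne_zero, not_false_eq_true, zero_pow, mul_zero, add_zero] at t3
    exact squeeze_zero (fun n => hOneSq_nonneg _ _ _) hle t3
  have z1 : Tendsto (fun n => ∫ x in Ω, (a.toFun x - φ' (ns n) x) ^ 2) atTop (𝓝 0) :=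
    squeeze_zero (fun n => normSq_nonneg _ _)
      (fun n => le_add_of_nonneg_right (energy_nonneg _ _)) hzero
  have z2 : ∀ i, Tendsto (fun n => ∫ x in Ω,
      (partialDeriv i a.toFun x - partialDeriv i (φ' (ns n)) x) ^ 2) atTop (𝓝 0) := by
    intro i
    rw [QuadCoeff.toFun, partialDeriv_quadFun _ _ has]
    refine squeeze_zero (fun n => integral_nonneg fun x => sq_nonneg _) (fun n => ?_) hzero
    have h1 := Finset.single_le_sum (f := fun i => normSq Ω fun x => a.grad i x -
      partialDeriv i (φ' (ns n)) x) (fun i _ => normSq_nonneg _ _) (Finset.mem_univ i)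
    exact h1.trans (le_add_of_nonneg_left (normSq_nonneg _ _))
  have hfr : ∀ z ∈ frontier Ω, a.toFun z = 0 := fun z hz =>
    eq_zero_of_mem_frontier hΩo hb hΩ (contDiff_quadFun _ _ _) (fun n => hφ't (ns n)) z1 z2 hz
  obtain ⟨h1, h2, h3⟩ := quadFun_coeff_eq_zero hΩo hne has
    (T.quadFun_eq_zero hΩo hne hb hΩ hfr)
  have : a = 0 := Prod.ext h1 (Prod.ext h2 h3)
  rw [this] at ha
  simp at ha

/-- Among all constants the mean is the best `L²` approximation. -/
theorem PoincareOn.normSq_sub_average_le (h : PoincareOn Ω Ω) (hb : Bornology.IsBounded Ω)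
    (hV : 0 < volume.real Ω) : ∃ C, 0 ≤ C ∧ ∀ f g, HasGrad Ω f g →
      normSq Ω (fun x => f x - ⨍ y in Ω, f y) ≤ C * energy Ω g := by
  obtain ⟨C, hC, h⟩ := h
  refine ⟨C, hC, fun f g hf => ?_⟩
  obtain ⟨c, hc⟩ := h f g hf
  refine le_trans ?_ hc
  unfold normSq
  rw [integral_sub_const_sq hb hf.memLp, integral_sub_const_sq hb hf.memLp]
  have e : ⨍ y in Ω, f y = (volume.real Ω)⁻¹ * ∫ y in Ω, f y := by
    rw [setAverage_eq, smul_eq_mul]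
  have e' : ∫ y in Ω, f y = (⨍ y in Ω, f y) * volume.real Ω := by
    rw [e]; field_simp
  rw [e']
  nlinarith [mul_nonneg (sq_nonneg (c - ⨍ y in Ω, f y)) hV.le]

/-- Choose the quadratic `p` from the top down: mean Hessian, then mean of the remaining gradient,
then mean of the remaining function. Poincaré's inequality at each stage bounds `u - p` by third
derivatives, and approximation of `u` by test functions bounds `p` itself. -/
theorem Triangulation.exists_energy_add_energy₂_le (T : Triangulation Ω) (hΩo : IsOpen Ω)
    (hΩc : IsConnected Ω) (hb : Bornology.IsBounded Ω) (hΩ : interior (closure Ω) = Ω) :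
    ∃ C, 0 ≤ C ∧ ∀ (u : Plane → ℝ) (g : Fin 2 → Plane → ℝ) (H : Fin 2 → Fin 2 → Plane → ℝ)
      (S : Fin 2 → Fin 2 → Fin 2 → Plane → ℝ), HasGrad Ω u g → (∀ i, HasGrad Ω (g i) (H i)) →
      (∀ i j, HasGrad Ω (H i j) (S i j)) → (∀ i j, H i j = H j i) →
      ∀ φ : ℕ → Plane → ℝ, (∀ n, IsTestFunction Ω (φ n)) →
      Tendsto (fun n => ∫ x in Ω, (u x - φ n x) ^ 2) atTop (𝓝 0) →
      (∀ i, Tendsto (fun n => ∫ x in Ω, (g i x - partialDeriv i (φ n) x) ^ 2) atTop (𝓝 0)) →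
      energy Ω g + energy₂ Ω H ≤ C * energy₃ Ω S := by
  have hne := hΩc.nonempty
  have hV : 0 < volume.real Ω :=
    ENNReal.toReal_pos (hΩo.measure_pos volume hne).ne' hb.measure_lt_top.ne
  have hfin := isFiniteMeasure_restrict_of_isBounded hb
  obtain ⟨P, hP0, hP⟩ := (T.poincareOn hΩo hΩc hb hΩ).normSq_sub_average_le hb hV
  obtain ⟨Q, hQ0, hQ⟩ := T.exists_norm_quadCoeff_sq_le hΩo hne hb hΩ
  obtain ⟨M, hM0, hM⟩ := QuadCoeff.exists_hOneSq_le hb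
  refine ⟨2 * (P * P) + 2 * P + (2 * M + 8 * volume.real Ω) * (Q * (2 * (P * (P * P) + P * P))),
    by positivity, fun u g H S hu hg hH hsymm φ hφ h1 h2 => ?_⟩
  set E := energy₃ Ω S with hE
  set A : Fin 2 → Fin 2 → ℝ := fun i j => ⨍ x in Ω, H i j x with hA
  have hAs : ∀ i j, A i j = A j i := fun i j => by simp only [hA, hsymm i j]
  have kH : ∑ i, ∑ j, normSq Ω (fun x => H i j x - A i j) ≤ P * E := by
    simp only [hE, energy₃, energy₂, Finset.mul_sum]
    refine Finset.sum_le_sum fun i _ => Finset.sum_le_sum fun j _ => ?_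
    exact hP _ _ (hH i j)
  have hg0 : ∀ i, HasGrad Ω (fun x => g i x - affineFun 0 (A i) x) (fun j x => H i j x - A i j) :=
    fun i => (hg i).sub (hasGrad_affineFun hb 0 (A i))
  set G : Fin 2 → ℝ := fun i => ⨍ x in Ω, (g i x - affineFun 0 (A i) x) with hG
  have eaff : ∀ i x, affineFun (G i) (A i) x = affineFun 0 (A i) x + G i := fun i x => by
    simp only [affineFun]; ring
  have kg : energy Ω (fun i x => g i x - affineFun (G i) (A i) x) ≤ P * (P * E) := by
    refine le_trans ?_ (mul_le_mul_of_nonneg_left kH hP0)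
    rw [energy, Finset.mul_sum]
    refine Finset.sum_le_sum fun i _ => ?_
    simp only [eaff, ← sub_sub]
    exact hP _ _ (hg0 i)
  have hu0 : HasGrad Ω (fun x => u x - quadFun 0 G A x) (fun i x => g i x - affineFun (G i) (A i) x) :=
    hu.sub (hasGrad_quadFun hb 0 G hAs)
  set α : ℝ := ⨍ x in Ω, (u x - quadFun 0 G A x) with hα
  have equad : ∀ x, quadFun α G A x = quadFun 0 G A x + α := fun x => by
    simp only [quadFun, affineFun]; ring
  have ku : normSq Ω (fun x => u x - quadFun α G A x) ≤ P * (P * (P * E)) := by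
    refine le_trans ?_ (mul_le_mul_of_nonneg_left kg hP0)
    simp only [equad, ← sub_sub]
    exact hP _ _ hu0
  set p : QuadCoeff := (α, G, A) with hp
  have hps : p.Symm := hAs
  have hr : HasGrad Ω (fun x => u x - p.toFun x) (fun i x => g i x - p.grad i x) :=
    hu.sub (hps.hasGrad hb)
  have kr : hOneSq Ω (fun x => u x - p.toFun x) (fun i x => g i x - p.grad i x)
      ≤ (P * (P * P) + P * P) * E := by
    have : (P * (P * P) + P * P) * E = P * (P * (P * E)) + P * (P * E) := by ring
    rw [this]
    exact add_le_add ku kg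
  have kp : ‖p‖ ^ 2 ≤ Q * (2 * (P * (P * P) + P * P)) * E := by
    -- The distance from `p` to `φ n` is estimated through `u`; the term with `u - φ n` disappears
    -- in the limit.
    have hN : ∀ n, ‖p‖ ^ 2 ≤ Q * (2 * hOneSq Ω (fun x => u x - p.toFun x) (fun i x => g i x - p.grad i x)
        + 2 * hOneSq Ω (fun x => u x - φ n x) (fun i x => g i x - partialDeriv i (φ n) x)) := by
      intro n
      refine (hQ p hps (φ n) (hφ n)).trans (mul_le_mul_of_nonneg_left ?_ hQ0)
      have h3 := (hr.const_mul (-1)).hOneSq_add_le (hu.sub (hasGrad_of_contDiff hb (hφ n).1))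
      rw [hOneSq_const_mul] at h3
      have e1 : ∀ x, -1 * (u x - p.toFun x) + (u x - φ n x) = p.toFun x - φ n x := fun x => by ring
      have e2 : ∀ i x, -1 * (g i x - p.grad i x) + (g i x - partialDeriv i (φ n) x)
        = p.grad i x - partialDeriv i (φ n) x := fun i x => by ring
      simp only [e1, e2] at h3
      linarith
    have hlim : Tendsto (fun n => hOneSq Ω (fun x => u x - φ n x)
        (fun i x => g i x - partialDeriv i (φ n) x)) atTop (𝓝 0) := by
      have := h1.add (tendsto_finsetSum Finset.univ fun i _ => h2 i)
      simpa [hOneSq, energy, normSq] using this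
    have h4 := ge_of_tendsto' (((hlim.const_mul 2).const_add (2 * hOneSq Ω (fun x => u x - p.toFun x)
      (fun i x => g i x - p.grad i x))).const_mul Q) hN
    rw [mul_zero, add_zero] at h4
    refine h4.trans ?_
    rw [mul_assoc, mul_assoc]
    exact mul_le_mul_of_nonneg_left (by linarith) hQ0
  have k1 : energy Ω g ≤ 2 * (P * (P * E)) + 2 * (M * ‖p‖ ^ 2) := by
    have h3 := energy_add_le hr.grad_memLp (hps.hasGrad hb).grad_memLp
    simp only [sub_add_cancel] at h3
    have h4 : energy Ω p.grad ≤ M * ‖p‖ ^ 2 :=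
      (le_add_of_nonneg_left (normSq_nonneg _ _)).trans (hM p)
    have h5 : energy Ω (fun i x => g i x - p.grad i x) ≤ P * (P * E) := kg
    have h6 : energy Ω g ≤ 2 * energy Ω (fun i x => g i x - p.grad i x) + 2 * energy Ω p.grad := h3
    linarith
  have k2 : energy₂ Ω H ≤ 2 * (P * E) + 8 * volume.real Ω * ‖p‖ ^ 2 := by
    have h3 : ∀ i j, normSq Ω (H i j) ≤ 2 * normSq Ω (fun x => H i j x - A i j)
        + 2 * (volume.real Ω * ‖p‖ ^ 2) := by
      intro i j
      have h4 := normSq_add_le ((hH i j).sub_const hb (A i j)).memLp (memLp_const (A i j))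
      simp only [sub_add_cancel] at h4
      have h5 := normSq_le_of_abs_le (f := fun _ => A i j) hb
        fun x _ => QuadCoeff.abs_matrix_le p i j
      have h6 : normSq Ω (H i j) ≤ _ := h4
      linarith
    have h4 : energy₂ Ω H ≤ ∑ i, ∑ j, (2 * normSq Ω (fun x => H i j x - A i j)
        + 2 * (volume.real Ω * ‖p‖ ^ 2)) :=
      Finset.sum_le_sum fun i _ => Finset.sum_le_sum fun j _ => h3 i j
    refine h4.trans ?_
    simp only [Fin.sum_univ_two] at kH ⊢
    linarith
  have hX : 0 ≤ 2 * M + 8 * volume.real Ω := by positivity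
  have k3 := mul_le_mul_of_nonneg_left kp hX
  linarith

end LowerOrder

/-! ### The global estimate -/

section Global

variable {Ω : Set Plane} {u : Plane → ℝ} {g : Fin 2 → Plane → ℝ} {H : Fin 2 → Fin 2 → Plane → ℝ}
  {S : Fin 2 → Fin 2 → Fin 2 → Plane → ℝ}

namespace Triangulation

variable (T : Triangulation Ω)

theorem energy_eq_sum (hΩ : interior (closure Ω) = Ω) (hu : HasGrad Ω u g) :
    energy Ω g = ∑ K ∈ T.elems, energy (interior (elem K)) g := by
  unfold energy
  rw [Finset.sum_comm]
  exact Finset.sum_congr rfl fun i _ => T.normSq_eq_sum hΩ (hu.grad_memLp i)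

theorem energy₂_eq_sum (hΩ : interior (closure Ω) = Ω) (hg : ∀ i, HasGrad Ω (g i) (H i)) :
    energy₂ Ω H = ∑ K ∈ T.elems, energy₂ (interior (elem K)) H := by
  unfold energy₂
  rw [Finset.sum_comm]
  exact Finset.sum_congr rfl fun i _ => T.energy_eq_sum hΩ (hg i)

theorem energy₃_eq_sum (hΩ : interior (closure Ω) = Ω) (hH : ∀ i j, HasGrad Ω (H i j) (S i j)) :
    energy₃ Ω S = ∑ K ∈ T.elems, energy₃ (interior (elem K)) S := by
  unfold energy₃
  rw [Finset.sum_comm]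
  exact Finset.sum_congr rfl fun i _ => T.energy₂_eq_sum hΩ (hH i)

end Triangulation

theorem normSq_interior_elem_union_le {K L : Finset Plane} (hP : FormParallelogram K L)
    {f : Plane → ℝ} (hK : MemLp f 2 (volume.restrict (interior (elem K))))
    (hL : MemLp f 2 (volume.restrict (interior (elem L)))) :
    normSq (interior (elem K ∪ elem L)) f
      ≤ normSq (interior (elem K)) f + normSq (interior (elem L)) f := by
  obtain ⟨a, b, c, e₁, e₂⟩ := hP.exists_eq
  have hae : (interior (elem K ∪ elem L) : Set Plane) =ᵐ[volume]
      (interior (elem K) ∪ interior (elem L) : Set Plane) :=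
    (interior_ae_eq (convex_elem_union e₁ e₂)).trans
      ((interior_ae_eq (convex_elem K)).union (interior_ae_eq (convex_elem L))).symm
  unfold normSq
  rw [setIntegral_congr_set hae, ← integral_add_measure hK.integrable_sq hL.integrable_sq]
  exact integral_mono_measure (Measure.restrict_union_le _ _)
    (Eventually.of_forall fun x => sq_nonneg _) (hK.integrable_sq.add_measure hL.integrable_sq)

theorem Triangulation.Uniform.abs_integral_interpError_le {T : Triangulation Ω} (hT : T.Uniform)
    (hΩo : IsOpen Ω) (hΩ : interior (closure Ω) = Ω) {C : ℝ}
    (hC : ∀ f g, HasGrad Ω f g → ∑ K ∈ T.boundaryElems, normSq (interior (elem K)) f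
        ≤ C * T.meshSize * (normSq Ω f + energy Ω g))
    (hu : HasGrad Ω u g) (hg : ∀ i, HasGrad Ω (g i) (H i)) (hH : ∀ i j, HasGrad Ω (H i j) (S i j))
    (hsymm : ∀ i j, H i j = H j i) (hC0 : 0 ≤ C) :
    |∫ x in Ω, (u x - PiCR T.elems u x) * (u x - PiZero T.elems u x)|
      ≤ (24 + 4 * C) * T.meshSize ^ 4 * (energy Ω g + energy₂ Ω H + energy₃ Ω S) := by
  set h := T.meshSize with hh
  have h0 : 0 ≤ h := T.meshSize_nonneg
  have hsub : ∀ K ∈ T.elems, interior (elem K) ⊆ Ω := fun K hK => T.interior_elem_subset hΩ hK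
  set B : Finset Plane → ℝ := fun K => errForm (interior (elem K)) u g u with hB
  set e : Finset Plane → ℝ := fun K => energy (interior (elem K)) g + energy₂ (interior (elem K)) H
    + energy₃ (interior (elem K)) S with he
  have hmain : ∫ x in Ω, (u x - PiCR T.elems u x) * (u x - PiZero T.elems u x)
      = ∑ K ∈ T.elems, B K := by
    rw [T.setIntegral_eq_iUnion hΩ]
    exact integral_iUnion_elem_eq_sum T.isTriangle
      (fun K hK L hL hKL => T.volume_inter_eq_zero hK hL hKL)
      (fun K hK => hu.mono (hsub K hK)) (fun K hK => hu.mono (hsub K hK))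
  have hadj : ∀ K ∈ T.elems, ∀ L ∈ T.neighbors K, |B K + B L| ≤ 24 * h ^ 4 * (e K + e L) := by
    intro K hK L hLn
    have hL := (T.mem_neighbors.1 hLn).1
    have hP := hT.formParallelogram hK hLn
    have hKL := T.interior_elem_union_subset hΩ hK hL
    refine (abs_errForm_parallelogram_le (T.isTriangle K hK) (T.isTriangle L hL) hP h0
      (T.dist_le_meshSize hK) (T.dist_le_meshSize hL) (hu.mono hKL) (fun i => (hg i).mono hKL)
      (fun i j => (hH i j).mono hKL) hsymm).trans ?_
    refine mul_le_mul_of_nonneg_left ?_ (by positivity)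
    have k1 : ∀ {f : Plane → ℝ} {g' : Fin 2 → Plane → ℝ}, HasGrad Ω f g' →
        energy (interior (elem K ∪ elem L)) g'
          ≤ energy (interior (elem K)) g' + energy (interior (elem L)) g' := by
      intro f g' hf
      unfold energy
      rw [← Finset.sum_add_distrib]
      exact Finset.sum_le_sum fun i _ => normSq_interior_elem_union_le hP
        ((hf.mono (hsub K hK)).grad_memLp i) ((hf.mono (hsub L hL)).grad_memLp i)
    have k2 : ∀ {f : Fin 2 → Plane → ℝ} {g' : Fin 2 → Fin 2 → Plane → ℝ},
        (∀ i, HasGrad Ω (f i) (g' i)) → energy₂ (interior (elem K ∪ elem L)) g'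
          ≤ energy₂ (interior (elem K)) g' + energy₂ (interior (elem L)) g' := by
      intro f g' hf
      unfold energy₂
      rw [← Finset.sum_add_distrib]
      exact Finset.sum_le_sum fun i _ => k1 (hf i)
    have k3 : energy₃ (interior (elem K ∪ elem L)) S
          ≤ energy₃ (interior (elem K)) S + energy₃ (interior (elem L)) S := by
      unfold energy₃
      rw [← Finset.sum_add_distrib]
      exact Finset.sum_le_sum fun i _ => k2 (hH i)
    have := k1 hu
    have := k2 hg
    simp only [he]
    linarith
  have he0 : ∀ K ∈ T.elems, 0 ≤ e K := fun K _ =>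
    add_nonneg (add_nonneg (energy_nonneg _ _) (energy₂_nonneg _ _)) (energy₃_nonneg _ _)
  have hsum : ∑ K ∈ T.elems, e K = energy Ω g + energy₂ Ω H + energy₃ Ω S := by
    rw [T.energy_eq_sum hΩ hu, T.energy₂_eq_sum hΩ hg, T.energy₃_eq_sum hΩ hH,
      ← Finset.sum_add_distrib, ← Finset.sum_add_distrib]
  have b1 : ∀ {f : Fin 2 → Plane → ℝ} {g' : Fin 2 → Fin 2 → Plane → ℝ},
      (∀ i, HasGrad Ω (f i) (g' i)) → ∑ K ∈ T.boundaryElems, energy (interior (elem K)) f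
        ≤ C * h * (energy Ω f + energy₂ Ω g') := by
    intro f g' hf
    unfold energy₂
    simp only [energy]
    rw [Finset.sum_comm, ← Finset.sum_add_distrib, Finset.mul_sum]
    exact Finset.sum_le_sum fun i _ => hC _ _ (hf i)
  have b2 : ∑ K ∈ T.boundaryElems, energy₂ (interior (elem K)) H
        ≤ C * h * (energy₂ Ω H + energy₃ Ω S) := by
    unfold energy₃
    simp only [energy₂]
    rw [Finset.sum_comm, ← Finset.sum_add_distrib, Finset.mul_sum]
    exact Finset.sum_le_sum fun i _ => b1 (hH i)
  -- On boundary elements only the `h³` estimate is available; the strip bounds `b1` and `b2` supply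
  -- the fourth power.
  have hbd : ∑ K ∈ T.boundaryElems, |B K| ≤ 2 * h ^ 3 *
      (∑ K ∈ T.boundaryElems, energy (interior (elem K)) g
        + ∑ K ∈ T.boundaryElems, energy₂ (interior (elem K)) H) := by
    rw [← Finset.sum_add_distrib, Finset.mul_sum]
    refine Finset.sum_le_sum fun K hKb => ?_
    have hK := Triangulation.boundaryElems_subset hKb
    have k1 := abs_errForm_le (T.isTriangle K hK) h0 (T.dist_le_meshSize hK)
      (hu.mono (hsub K hK)) (fun i => (hg i).mono (hsub K hK)) (hu.mono (hsub K hK))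
    have k2 := two_mul_le_add_sq (√(energy₂ (interior (elem K)) H)) (√(energy (interior (elem K)) g))
    rw [Real.sq_sqrt (energy₂_nonneg _ _), Real.sq_sqrt (energy_nonneg _ _)] at k2
    refine k1.trans ?_
    have k3 := mul_le_mul_of_nonneg_left k2 (by positivity : 0 ≤ 2 * h ^ 3)
    linarith
  have hfin := hT.abs_sum_le hΩo (by positivity : 0 ≤ 24 * h ^ 4) he0 hadj
  rw [hmain]
  refine hfin.trans ?_
  rw [hsum]
  have k4 := mul_le_mul_of_nonneg_left (add_le_add (b1 hg) b2) (by positivity : 0 ≤ 2 * h ^ 3)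
  have k5 : 0 ≤ C * h ^ 4 * (energy Ω g) := mul_nonneg (by positivity) (energy_nonneg _ _)
  have k6 : 0 ≤ C * h ^ 4 * (energy₃ Ω S) := mul_nonneg (by positivity) (energy₃_nonneg _ _)
  nlinarith

/-- The tensor of third derivatives lists each mixed derivative three times, the semi-norm only
once. -/
theorem energy₃_weakDeriv_le (Ω : Set Plane) (u : Plane → ℝ) :
    energy₃ Ω (fun i j k => weakDeriv Ω ((0, 0) + unitIndex i + unitIndex j + unitIndex k) u)
      ≤ 3 * sobolevSeminorm 3 Ω u ^ 2 := by
  rw [sobolevSeminorm, Real.sq_sqrt (Finset.sum_nonneg fun _ _ => integral_nonneg fun _ => sq_nonneg _),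
    Finset.Nat.sum_antidiagonal_eq_sum_range_succ_mk]
  simp only [energy₃, energy₂, energy, Fin.sum_univ_two, Finset.sum_range_succ, Finset.sum_range_zero]
  have k0 := normSq_nonneg Ω (weakDeriv Ω (3, 0) u)
  have k3 := normSq_nonneg Ω (weakDeriv Ω (0, 3) u)
  simp only [unitIndex, normSq] at *
  norm_num at *
  linarith

theorem Triangulation.exists_abs_integral_interpError_le (T₀ : Triangulation Ω) (hΩo : IsOpen Ω)
    (hΩc : IsConnected Ω) (hb : Bornology.IsBounded Ω) (hΩ : interior (closure Ω) = Ω) :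
    ∃ C : ℝ, 0 < C ∧ ∀ T : Triangulation Ω, T.Uniform → ∀ u : Plane → ℝ, MemSobolev 3 Ω u →
      MemH10 Ω u → |∫ x in Ω, (u x - PiCR T.elems u x) * (u x - PiZero T.elems u x)|
        ≤ C * T.meshSize ^ 4 * sobolevSeminorm 3 Ω u ^ 2 := by
  obtain ⟨C₁, hC₁, h₁⟩ := exists_sum_boundaryElems_normSq_le hΩo hΩ T₀
  obtain ⟨C₂, hC₂, h₂⟩ := T₀.exists_energy_add_energy₂_le hΩo hΩc hb hΩ
  refine ⟨(24 + 4 * C₁) * ((C₂ + 1) * 3), by positivity, fun T hT u hu hu0 => ?_⟩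
  obtain ⟨-, φ, hφ, hlim⟩ := hu0
  -- The chosen derivative of order zero equals `u` only almost everywhere, so it has to be
  -- exchanged for `u` itself.
  have hgrad := (hu.hasGrad_weakDeriv (0, 0) (by norm_num)).congr (hu.weakDeriv_zero_ae_eq hΩo)
    fun _ => ae_eq_refl _
  have hsum : ∀ i : Fin 2, (unitIndex i).1 + (unitIndex i).2 = 1 := by
    intro i; fin_cases i <;> rfl
  have hg := fun i => hu.hasGrad_weakDeriv ((0, 0) + unitIndex i) (by
    have := hsum i
    simp only [Prod.fst_add, Prod.snd_add]
    omega)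
  have hH := fun i j => hu.hasGrad_weakDeriv ((0, 0) + unitIndex i + unitIndex j) (by
    have := hsum i
    have := hsum j
    simp only [Prod.fst_add, Prod.snd_add]
    omega)
  -- The chosen derivatives depend on the multi-index alone, so the Hessian is symmetric as an
  -- equality of functions.
  have hsymm : ∀ i j, weakDeriv Ω ((0, 0) + unitIndex i + unitIndex j) u
      = weakDeriv Ω ((0, 0) + unitIndex j + unitIndex i) u := fun i j => by rw [add_right_comm]
  obtain ⟨t1, t2⟩ := (tendsto_sobolevNorm_one_iff hΩo hb hgrad fun n => (hφ n).1).1 hlim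
  have k1 := hT.abs_integral_interpError_le hΩo hΩ (h₁ T) hgrad hg hH hsymm hC₁
  have k2 := h₂ _ _ _ _ hgrad hg hH hsymm φ hφ t1 t2
  have k3 := energy₃_weakDeriv_le Ω u
  refine k1.trans ?_
  have e : (24 + 4 * C₁) * ((C₂ + 1) * 3) * T.meshSize ^ 4 * sobolevSeminorm 3 Ω u ^ 2
      = (24 + 4 * C₁) * T.meshSize ^ 4 * ((C₂ + 1) * (3 * sobolevSeminorm 3 Ω u ^ 2)) := by ring
  rw [e]
  refine mul_le_mul_of_nonneg_left ?_ (by positivity)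
  have k4 := mul_le_mul_of_nonneg_left k3 (by positivity : 0 ≤ C₂ + 1)
  linarith

end Global

end CRMesh

end

theorem lemma3p5 :
    (∀ K₁ K₂ : Finset Plane, CRMesh.IsTriangle K₁ → CRMesh.IsTriangle K₂ →
      CRMesh.FormParallelogram K₁ K₂ →
      ∀ w v : Plane → ℝ, CRMesh.IsPoly 2 w → CRMesh.IsPoly 1 v →
        ∫ x in CRMesh.elem K₁ ∪ CRMesh.elem K₂,
          (w x - CRMesh.PiCR {K₁, K₂} w x) * (v x - CRMesh.PiZero {K₁, K₂} v x) = 0) ∧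
    (∀ Ω : Set Plane, IsOpen Ω → IsConnected Ω → Bornology.IsBounded Ω →
      interior (closure Ω) = Ω →
      ∀ γ : ℝ, 0 < γ → ∃ C : ℝ, 0 < C ∧
        ∀ T : CRMesh.Triangulation Ω, T.Uniform → T.ShapeRegular γ →
          ∀ u : Plane → ℝ, CRMesh.MemSobolev 3 Ω u → CRMesh.MemH10 Ω u →
            |∫ x in Ω, (u x - CRMesh.PiCR T.elems u x) * (u x - CRMesh.PiZero T.elems u x)| ≤
              C * T.meshSize ^ 4 * CRMesh.sobolevSeminorm 3 Ω u ^ 2) := by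
  refine ⟨fun K₁ K₂ h₁ h₂ hP w v hw hv => hP.integral_interpError_eq_zero h₁ h₂ hw hv,
    fun Ω hΩo hΩc hb hΩ γ _ => ?_⟩
  -- That `Ω` is polygonal enters through the existence of a triangulation. If there is one, the
  -- constant is built from a fixed choice of it; if there is none, the estimate is vacuous.
  by_cases hT : Nonempty (CRMesh.Triangulation Ω)
  · obtain ⟨C, hC, h⟩ := hT.some.exists_abs_integral_interpError_le hΩo hΩc hb hΩ
    exact ⟨C, hC, fun T hTu _ => h T hTu⟩
  · exact ⟨1, one_pos, fun T => (hT ⟨T⟩).elim⟩
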